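/- Let $k$ be an algebraically closed field of characteristic $p>0$ and let $r\ge 1$. **Hyperalgebra.** Let $X,Y,H$ be the standard basis of $\mathfrak{sl}_2(\mathbb C)$, write $X^{(m)}=X^m/m!$, $Y^{(m)}=Y^m/m!$ and $\binom{H+c}{m}=\frac{(H+c)(H+c-1)\cdots(H+c-m+1)}{m!}$ for $c\in\mathbb Z$. Let $\mathcal U_{\mathbb Z}$ be the subring of the universal enveloping algebra of $\mathfrak{sl}_2(\mathbb C)$ generated by all $X^{(m)},Y^{(m)}$ ($m\ge 0$), and let $\mathcal U=\mathcal U_{\mathbb Z}\otimes_{\mathbb Z}k$, which has the $k$-basis $Y^{(m)}\binom Hn X^{(m')}$ ($m,n,m'\ge 0$). Let $\mathcal U_r\subseteq\mathcal U$ be the subalgebra generated by $X^{(p^i)},Y^{(p^i)}$ ($0\le i<r$), let $\mathcal A\subseteq\mathcal U$ be the subalgebra generated by all $\binom{H}{p^i}$ and $Y^{(p^i)}X^{(p^i)}$ ($i\ge0$), and let $\mathcal A_r=\mathcal A\cap\mathcal U_r$ (the elements of degree $0$ in $\mathcal U_r$). Let $\mathrm{Fr}':\mathcal U\to\mathcal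 U$ be the $k$-linear map with $Y^{(m)}\binom Hn X^{(m')}\mapsto Y^{(mp)}\binom H{np}X^{(m'p)}$. **The elements for $r=1$.** Put $\mu_a=\binom{H-a-1}{p-1}\in\mathcal U$. If $p$ is odd, let $\mathcal S=\{0,1,\dots,(p-1)/2\}$, $\mathcal P=\{0,\dots,p-1\}\times\mathcal S$ and, in $\mathbb F_p[x]$, $\varphi_{a,m}(x)=\prod_{i=0}^{m-1}(x-i(i+a+1))$, $\psi(x)=\prod_{i\in\mathbb F_p}(x-i^2)$, $\psi^{(1)}_j(x)=\psi(x)/(x-j^2)$, $\psi^{(0)}_0(x)=\prod_{i\in\mathbb F_p^\times}(x-i^2)$ and $\psi^{(0)}_j(x)=2x(x+j^2)\prod_{i\in\mathbb F_p^\times\setminus\{j,-j\}}(x-i^2)$ for $j\in\mathcal S\setminus\{0\}$. For $\varepsilon\in\{0,1\}$ and $(a,j)\in\mathcal P$ set $$B^{(\varepsilon)}(a,j)=\psi^{(\varepsilon)}_j\Big(\mu_aYX+\big(\tfrac{a+1}2\big)^2\Big)\mu_a ,$$ and let $n^{(\varepsilon)}(a,j)$ be the largest $n\ge0$ with $\varphi_{a,n}(x)\mid\psi^{(\varepsilon)}_j\big(x+(\tfrac{a+1}2)^2\big)$.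 If $p=2$, let $\mathcal P=\{(0,\tfrac12),(1,0),(1,1)\}$, $B^{(0)}(0,\tfrac12)=\mu_0$, $B^{(1)}(0,\tfrac12)=\mu_0YX$, $B^{(0)}(1,0)=B^{(1)}(1,0)=\mu_1YX$, $B^{(0)}(1,1)=B^{(1)}(1,1)=\mu_1YX+\mu_1$, and $n^{(0)}(0,\tfrac12)=0$, $n^{(1)}(0,\tfrac12)=1$, $n^{(\varepsilon)}(1,0)=1$, $n^{(\varepsilon)}(1,1)=0$. In all cases there are unique $c^{(\varepsilon)}_m\in\mathbb F_p$ with $B^{(\varepsilon)}(a,j)=\mu_a\sum_{m=n^{(\varepsilon)}(a,j)}^{p-1}c^{(\varepsilon)}_mY^mX^m$. **The elements for general $r$.** Call $(a,j)\in\mathcal P$ *of shifted type* if: $p$ is odd, $a$ is even and $j\ge(p-a+1)/2$; or $p$ is odd, $a$ is odd and $j\le(a-1)/2$; or $p=2$ and $(a,j)=(1,0)$. In these three cases put $s(a,j)=(p-a+1)/2$, $(p-a)/2$, $1$ respectively. For $z\in\mathcal U$ put $$Z^{(\varepsilon)}(z;(a,j))=\mu_a\sum_{m=n^{(\varepsilon)}(a,j)}^{p-1}c^{(\varepsilon)}_m\,Y^mX^{m-s(a,j)}\,\mathrm{Fr}'(z)\,X^{s(a,j)}$$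 if $(a,j)$ is of shifted type, and $Z^{(\varepsilon)}(z;(a,j))=\mathrm{Fr}'(z)B^{(\varepsilon)}(a,j)$ otherwise. For $(\boldsymbol a,\boldsymbol j)=((a_i,j_i))_{i=0}^{r-1}\in\mathcal P^r$ and $\boldsymbol\varepsilon=(\varepsilon_0,\dots,\varepsilon_{r-1})\in\{0,1\}^r$ let $B^{(\boldsymbol\varepsilon)}(\boldsymbol a,\boldsymbol j)=B^{(\varepsilon_0)}(a_0,j_0)$ if $r=1$, and $$B^{(\boldsymbol\varepsilon)}(\boldsymbol a,\boldsymbol j)=Z^{(\varepsilon_0)}\Big(B^{(\varepsilon_1,\dots,\varepsilon_{r-1})}\big((a_i,j_i)_{i=1}^{r-1}\big);(a_0,j_0)\Big)$$ if $r\ge2$. Put $E(\boldsymbol a,\boldsymbol j)=B^{(0,\dots,0)}(\boldsymbol a,\boldsymbol j)$. Let $\mathcal X_r(\boldsymbol a,\boldsymbol j)$ be the set of $\boldsymbol\varepsilon\in\{0,1\}^r$ with $\varepsilon_i=0$ whenever $j_i=0$ (if $p$ is odd), respectively whenever $a_i=1$ (if $p=2$), and let $\boldsymbol\tau$ be its largest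 element, i.e. $\tau_i=0$ exactly for those $i$. **Theorem 3.13.** For every $(\boldsymbol a,\boldsymbol j)\in\mathcal P^r$, the element $E(\boldsymbol a,\boldsymbol j)$ is an idempotent of $\mathcal A_r$, and the $k$-algebra $\mathcal A_r\cdot E(\boldsymbol a,\boldsymbol j)$, with unit $E(\boldsymbol a,\boldsymbol j)$, is symmetric: it is finite-dimensional and has a linear functional $f$ with $f(xy)=f(yx)$ for all $x,y$ whose kernel contains no nonzero left ideal. More precisely, the elements $B^{(\boldsymbol\varepsilon)}(\boldsymbol a,\boldsymbol j)$ with $\boldsymbol\varepsilon\in\mathcal X_r(\boldsymbol a,\boldsymbol j)$ form a $k$-basis of $\mathcal A_r\cdot E(\boldsymbol a,\boldsymbol j)$, and the functional that sends an element to its coefficient of $B^{(\boldsymbol\tau)}(\boldsymbol a,\boldsymbol j)$ in this basis is such an $f$. -/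

import Mathlib

open scoped TensorProduct Nat

/-! ### Symmetric algebras -/

section SymmetricAlgebras

variable {k R : Type*} [Field k] [Ring R] [Algebra k R]

/-- `f : R → k` is a symmetrizing form: `f (x y) = f (y x)`, and the kernel of `f` contains no
nonzero left ideal (equivalently, `(x, y) ↦ f (x y)` is a nondegenerate symmetric associative
bilinear form). -/
structure IsSymmetrizingForm (f : R →ₗ[k] k) : Prop where
  symm : ∀ x y : R, f (x * y) = f (y * x)
  no_ideal : ∀ I : Ideal R, (∀ x ∈ I, f x = 0) → I = ⊥

variable (k R) in
/-- A symmetric `k`-algebra: a finite-dimensional `k`-algebra with a symmetrizing form. -/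
def IsSymmetricKAlgebra : Prop :=
  Module.Finite k R ∧ ∃ f : R →ₗ[k] k, IsSymmetrizingForm f

/-- For an idempotent `e` of a `k`-algebra `R`, the ring `e R e` with unit `e` is a `k`-algebra,
with scalar multiplication `c • x` inherited from `R`. -/
noncomputable instance cornerAlgebra {e : R} (he : IsIdempotentElem e) : Algebra k he.Corner where
  smul c x := ⟨c • x.1, by
    obtain ⟨z, hz⟩ := x.2
    exact ⟨c • z, by rw [← hz]; simp⟩⟩
  algebraMap :=
    { toFun := fun c => ⟨c • e, c • e, by simp [he.eq]⟩
      map_one' := Subtype.ext (one_smul k e)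
      map_mul' := fun c d => Subtype.ext (by
        change (c * d) • e = (c • e) * (d • e)
        rw [smul_mul_smul_comm, he.eq])
      map_zero' := Subtype.ext (zero_smul k e)
      map_add' := fun c d => Subtype.ext (add_smul c d e) }
  commutes' c x := Subtype.ext (by
    have h := (Subsemigroup.mem_corner_iff he).mp x.2
    change (c • e) * x.1 = x.1 * (c • e)
    simp [h.1, h.2])
  smul_def' c x := Subtype.ext (by
    have h := (Subsemigroup.mem_corner_iff he).mp x.2
    change c • x.1 = (c • e) * x.1
    simp [h.1])

end SymmetricAlgebras

/-! ### The hyperalgebra of `SL₂` -/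

namespace SL2Hyper

/-- The complex Lie algebra `sl₂`. -/
abbrev sl2 : Type := LieAlgebra.SpecialLinear.sl (Fin 2) ℂ

/-- The universal enveloping algebra of the complex Lie algebra `sl₂`. -/
abbrev UC : Type := UniversalEnvelopingAlgebra ℂ sl2

/-- `X = !![0, 1; 0, 0]` in the enveloping algebra. -/
noncomputable def XC : UC :=
  UniversalEnvelopingAlgebra.ι ℂ (LieAlgebra.SpecialLinear.single 0 1 (by decide) (1 : ℂ))

/-- `Y = !![0, 0; 1, 0]` in the enveloping algebra. -/
noncomputable def YC : UC :=
  UniversalEnvelopingAlgebra.ι ℂ (LieAlgebra.SpecialLinear.single 1 0 (by decide) (1 : ℂ))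

/-- `H = !![1, 0; 0, -1]` in the enveloping algebra. -/
noncomputable def HC : UC :=
  UniversalEnvelopingAlgebra.ι ℂ (LieAlgebra.SpecialLinear.singleSubSingle 0 1 (1 : ℂ))

/-- The divided power `u ^ m / m!`. -/
noncomputable def dividedPow (u : UC) (m : ℕ) : UC := ((m ! : ℂ)⁻¹) • u ^ m

/-- `binom(H + c, m) = (H + c)(H + c - 1) ⋯ (H + c - m + 1) / m!`. -/
noncomputable def binomHC (c : ℤ) (m : ℕ) : UC :=
  ((m ! : ℂ)⁻¹) • Polynomial.aeval (HC + algebraMap ℤ UC c) (descPochhammer ℤ m)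

/-- The `ℤ`-form of the enveloping algebra: the subring generated by all `X^(m)` and `Y^(m)`. -/
noncomputable def UZ : Subalgebra ℤ UC :=
  Algebra.adjoin ℤ (Set.range (dividedPow XC) ∪ Set.range (dividedPow YC))

section Field

variable (k : Type*) [Field k]

/-- The hyperalgebra of `SL₂` over `k`. -/
def U : Type _ := k ⊗[ℤ] UZ

noncomputable instance : Ring (U k) := inferInstanceAs (Ring (k ⊗[ℤ] UZ))

noncomputable instance : Algebra k (U k) := inferInstanceAs (Algebra k (k ⊗[ℤ] UZ))

open Classical in
/-- The image in `U` of an element of the `ℤ`-form. It is only ever applied to `X^(m)`, `Y^(m)`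
and `binom(H + c, m)`, all of which lie in the `ℤ`-form (elsewhere: junk value `0`). -/
noncomputable def ofUC (u : UC) : U k :=
  if h : u ∈ UZ then ((1 : k) ⊗ₜ[ℤ] (⟨u, h⟩ : UZ) : k ⊗[ℤ] UZ) else 0

/-- `X^(m)` in `U`. -/
noncomputable def Xd (m : ℕ) : U k := ofUC k (dividedPow XC m)

/-- `Y^(m)` in `U`. -/
noncomputable def Yd (m : ℕ) : U k := ofUC k (dividedPow YC m)

/-- `binom(H + c, m)` in `U`. -/
noncomputable def binomH (c : ℤ) (m : ℕ) : U k := ofUC k (binomHC c m)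

/-- The basis element `Y^(m) binom(H, n) X^(m')` of `U`, indexed by `(m, n, m')`. -/
noncomputable def pbw (t : ℕ × ℕ × ℕ) : U k := Yd k t.1 * binomH k 0 t.2.1 * Xd k t.2.2

/-- The coordinates of an element of `U` in the basis `pbw` (the inverse of the bijective map
`(ℕ × ℕ × ℕ →₀ k) → U`, `v ↦ ∑ t, v t • pbw t`). -/
noncomputable def pbwCoord : U k →ₗ[k] (ℕ × ℕ × ℕ →₀ k) :=
  (Finsupp.linearCombination k (pbw k)).leftInverse

/-- The `k`-linear map `Fr'` with
`Y^(m) binom(H, n) X^(m') ↦ Y^(m p) binom(H, n p) X^(m' p)`. -/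
noncomputable def Fr' (p : ℕ) : U k →ₗ[k] U k :=
  Finsupp.linearCombination k (fun t : ℕ × ℕ × ℕ => pbw k (t.1 * p, t.2.1 * p, t.2.2 * p)) ∘ₗ
    pbwCoord k

/-- The subalgebra `U_r`, generated by `X^(p^i)`, `Y^(p^i)` with `i < r`. -/
noncomputable def Ur (p r : ℕ) : Subalgebra k (U k) :=
  Algebra.adjoin k {u | ∃ i < r, u = Xd k (p ^ i) ∨ u = Yd k (p ^ i)}

/-- The subalgebra `U⁰`, generated by `binom(H, p^i)` with `i ≥ 0`. -/
noncomputable def Uzero (p : ℕ) : Subalgebra k (U k) :=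
  Algebra.adjoin k {u | ∃ i : ℕ, u = binomH k 0 (p ^ i)}

/-- The subalgebra `A` of `U`, generated by `U⁰` and all `Y^(p^i) X^(p^i)`. -/
noncomputable def A (p : ℕ) : Subalgebra k (U k) :=
  Algebra.adjoin k ((Uzero k p : Set (U k)) ∪ {u | ∃ i : ℕ, u = Yd k (p ^ i) * Xd k (p ^ i)})

/-- `A_r = A ∩ U_r`. -/
noncomputable def Ar (p r : ℕ) : Subalgebra k (U k) := A k p ⊓ Ur k p r

end Field

/-! ### The polynomials over `F_p` and the index set `P` -/

section Combinatorics

open Polynomial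

variable (p : ℕ) [Fact p.Prime]

/-- `φ_{a,m}(x) = ∏_{i < m} (x - i (i + a + 1))`. -/
noncomputable def phi (a m : ℕ) : (ZMod p)[X] :=
  ∏ i ∈ Finset.range m, (X - C ((i : ZMod p) * (i + a + 1)))

/-- `ψ(x) = ∏_{i ∈ F_p} (x - i²)`. -/
noncomputable def psi : (ZMod p)[X] := ∏ i : ZMod p, (X - C (i ^ 2))

/-- `ψ_j^{(ε)}(x)` for `j ∈ F_p`. -/
noncomputable def psiEps (ε : Fin 2) (j : ZMod p) : (ZMod p)[X] :=
  if ε = 1 then psi p / (X - C (j ^ 2))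
  else if j = 0 then ∏ i ∈ Finset.univ.erase (0 : ZMod p), (X - C (i ^ 2))
  else 2 * X * (X + C (j ^ 2)) * ∏ i ∈ Finset.univ \ {0, j, -j}, (X - C (i ^ 2))

/-- The index set `P` of pairs `(a, j)`. -/
def P : Set (ℕ × ℚ) :=
  if p = 2 then {(0, 1 / 2), (1, 0), (1, 1)}
  else {x | x.1 < p ∧ ∃ s : ℕ, s ≤ (p - 1) / 2 ∧ x.2 = s}

/-- `n^{(ε)}(a,j)`: for odd `p` the largest `n` such that `φ_{a,n}(x)` divides
`ψ_j^{(ε)}(x + ((a+1)/2)²)`. -/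
noncomputable def nEps (ε : Fin 2) (x : ℕ × ℚ) : ℕ :=
  if p = 2 then
    if x = (0, 1 / 2) then (if ε = 0 then 0 else 1)
    else if x = (1, 0) then 1 else 0
  else sSup {n | phi p x.1 n ∣
    (psiEps p ε (x.2 : ZMod p)).comp (X + C ((((x.1 : ZMod p) + 1) / 2) ^ 2))}

/-- The shifted type of pairs `(a,j)`: for odd `p`, `a` is even and `(p - a + 1) / 2 ≤ j`, or `a` is
odd and `j ≤ (a - 1) / 2`; for `p = 2`, only `(1,0)`. -/
def IsShifted (x : ℕ × ℚ) : Prop :=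
  if p = 2 then x = (1, 0)
  else (Even x.1 ∧ ((p : ℚ) - x.1 + 1) / 2 ≤ x.2) ∨ (Odd x.1 ∧ x.2 ≤ ((x.1 : ℚ) - 1) / 2)

/-- `s(a,j)`, used only for pairs of shifted type (where all divisions and subtractions are exact). -/
def sShift (x : ℕ × ℚ) : ℕ :=
  if p = 2 then 1 else if Even x.1 then (p - x.1 + 1) / 2 else (p - x.1) / 2

/-- The condition under which `B^{(0)}(a,j) = B^{(1)}(a,j)`:
`j = 0` if `p` is odd, `a = 1` if `p = 2`. -/
def Degenerate (x : ℕ × ℚ) : Prop := if p = 2 then x.1 = 1 else x.2 = 0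

/-- The set `X_r(a,j) ⊆ {0,1}^r`. -/
def epsSet {r : ℕ} (aj : Fin r → ℕ × ℚ) : Set (Fin r → Fin 2) :=
  {ε | ∀ i, Degenerate p (aj i) → ε i = 0}

open Classical in
/-- The element `τ(a,j)` of `X_r(a,j)`. -/
noncomputable def tau {r : ℕ} (aj : Fin r → ℕ × ℚ) : epsSet p aj :=
  ⟨fun i => if Degenerate p (aj i) then 0 else 1, fun _ hi => if_pos hi⟩

end Combinatorics

/-! ### The elements `B^{(ε)}(a,j)` -/

section Elements

variable (k : Type*) [Field k] (p : ℕ) [Fact p.Prime] [CharP k p]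

/-- `μ_a = binom(H - a - 1, p - 1)`. -/
noncomputable def mu (a : ℕ) : U k := binomH k (-(a : ℤ) - 1) (p - 1)

/-- The inclusion `F_p → k`. -/
abbrev toField : ZMod p →+* k := ZMod.castHom (dvd_refl p) k

/-- `B^{(ε)}(a,j)` for a single pair `(a,j)`. -/
noncomputable def B1 (ε : Fin 2) (x : ℕ × ℚ) : U k :=
  if p = 2 then
    if x = (0, 1 / 2) then (if ε = 0 then mu k p 0 else mu k p 0 * Yd k 1 * Xd k 1)
    else if x = (1, 0) then mu k p 1 * Yd k 1 * Xd k 1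
    else mu k p 1 * Yd k 1 * Xd k 1 + mu k p 1
  else
    Polynomial.aeval
      (mu k p x.1 * Yd k 1 * Xd k 1 +
        algebraMap k (U k) (toField k p ((((x.1 : ZMod p) + 1) / 2) ^ 2)))
      ((psiEps p ε (x.2 : ZMod p)).map (toField k p)) * mu k p x.1

/-- The scalars `c_m ∈ F_p` (`n^{(ε)}(a,j) ≤ m ≤ p - 1`) in the expansion
`B^{(ε)}(a,j) = μ_a ∑_m c_m Y^m X^m`; they exist and are unique. -/
noncomputable def coeffB (ε : Fin 2) (x : ℕ × ℚ) : ℕ → ZMod p :=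
  Classical.epsilon fun c : ℕ → ZMod p =>
    B1 k p ε x = mu k p x.1 *
      ∑ m ∈ Finset.Icc (nEps p ε x) (p - 1), toField k p (c m) • (Yd k 1 ^ m * Xd k 1 ^ m)

open Classical in
/-- `Z^{(ε)}(z; (a,j))`. -/
noncomputable def Z (ε : Fin 2) (z : U k) (x : ℕ × ℚ) : U k :=
  if IsShifted p x then
    mu k p x.1 * ∑ m ∈ Finset.Icc (nEps p ε x) (p - 1),
      toField k p (coeffB k p ε x m) •
        (Yd k 1 ^ m * Xd k 1 ^ (m - sShift p x) * Fr' k p z * Xd k 1 ^ sShift p x)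
  else Fr' k p z * B1 k p ε x

/-- `B^{(ε)}(a,j)` for `r`-tuples, `r ≥ 1` (the value for `r = 0` is not used). -/
noncomputable def B : {r : ℕ} → (Fin r → Fin 2) → (Fin r → ℕ × ℚ) → U k
  | 0, _, _ => 1
  | 1, ε, aj => B1 k p (ε 0) (aj 0)
  | _ + 2, ε, aj => Z k p (ε 0) (B (fun i => ε i.succ) (fun i => aj i.succ)) (aj 0)

/-- `E(a,j) = B^{(0,…,0)}(a,j)`. -/
noncomputable def E {r : ℕ} (aj : Fin r → ℕ × ℚ) : U k := B k p (fun _ => 0) aj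

end Elements

end SL2Hyper

/-! All elements involved have degree zero, and the degree-zero part of the hyperalgebra is
commutative (`degSpan_commute`). So f(xy) = f(yx) is automatic, and the content is a basis with an
explicit multiplication table.

One Frobenius level. The Cartan part is modelled by functions on ℤ (`hel`), and μ_a becomes the
indicator function of the residue class of a modulo p (`mu_eq`). On that weight space a polynomial
in YX matters only modulo φ_{a,p}, because Y^p = 0 (`aeval_phiIco_mul`). For odd p, completing the
square turns φ_{a,p}(x) into ψ(x + ((a+1)/2)²) (`phiIco_prime_eq_psi_comp`). The root 0 of ψ is
simple and the roots j² ≠ 0 are double, so k[x]/ψ is a product of copies of k and of k[t]/t². Modulo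
ψ, ψ_j^{(0)} is the unit of the factor at j² and, for j ≠ 0, ψ_j^{(1)} spans its radical
(`psi_dvd_psiEps_zero_mul_sub`, `psi_dvd_psiEps_one_mul_self`). For p = 2 the same relations are
checked directly.

Passage to higher levels. `Fr'` is not multiplicative, but it becomes so after left multiplication
by an element that lies in one weight space and is killed by enough divided powers of Y
(`IsAdmissible.mul_Fr'_mul_Fr'`). The shift s(a,j) moves the weight a to 0 or 1 modulo p, where this
condition is easy; for the other pairs it follows because the block polynomial is divisible by the
polynomial of X^a Y^a (`exists_isAdmissible`). Hence Z inherits the relations of the case r = 1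
(`Z_zero_mul_Z`, `Z_one_mul_Z_one`, `Z_mul_Z_of_ne`). It is also injective in z, since the normal
form of its terms has exponents m + cp with m < p, from which m and c can be read off
(`eq_zero_of_zeta_eq_zero`).

Multiplication table and conclusion. By induction on r, B^ε B^ε' is B^{max(ε,ε')} when the supports
are disjoint and 0 when they meet at a nondegenerate index; products for different tuples vanish,
and no B^ε is zero. Multiplying a linear relation by B^{τ-ε} with ε minimal isolates one
coefficient, so the B's are independent (`linearIndependent_B`). There are at least p^{2r} of them,
while the PBW theorem bounds the dimension of A_r by p^{2r} (`mem_Ar_iff`), so they span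
(`mem_span_B`). Finally, B^{τ-ε} is dual to B^ε for the coefficient of B^τ (`coord_tau_mul`), so the
kernel of this functional contains no nonzero ideal.

The PBW basis rests on Kostant's commutation formula and integer-valued polynomials for spanning,
and on Verma modules for independence. -/

namespace SL2Hyper

/-! ### Divided powers and Kostant's formula for an sl₂-triple in a complex algebra. -/

section GenericTriple

open Polynomial

/-- The polynomial `binom(X, m)`. -/
noncomputable def binomPoly (m : ℕ) : ℂ[X] := C ((m ! : ℂ)⁻¹) * descPochhammer ℂ m

@[simp] lemma binomPoly_zero : binomPoly 0 = 1 := by simp [binomPoly]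

lemma binomPoly_succ_mul (m : ℕ) :
    C ((m : ℂ) + 1) * binomPoly (m + 1) = (X - C (m : ℂ)) * binomPoly m := by
  have h : ((m : ℂ) + 1) * ((m + 1) ! : ℂ)⁻¹ = (m ! : ℂ)⁻¹ := by
    rw [Nat.factorial_succ]
    have h1 : (m : ℂ) + 1 ≠ 0 := by exact_mod_cast Nat.succ_ne_zero m
    have h2 : (m ! : ℂ) ≠ 0 := by exact_mod_cast Nat.factorial_ne_zero m
    push_cast
    field_simp
  rw [binomPoly, binomPoly, descPochhammer_succ_right, ← mul_assoc, ← C_mul, h]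
  simp only [map_natCast]
  ring

lemma binomPoly_eval_int (m : ℕ) (n : ℤ) :
    (binomPoly m).eval (n : ℂ) = (Ring.choose n m : ℤ) := by
  have h := Ring.descPochhammer_eq_factorial_smul_choose n m
  rw [← eval_eq_smeval] at h
  have h2 : (descPochhammer ℂ m).eval (n : ℂ) = (((descPochhammer ℤ m).eval n : ℤ) : ℂ) := by
    rw [← descPochhammer_map (Int.castRingHom ℂ)]
    exact eval_intCast_map (Int.castRingHom ℂ) _ _
  have h3 : (m ! : ℂ) ≠ 0 := by exact_mod_cast Nat.factorial_ne_zero m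
  rw [binomPoly, eval_mul, eval_C, h2, h]
  push_cast [nsmul_eq_mul]
  field_simp

lemma binomPoly_natDegree (m : ℕ) : (binomPoly m).natDegree = m := by
  rw [binomPoly, natDegree_C_mul (inv_ne_zero (by exact_mod_cast Nat.factorial_ne_zero m)),
    descPochhammer_natDegree]

lemma binomPoly_leadingCoeff (m : ℕ) : (binomPoly m).leadingCoeff = (m ! : ℂ)⁻¹ := by
  rw [binomPoly, leadingCoeff_mul, leadingCoeff_C, (monic_descPochhammer ℂ m).leadingCoeff,
    mul_one]

lemma eq_of_eval_int_eq {f g : ℂ[X]} (h : ∀ n : ℤ, f.eval (n : ℂ) = g.eval (n : ℂ)) : f = g := by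
  refine eq_of_infinite_eval_eq f g ?_
  refine Set.Infinite.mono (s := Set.range (fun n : ℤ => (n : ℂ))) ?_
    (Set.infinite_range_of_injective Int.cast_injective)
  rintro _ ⟨n, rfl⟩
  exact h n

lemma binomPoly_comp_add_one (m : ℕ) :
    (binomPoly (m + 1)).comp (X + C 1) = binomPoly (m + 1) + binomPoly m := by
  refine eq_of_eval_int_eq fun n => ?_
  have := binomPoly_eval_int (m + 1) (n + 1)
  push_cast at this
  rw [eval_comp, eval_add, eval_add, eval_X, eval_C, this, binomPoly_eval_int, binomPoly_eval_int,
    Ring.choose_succ_succ]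
  push_cast
  ring

variable {R : Type*} [Ring R] [Algebra ℂ R]

/-- The divided power `u ^ m / m!` in a `ℂ`-algebra. -/
noncomputable def dpow (u : R) (m : ℕ) : R := ((m ! : ℂ)⁻¹) • u ^ m

@[simp] lemma dpow_zero (u : R) : dpow u 0 = 1 := by simp [dpow]

@[simp] lemma dpow_one (u : R) : dpow u 1 = u := by simp [dpow]

lemma mul_dpow (u : R) (m : ℕ) : u * dpow u m = ((m : ℂ) + 1) • dpow u (m + 1) := by
  have h1 : (m : ℂ) + 1 ≠ 0 := by exact_mod_cast Nat.succ_ne_zero m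
  have h2 : (m ! : ℂ) ≠ 0 := by exact_mod_cast Nat.factorial_ne_zero m
  rw [dpow, dpow, mul_smul_comm, ← pow_succ', smul_smul, Nat.factorial_succ]
  congr 1
  push_cast
  field_simp

lemma dpow_mul_dpow (u : R) (m n : ℕ) :
    dpow u m * dpow u n = ((m + n).choose m) • dpow u (m + n) := by
  rw [dpow, dpow, dpow, smul_mul_smul_comm, ← pow_add, ← Nat.cast_smul_eq_nsmul ℂ, smul_smul]
  congr 1
  have h := Nat.add_choose_mul_factorial_mul_factorial m n
  rw [Nat.choose_symm_add] at *
  have h1 : (m ! : ℂ) ≠ 0 := by exact_mod_cast Nat.factorial_ne_zero m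
  have h2 : (n ! : ℂ) ≠ 0 := by exact_mod_cast Nat.factorial_ne_zero n
  have h3 : ((m + n) ! : ℂ) ≠ 0 := by exact_mod_cast Nat.factorial_ne_zero _
  field_simp
  rw [← h]
  push_cast
  ring

variable {x y h : R}

/-- An element u of weight c translates every polynomial in h by c when moved across it. -/
lemma aeval_mul_of_mul_eq {c : ℂ} {u : R} (hu : h * u = u * (h + algebraMap ℂ R c)) (f : ℂ[X]) :
    aeval h f * u = u * aeval h (f.comp (X + C c)) := by
  rw [aeval_comp]
  simp only [map_add, aeval_X, aeval_C]
  induction f using Polynomial.induction_on' with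
  | add p q hp hq => simp only [map_add, add_mul, mul_add, hp, hq]
  | monomial n a =>
    simp only [aeval_monomial]
    have : h ^ n * u = u * (h + algebraMap ℂ R c) ^ n := by
      induction n with
      | zero => simp
      | succ n ih => rw [pow_succ, mul_assoc, hu, ← mul_assoc, ih, mul_assoc, ← pow_succ]
    rw [mul_assoc, this, ← mul_assoc, ← mul_assoc, Algebra.commutes a u]

lemma mul_pow_eq_of_mul_eq {c : ℂ} {u : R} (hu : h * u = u * (h + algebraMap ℂ R c)) (m : ℕ) :
    h * u ^ m = u ^ m * (h + algebraMap ℂ R (m * c)) := by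
  induction m with
  | zero => simp
  | succ m ih =>
    have e : ((m + 1 : ℕ) : ℂ) * c = c + m * c := by push_cast; ring
    rw [pow_succ, ← mul_assoc, ih, mul_assoc, add_mul, hu, Algebra.commutes, ← mul_add, add_assoc,
      ← map_add, mul_assoc, e]

lemma aeval_mul_dpow {c : ℂ} {u : R} (hu : h * u = u * (h + algebraMap ℂ R c)) (m : ℕ) (f : ℂ[X]) :
    aeval h f * dpow u m = dpow u m * aeval h (f.comp (X + C (m * c))) := by
  rw [dpow, mul_smul_comm, aeval_mul_of_mul_eq (mul_pow_eq_of_mul_eq hu m), smul_mul_assoc]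

/-- `y ^ (b - k) / (b - k)!` if `k ≤ b`, else `0`. -/
noncomputable def dpowSub (y : R) (b k : ℕ) : R := if k ≤ b then dpow y (b - k) else 0

lemma mul_dpow_of_triple (hy : h * y = y * (h + algebraMap ℂ R (-2))) (hxy : x * y = y * x + h)
    (b : ℕ) : x * dpow y (b + 1) = dpow y (b + 1) * x + dpow y b * (h - algebraMap ℂ R b) := by
  induction b with
  | zero => simp [hxy]
  | succ b ih =>
    have h1 : ((b + 1 : ℕ) : ℂ) + 1 ≠ 0 := by exact_mod_cast Nat.succ_ne_zero (b + 1)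
    -- Scaling by b + 2 lets y ^ (b+2) / (b+2)! be rewritten as y times the preceding divided power.
    refine smul_right_injective R h1 ?_
    have h2 : h * dpow y (b + 1) = dpow y (b + 1) * (h + algebraMap ℂ R ((b + 1 : ℕ) * (-2))) := by
      have := aeval_mul_dpow hy (b + 1) X
      simpa using this
    have e1 : ((b + 1 : ℕ) + 1 : ℂ) • dpow y (b + 1 + 1) = y * dpow y (b + 1) :=
      (mul_dpow y (b + 1)).symm
    have e2 : y * dpow y b = ((b : ℂ) + 1) • dpow y (b + 1) := mul_dpow y b
    simp only [smul_add, ← mul_smul_comm ((b + 1 : ℕ) + 1 : ℂ) x,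
      ← smul_mul_assoc ((b + 1 : ℕ) + 1 : ℂ) (dpow y (b + 1 + 1)), e1]
    rw [← mul_assoc, hxy, add_mul, mul_assoc, ih, mul_add, h2, ← mul_assoc, ← mul_assoc, e2,
      add_assoc]
    congr 1
    rw [smul_mul_assoc, ← mul_smul_comm, ← mul_smul_comm, ← mul_add]
    congr 1
    simp only [Algebra.algebraMap_eq_smul_one, smul_sub, smul_smul]
    push_cast
    module

lemma mul_dpowSub_of_triple (hy : h * y = y * (h + algebraMap ℂ R (-2))) (hxy : x * y = y * x + h)
    (b k : ℕ) : x * dpowSub y b k =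
      dpowSub y b k * x + dpowSub y b (k + 1) * (h + algebraMap ℂ R (k + 1 - b)) := by
  rcases lt_trichotomy k b with hk | rfl | hk
  · obtain ⟨c, rfl⟩ := Nat.exists_eq_add_of_lt hk
    have e1 : k + c + 1 - k = c + 1 := by omega
    have e2 : k + c + 1 - (k + 1) = c := by omega
    rw [dpowSub, dpowSub, if_pos hk.le, if_pos (Nat.succ_le_of_lt hk), e1, e2, mul_dpow_of_triple hy hxy,
      sub_eq_add_neg h, ← map_neg]
    congr 4
    push_cast
    ring
  · simp [dpowSub]
  · rw [dpowSub, dpowSub, if_neg (by omega), if_neg (by omega)]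
    simp

/-- This is the identity of H-coefficients behind Kostant's formula: two contributions to the term
of index k + 1 must add up to one shifted binomial. -/
lemma binomPoly_exchange (T : ℂ[X]) (k : ℕ) (a : ℂ) :
    C (a - k) * (binomPoly (k + 1)).comp T + (T + C (a - k + 1)) * (binomPoly k).comp T =
      C (a + 1) * (binomPoly (k + 1)).comp (T + C 1) := by
  have h1 := congrArg (fun f => f.comp T) (binomPoly_succ_mul k)
  have h2 := congrArg (fun f => f.comp T) (binomPoly_comp_add_one k)
  simp only [mul_comp, sub_comp, X_comp, C_comp, comp_assoc, add_comp] at h1 h2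
  rw [h2]
  simp only [C_add, C_sub, C_1] at h1 ⊢
  linear_combination (-1 : ℂ[X]) * h1

/-- Kostant's commutation formula. -/
theorem dpow_mul_dpow_of_triple (hx : h * x = x * (h + algebraMap ℂ R 2))
    (hy : h * y = y * (h + algebraMap ℂ R (-2))) (hxy : x * y = y * x + h) (a b : ℕ) :
    dpow x a * dpow y b = ∑ k ∈ Finset.range (a + 1), dpowSub y b k *
      aeval h ((binomPoly k).comp (X + C (2 * (k : ℂ) - a - b))) * dpow x (a - k) := by
  induction a with
  | zero => simp [dpowSub]
  | succ a ih =>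
    have h1 : (a : ℂ) + 1 ≠ 0 := by exact_mod_cast Nat.succ_ne_zero a
    refine smul_right_injective R h1 ?_
    change ((a : ℂ) + 1) • _ = ((a : ℂ) + 1) • _
    rw [← smul_mul_assoc, ← mul_dpow, mul_assoc, ih, Finset.mul_sum]
    -- Moving one more x through the k-th term yields a term with the same k and a correction with k
    -- + 1.
    have key : ∀ k ∈ Finset.range (a + 1), x * (dpowSub y b k *
        aeval h ((binomPoly k).comp (X + C (2 * (k : ℂ) - a - b))) * dpow x (a - k)) =
        ((a + 1 - k : ℂ) • (dpowSub y b k *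
          aeval h ((binomPoly k).comp (X + C (2 * (k : ℂ) - a - b - 2))) * dpow x (a + 1 - k))) +
        dpowSub y b (k + 1) * aeval h ((X + C (k + 1 - b : ℂ)) *
          (binomPoly k).comp (X + C (2 * (k : ℂ) - a - b))) * dpow x (a - k) := by
      intro k hk
      have hk' : k ≤ a := by simpa [Nat.lt_succ_iff] using hk
      obtain ⟨c, rfl⟩ := Nat.exists_eq_add_of_le hk'
      have e1 : k + c - k = c := by omega
      have e2 : k + c + 1 - k = c + 1 := by omega
      have e3 := aeval_mul_of_mul_eq hx ((binomPoly k).comp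
        (X + C (2 * (k : ℂ) - (k + c : ℕ) - b - 2)))
      rw [comp_assoc] at e3
      simp only [add_comp, X_comp, C_comp, add_assoc, ← C_add] at e3
      have e4 : (2 + (2 * (k : ℂ) - (k + c : ℕ) - b - 2)) = 2 * (k : ℂ) - (k + c : ℕ) - b := by
        ring
      rw [e4] at e3
      rw [e1, e2, ← mul_assoc, ← mul_assoc, mul_dpowSub_of_triple hy hxy, add_mul, add_mul]
      congr 1
      · rw [mul_assoc (dpowSub y b k), ← e3, mul_assoc, mul_assoc, mul_dpow, mul_smul_comm,
          mul_smul_comm, mul_assoc]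
        congr 1
        push_cast
        ring
      · rw [map_mul, map_add, aeval_X, aeval_C, mul_assoc (dpowSub y b (k + 1))]
    rw [Finset.sum_congr rfl key, Finset.sum_add_distrib]
    -- The coefficient a + 1 - k vanishes at k = a + 1, so the sum can be extended by one term and
    -- then matched with the corrections after an index shift.
    have e0 : ∑ k ∈ Finset.range (a + 1), ((a + 1 - k : ℂ) • (dpowSub y b k *
          aeval h ((binomPoly k).comp (X + C (2 * (k : ℂ) - a - b - 2))) * dpow x (a + 1 - k))) =
        ∑ k ∈ Finset.range (a + 1 + 1), ((a + 1 - k : ℂ) • (dpowSub y b k *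
          aeval h ((binomPoly k).comp (X + C (2 * (k : ℂ) - a - b - 2))) * dpow x (a + 1 - k))) := by
      rw [Finset.sum_range_succ _ (a + 1)]
      simp
    rw [e0, Finset.sum_range_succ' _ (a + 1), Finset.sum_range_succ' _ (a + 1), add_right_comm,
      ← Finset.sum_add_distrib, smul_add, Finset.smul_sum]
    congr 1
    · refine Finset.sum_congr rfl fun k _ => ?_
      have e2 : a + 1 - (k + 1) = a - k := by omega
      rw [e2, ← smul_mul_assoc (_ - _ : ℂ), ← smul_mul_assoc (_ + _ : ℂ), ← add_mul,
        ← mul_smul_comm, ← mul_smul_comm, ← map_smul, ← map_smul, ← mul_add, ← map_add]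
      congr 3
      have := binomPoly_exchange (X + C (2 * (k : ℂ) - a - b)) k a
      rw [smul_eq_C_mul, smul_eq_C_mul]
      have t1 : (2 * ((k + 1 : ℕ) : ℂ) - a - b - 2) = 2 * (k : ℂ) - a - b := by push_cast; ring
      have t2 : (2 * ((k + 1 : ℕ) : ℂ) - (a + 1 : ℕ) - b) = (2 * (k : ℂ) - a - b) + 1 := by
        push_cast; ring
      have t3 : (a + 1 - ((k + 1 : ℕ) : ℂ)) = a - k := by push_cast; ring
      have t4 : (k + 1 - b : ℂ) = (2 * (k : ℂ) - a - b) + (a - k + 1) := by ring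
      rw [t1, t2, t3, t4, C_add (a := (2 * (k : ℂ) - a - b)) (b := (a - k + 1 : ℂ)),
        C_add (a := (2 * (k : ℂ) - a - b)) (b := (1 : ℂ)), ← add_assoc X, ← add_assoc X]
      exact this
    · simp

end GenericTriple
end SL2Hyper

namespace SL2Hyper

/-! ### Newton interpolation and integer-valued polynomials. -/

section IntegerValued

open Polynomial

/-- Newton interpolation at `0, 1, …, N - 1`. -/
lemma exists_newton_interpolation {R : Type*} [CommRing R] (g : ℕ → R) (N : ℕ) :
    ∃ a : ℕ → R, ∀ i < N, g i = ∑ k ∈ Finset.range N, a k * (i.choose k : R) := by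
  induction N with
  | zero => exact ⟨0, by simp⟩
  | succ N ih =>
    obtain ⟨a, ha⟩ := ih
    refine ⟨Function.update a N (g N - ∑ k ∈ Finset.range N, a k * (N.choose k : R)), ?_⟩
    intro i hi
    have hsum : ∀ i : ℕ, ∑ k ∈ Finset.range N, Function.update a N
        (g N - ∑ k ∈ Finset.range N, a k * (N.choose k : R)) k * (i.choose k : R) =
        ∑ k ∈ Finset.range N, a k * (i.choose k : R) := fun i =>
      Finset.sum_congr rfl fun k hk => by
        rw [Function.update_of_ne (Finset.mem_range.mp hk).ne]
    rw [Finset.sum_range_succ, hsum, Function.update_self]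
    rcases Nat.lt_succ_iff_lt_or_eq.mp hi with h | rfl
    · rw [Nat.choose_eq_zero_of_lt h, ha i h]
      simp
    · simp

/-- Polynomials taking integral values at the natural numbers. -/
def IsIntValued (f : ℂ[X]) : Prop := ∀ n : ℕ, ∃ m : ℤ, f.eval (n : ℂ) = m

lemma IsIntValued.exists_eq_sum {f : ℂ[X]} (hf : IsIntValued f) :
    ∃ a : ℕ → ℤ, f = ∑ k ∈ Finset.range (f.natDegree + 1), a k • binomPoly k := by
  choose v hv using hf
  obtain ⟨a, ha⟩ := exists_newton_interpolation v (f.natDegree + 1)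
  refine ⟨a, ?_⟩
  refine eq_of_degree_sub_lt_of_eval_finset_eq
    ((Finset.range (f.natDegree + 1)).map ⟨((↑) : ℕ → ℂ), Nat.cast_injective⟩) ?_ ?_
  · rw [Finset.card_map, Finset.card_range]
    have h1 : f.natDegree < f.natDegree + 1 := Nat.lt_succ_self _
    refine (degree_sub_le _ _).trans_lt (max_lt ?_ ?_)
    · exact degree_le_natDegree.trans_lt (by exact_mod_cast h1)
    · refine (degree_sum_le _ _).trans_lt ?_
      refine (Finset.sup_lt_iff (WithBot.bot_lt_coe _)).mpr fun k hk => ?_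
      rw [zsmul_eq_mul, ← C_eq_intCast]
      refine degree_le_natDegree.trans_lt ?_
      have := (natDegree_C_mul_le ((a k : ℤ) : ℂ) (binomPoly k)).trans_eq (binomPoly_natDegree k)
      exact_mod_cast this.trans_lt <| Finset.mem_range.mp hk
  · intro x hx
    simp only [Finset.mem_map, Finset.mem_range, Function.Embedding.coeFn_mk] at hx
    obtain ⟨i, hi, rfl⟩ := hx
    rw [hv, ha i hi, eval_finsetSum]
    push_cast
    refine Finset.sum_congr rfl fun k _ => ?_
    have := binomPoly_eval_int k i
    rw [Ring.choose_natCast] at this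
    push_cast at this
    rw [zsmul_eq_mul, eval_mul, this]
    simp

lemma isIntValued_binomPoly_comp (m : ℕ) (c : ℤ) :
    IsIntValued ((binomPoly m).comp (X + C (c : ℂ))) := fun n =>
  ⟨Ring.choose ((n : ℤ) + c) m, by
    rw [← binomPoly_eval_int]; simp [eval_comp]⟩

lemma isIntValued_binomPoly (m : ℕ) : IsIntValued (binomPoly m) := by
  simpa using isIntValued_binomPoly_comp m 0

lemma IsIntValued.mul {f g : ℂ[X]} (hf : IsIntValued f) (hg : IsIntValued g) :
    IsIntValued (f * g) := fun n => by
  obtain ⟨a, ha⟩ := hf n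
  obtain ⟨b, hb⟩ := hg n
  exact ⟨a * b, by simp [ha, hb]⟩

end IntegerValued

/-! ### The PBW monomials span the integral form. -/

section IntegralForm

open Polynomial

attribute [local instance 100] LieRing.ofAssociativeRing

lemma ι_mul_ι_eq (a b c : sl2) (h : ⁅a, b⁆ = c) :
    UniversalEnvelopingAlgebra.ι ℂ a * UniversalEnvelopingAlgebra.ι ℂ b =
      UniversalEnvelopingAlgebra.ι ℂ b * UniversalEnvelopingAlgebra.ι ℂ a +
        UniversalEnvelopingAlgebra.ι ℂ c := by
  rw [← h, LieHom.map_lie, LieRing.of_associative_ring_bracket]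
  abel

lemma HC_mul_XC : HC * XC = XC * (HC + algebraMap ℂ UC 2) := by
  rw [HC, XC, ι_mul_ι_eq _ _ ((2 : ℂ) • LieAlgebra.SpecialLinear.single 0 1 (by decide) (1 : ℂ)),
    map_smul, mul_add, ← Algebra.commutes, Algebra.smul_def]
  ext i j
  rw [LieAlgebra.SpecialLinear.sl_bracket]
  fin_cases i <;> fin_cases j <;> simp [Matrix.mul_apply, Matrix.single_apply]; norm_num

lemma HC_mul_YC : HC * YC = YC * (HC + algebraMap ℂ UC (-2)) := by
  rw [HC, YC, ι_mul_ι_eq _ _ ((-2 : ℂ) • LieAlgebra.SpecialLinear.single 1 0 (by decide) (1 : ℂ)),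
    map_smul, mul_add, ← Algebra.commutes, Algebra.smul_def]
  ext i j
  rw [LieAlgebra.SpecialLinear.sl_bracket]
  fin_cases i <;> fin_cases j <;> simp [Matrix.mul_apply, Matrix.single_apply]; norm_num

lemma XC_mul_YC : XC * YC = YC * XC + HC := by
  rw [HC, XC, YC, ι_mul_ι_eq]
  ext i j
  rw [LieAlgebra.SpecialLinear.sl_bracket]
  fin_cases i <;> fin_cases j <;> simp

lemma binomHC_eq (c : ℤ) (m : ℕ) :
    binomHC c m = aeval HC ((binomPoly m).comp (X + C (c : ℂ))) := by
  have h : aeval (HC + algebraMap ℤ UC c) (descPochhammer ℤ m) =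
      aeval (HC + algebraMap ℤ UC c) (descPochhammer ℂ m) := by
    rw [← descPochhammer_map (algebraMap ℤ ℂ), aeval_map_algebraMap]
  rw [binomHC, h, aeval_comp, binomPoly]
  simp [Algebra.smul_def]

lemma binomHC_zero_eq (m : ℕ) : binomHC 0 m = aeval HC (binomPoly m) := by
  simp [binomHC_eq]

lemma dividedPow_eq (u : UC) (m : ℕ) : dividedPow u m = dpow u m := rfl

lemma dpow_XC_mem (m : ℕ) : dpow XC m ∈ UZ :=
  Algebra.subset_adjoin (Or.inl ⟨m, rfl⟩)

lemma dpow_YC_mem (m : ℕ) : dpow YC m ∈ UZ :=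
  Algebra.subset_adjoin (Or.inr ⟨m, rfl⟩)

lemma dpowSub_YC_mem (m k : ℕ) : dpowSub YC m k ∈ UZ := by
  rw [dpowSub]
  split_ifs
  exacts [dpow_YC_mem _, zero_mem _]

lemma aeval_HC_mem_of_binomPoly_mem {f : ℂ[X]} (hf : IsIntValued f)
    (h : ∀ k ≤ f.natDegree, aeval HC (binomPoly k) ∈ UZ) : aeval HC f ∈ UZ := by
  obtain ⟨a, ha⟩ := hf.exists_eq_sum
  rw [ha, map_sum]
  refine sum_mem fun k hk => ?_
  rw [map_zsmul]
  exact zsmul_mem (h k (by simpa [Nat.lt_succ_iff] using hk)) _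

lemma dpow_XC_mul_dpow_YC (a b : ℕ) : dpow XC a * dpow YC b =
    ∑ k ∈ Finset.range (a + 1), dpowSub YC b k *
      aeval HC ((binomPoly k).comp (X + C ((2 * k - a - b : ℤ) : ℂ))) * dpow XC (a - k) := by
  rw [dpow_mul_dpow_of_triple HC_mul_XC HC_mul_YC XC_mul_YC]
  push_cast
  rfl

/-- In Kostant's formula for X^(m) Y^(m) the last term is binom(H, m) itself. The other terms
contain translated binomials of smaller degree, which are integral combinations of binom(H, l) with
l < m and hence covered by induction. -/
lemma aeval_HC_binomPoly_mem (m : ℕ) : aeval HC (binomPoly m) ∈ UZ := by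
  induction m using Nat.strong_induction_on with
  | _ m ih =>
    have h := dpow_XC_mul_dpow_YC m m
    rw [Finset.sum_range_succ] at h
    have h0 : ((2 * m - m - m : ℤ) : ℂ) = 0 := by push_cast; ring
    rw [h0] at h
    simp only [dpowSub, le_refl, if_true, Nat.sub_self, dpow_zero, one_mul, mul_one, C_0, add_zero,
      comp_X] at h
    rw [← sub_eq_iff_eq_add'] at h
    rw [← h]
    refine sub_mem (mul_mem (dpow_XC_mem _) (dpow_YC_mem _)) (sum_mem fun k hk => ?_)
    refine mul_mem (mul_mem (dpowSub_YC_mem m k) ?_) (dpow_XC_mem _)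
    refine aeval_HC_mem_of_binomPoly_mem (isIntValued_binomPoly_comp k _) fun l hl => ih l ?_
    rw [natDegree_comp, binomPoly_natDegree, natDegree_X_add_C, mul_one] at hl
    exact hl.trans_lt (Finset.mem_range.mp hk)

lemma aeval_HC_mem {f : ℂ[X]} (hf : IsIntValued f) : aeval HC f ∈ UZ :=
  aeval_HC_mem_of_binomPoly_mem hf fun k _ => aeval_HC_binomPoly_mem k

lemma aeval_HC_mul_dpow_XC (m : ℕ) (f : ℂ[X]) :
    aeval HC f * dpow XC m = dpow XC m * aeval HC (f.comp (X + C ((2 * m : ℤ) : ℂ))) := by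
  rw [aeval_mul_dpow HC_mul_XC]
  push_cast
  rw [mul_comm (m : ℂ)]

lemma aeval_HC_mul_dpow_YC (m : ℕ) (f : ℂ[X]) :
    aeval HC f * dpow YC m = dpow YC m * aeval HC (f.comp (X + C ((-(2 * m) : ℤ) : ℂ))) := by
  rw [aeval_mul_dpow HC_mul_YC]
  push_cast
  rw [mul_comm (m : ℂ), neg_mul]

lemma dpow_XC_mul_aeval_HC (m : ℕ) (f : ℂ[X]) :
    dpow XC m * aeval HC f = aeval HC (f.comp (X + C ((-(2 * m) : ℤ) : ℂ))) * dpow XC m := by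
  rw [aeval_HC_mul_dpow_XC, comp_assoc]
  simp

/-- The integral PBW monomials. -/
noncomputable def pbwC (t : ℕ × ℕ × ℕ) : UC :=
  dpow YC t.1 * aeval HC (binomPoly t.2.1) * dpow XC t.2.2

lemma pbwC_mem (t : ℕ × ℕ × ℕ) : pbwC t ∈ UZ :=
  mul_mem (mul_mem (dpow_YC_mem _) (aeval_HC_binomPoly_mem _)) (dpow_XC_mem _)

lemma dpow_mul_aeval_mul_dpow_mem_span (m m' : ℕ) {f : ℂ[X]} (hf : IsIntValued f) :
    dpow YC m * aeval HC f * dpow XC m' ∈ Submodule.span ℤ (Set.range pbwC) := by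
  obtain ⟨a, ha⟩ := hf.exists_eq_sum
  rw [ha, map_sum, Finset.mul_sum, Finset.sum_mul]
  refine sum_mem fun k _ => ?_
  rw [map_zsmul, mul_smul_comm, smul_mul_assoc]
  exact Submodule.smul_mem _ _ (Submodule.subset_span ⟨(m, k, m'), rfl⟩)

/-- It suffices to multiply a monomial by a generator. For X^(a), Kostant's formula passes Y^(m) and
a translation passes binom(H, n); the two polynomials in H then merge into one integer-valued
polynomial. -/
lemma mul_mem_span_pbwC {u s : UC} (hu : u ∈ UZ) (hs : s ∈ Submodule.span ℤ (Set.range pbwC)) :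
    u * s ∈ Submodule.span ℤ (Set.range pbwC) := by
  induction hu using Algebra.adjoin_induction generalizing s with
  | algebraMap r => rw [← Algebra.smul_def]; exact Submodule.smul_mem _ _ hs
  | add x y _ _ hx hy => rw [add_mul]; exact add_mem (hx hs) (hy hs)
  | mul x y _ _ hx hy => rw [mul_assoc]; exact hx (hy hs)
  | mem x hx =>
    induction hs using Submodule.span_induction with
    | zero => rw [mul_zero]; exact zero_mem _
    | add a b _ _ ha hb => rw [mul_add]; exact add_mem ha hb
    | smul c a _ ha => rw [mul_smul_comm]; exact Submodule.smul_mem _ _ ha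
    | mem s hs =>
      obtain ⟨⟨m, n, m'⟩, rfl⟩ := hs
      rcases hx with ⟨a, rfl⟩ | ⟨a, rfl⟩
      · rw [dividedPow_eq, pbwC, ← mul_assoc, ← mul_assoc, dpow_XC_mul_dpow_YC, Finset.sum_mul,
          Finset.sum_mul]
        refine sum_mem fun k _ => ?_
        rw [mul_assoc (_ * _) (dpow XC (a - k)), dpow_XC_mul_aeval_HC, mul_assoc, mul_assoc,
          mul_assoc (aeval HC _) (dpow XC _), dpow_mul_dpow, ← mul_assoc (aeval HC _),
          mul_smul_comm, mul_smul_comm, mul_assoc,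
          ← mul_assoc (aeval HC _) (aeval HC _), ← map_mul, ← mul_assoc]
        refine nsmul_mem ?_ _
        rw [dpowSub]
        split_ifs
        · exact dpow_mul_aeval_mul_dpow_mem_span _ _
            ((isIntValued_binomPoly_comp _ _).mul (isIntValued_binomPoly_comp _ _))
        · simp
      · rw [dividedPow_eq, pbwC, ← mul_assoc, ← mul_assoc, dpow_mul_dpow, smul_mul_assoc,
          smul_mul_assoc]
        refine nsmul_mem ?_ _
        exact Submodule.subset_span ⟨(a + m, n, m'), rfl⟩

lemma mem_span_pbwC_of_mem_UZ {u : UC} (hu : u ∈ UZ) : u ∈ Submodule.span ℤ (Set.range pbwC) := by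
  rw [← mul_one u]
  have h1 : (1 : UC) = pbwC (0, 0, 0) := by simp [pbwC]
  have h2 : pbwC (0, 0, 0) ∈ Submodule.span ℤ (Set.range pbwC) :=
    Submodule.subset_span (Set.mem_range_self _)
  rw [← h1] at h2
  exact mul_mem_span_pbwC hu h2

end IntegralForm

end SL2Hyper

namespace SL2Hyper

/-! ### Independence of the PBW monomials, from Verma modules with varying highest weight. -/

section Verma

open Polynomial

attribute [local instance 100] LieRing.ofAssociativeRing

/-- The raising operator on the (completed) Verma module of highest weight `ν`. -/
noncomputable def vermaX (ν : ℂ) : Module.End ℂ (ℕ → ℂ) where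
  toFun v i := (ν - i) * v (i + 1)
  map_add' v w := by ext i; simp [mul_add]
  map_smul' c v := by ext i; simp; ring

/-- The lowering operator on the (completed) Verma module. -/
noncomputable def vermaY : Module.End ℂ (ℕ → ℂ) where
  toFun v i := i * v (i - 1)
  map_add' v w := by ext i; simp [mul_add]
  map_smul' c v := by ext i; simp; ring

/-- The weight operator on the (completed) Verma module of highest weight `ν`. -/
noncomputable def vermaH (ν : ℂ) : Module.End ℂ (ℕ → ℂ) where
  toFun v i := (ν - 2 * i) * v i
  map_add' v w := by ext i; simp [mul_add]
  map_smul' c v := by ext i; simp; ring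

lemma vermaH_X (ν : ℂ) : vermaH ν * vermaX ν - vermaX ν * vermaH ν = (2 : ℂ) • vermaX ν := by
  ext v i
  simp [vermaH, vermaX]
  ring

lemma vermaH_Y (ν : ℂ) : vermaH ν * vermaY - vermaY * vermaH ν = (-2 : ℂ) • vermaY := by
  ext v i
  rcases i with _ | i
  · simp [vermaH, vermaY]
  · simp [vermaH, vermaY]
    ring

lemma vermaX_Y (ν : ℂ) : vermaX ν * vermaY - vermaY * vermaX ν = vermaH ν := by
  ext v i
  rcases i with _ | i
  · simp [vermaH, vermaY, vermaX]
  · simp [vermaH, vermaY, vermaX]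
    ring

lemma sl2_apply_one_one (A : sl2) : A.1 1 1 = -A.1 0 0 := by
  have h : Matrix.trace A.1 = 0 := A.2
  rw [Matrix.trace_fin_two] at h
  linear_combination h

/-- The action of `sl₂` on the (completed) Verma module of highest weight `ν`. -/
noncomputable def vermaLie (ν : ℂ) : sl2 →ₗ⁅ℂ⁆ Module.End ℂ (ℕ → ℂ) where
  toFun A := A.1 0 1 • vermaX ν + A.1 1 0 • vermaY + A.1 0 0 • vermaH ν
  map_add' A B := by
    have h (i j : Fin 2) : (A + B).1 i j = A.1 i j + B.1 i j := rfl
    rw [h, h, h]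
    module
  map_smul' c A := by
    have h (i j : Fin 2) : (c • A).1 i j = c * A.1 i j := rfl
    rw [h, h, h, RingHom.id_apply]
    module
  map_lie' {A B} := by
    have hA := sl2_apply_one_one A
    have hB := sl2_apply_one_one B
    have h1 := vermaH_X ν
    have h2 := vermaH_Y ν
    have h3 := vermaX_Y ν
    rw [LieRing.of_associative_ring_bracket]
    simp only [LieAlgebra.SpecialLinear.sl_bracket, Matrix.sub_apply, Matrix.mul_apply,
      Fin.sum_univ_two, hA, hB]
    rw [sub_eq_iff_eq_add] at h1 h2 h3
    simp only [mul_add, add_mul, smul_mul_smul_comm, h1, h2, h3]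
    module

/-- The representation of the enveloping algebra on the (completed) Verma module. -/
noncomputable def vermaRep (ν : ℂ) : UC →ₐ[ℂ] Module.End ℂ (ℕ → ℂ) :=
  UniversalEnvelopingAlgebra.lift ℂ (vermaLie ν)

lemma vermaRep_XC (ν : ℂ) : vermaRep ν XC = vermaX ν := by
  rw [vermaRep, XC, UniversalEnvelopingAlgebra.lift_ι_apply]
  simp [vermaLie]

lemma vermaRep_YC (ν : ℂ) : vermaRep ν YC = vermaY := by
  rw [vermaRep, YC, UniversalEnvelopingAlgebra.lift_ι_apply]
  simp [vermaLie]

lemma vermaRep_HC (ν : ℂ) : vermaRep ν HC = vermaH ν := by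
  rw [vermaRep, HC, UniversalEnvelopingAlgebra.lift_ι_apply]
  simp [vermaLie]

/-- `Pi.single j 1` plays the role of Y^(j) applied to the highest weight vector; this normalisation
determines the scalars here and in `vermaY_single`. -/
lemma vermaX_single_succ (ν : ℂ) (j : ℕ) :
    vermaX ν (Pi.single (j + 1) 1) = (ν - j) • Pi.single j 1 := by
  ext i
  by_cases h : i = j <;> simp [vermaX, h]

lemma vermaX_single_zero (ν : ℂ) : vermaX ν (Pi.single 0 1) = 0 := by
  ext i
  simp [vermaX]

lemma vermaY_single (j : ℕ) : vermaY (Pi.single j 1) = ((j : ℂ) + 1) • Pi.single (j + 1) 1 := by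
  ext i
  rcases i with _ | i
  · simp [vermaY]
  · by_cases h : i = j <;> simp [vermaY, h]

lemma vermaX_pow_single_lt (ν : ℂ) {m j : ℕ} (h : j < m) :
    (vermaX ν ^ m) (Pi.single j 1) = 0 := by
  induction m generalizing j with
  | zero => omega
  | succ m ih =>
    rw [pow_succ, Module.End.mul_apply]
    rcases j with _ | j
    · rw [vermaX_single_zero, map_zero]
    · rw [vermaX_single_succ, map_smul, ih (by omega), smul_zero]

lemma vermaX_pow_single_self (ν : ℂ) (m : ℕ) :
    (vermaX ν ^ m) (Pi.single m 1) = (∏ i ∈ Finset.range m, (ν - i)) • Pi.single 0 1 := by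
  induction m with
  | zero => simp
  | succ m ih =>
    rw [pow_succ, Module.End.mul_apply, vermaX_single_succ, map_smul, ih, smul_smul,
      Finset.prod_range_succ, mul_comm]

lemma vermaY_pow_single_zero (m : ℕ) :
    (vermaY ^ m) (Pi.single 0 1) = (m ! : ℂ) • Pi.single m 1 := by
  induction m with
  | zero => simp
  | succ m ih =>
    rw [pow_succ', Module.End.mul_apply, ih, map_smul, vermaY_single, smul_smul,
      Nat.factorial_succ]
    congr 1
    push_cast
    ring

lemma aeval_vermaH_single_zero (ν : ℂ) (f : ℂ[X]) :
    aeval (vermaH ν) f (Pi.single 0 1) = f.eval ν • Pi.single 0 1 := by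
  have h : (vermaH ν) (Pi.single 0 1) = ν • Pi.single 0 1 := by
    ext i
    by_cases h : i = 0 <;> simp [vermaH, h]
  induction f using Polynomial.induction_on' with
  | add p q hp hq => simp only [map_add, LinearMap.add_apply, hp, hq, eval_add, add_smul]
  | monomial n a =>
    have : (vermaH ν ^ n) (Pi.single 0 1) = ν ^ n • Pi.single 0 1 := by
      induction n with
      | zero => simp
      | succ n ih => rw [pow_succ, Module.End.mul_apply, h, map_smul, ih, smul_smul, pow_succ']
    rw [aeval_monomial, eval_monomial, Module.End.mul_apply, this, map_smul]
    simp only [Module.algebraMap_end_apply, smul_smul]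
    rw [mul_comm]

lemma vermaRep_pbwC_lt (ν : ℂ) (t : ℕ × ℕ × ℕ) {j : ℕ} (h : j < t.2.2) :
    vermaRep ν (pbwC t) (Pi.single j 1) = 0 := by
  rw [pbwC, map_mul, Module.End.mul_apply, dpow, dpow, map_smul, map_pow, vermaRep_XC,
    LinearMap.smul_apply, vermaX_pow_single_lt ν h, smul_zero, map_zero]

lemma vermaRep_pbwC_self (ν : ℂ) (t : ℕ × ℕ × ℕ) :
    vermaRep ν (pbwC t) (Pi.single t.2.2 1) =
      (((t.2.2 ! : ℂ)⁻¹ * ∏ i ∈ Finset.range t.2.2, (ν - i)) * (binomPoly t.2.1).eval ν) •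
        Pi.single t.1 1 := by
  have h3 : (t.1 ! : ℂ) ≠ 0 := by exact_mod_cast Nat.factorial_ne_zero _
  rw [pbwC, map_mul, Module.End.mul_apply, dpow, dpow, map_smul, map_pow, vermaRep_XC,
    LinearMap.smul_apply, vermaX_pow_single_self, map_mul, Module.End.mul_apply, map_smul, map_pow,
    vermaRep_YC, smul_smul, map_smul, ← aeval_algHom_apply, vermaRep_HC,
    aeval_vermaH_single_zero, smul_smul, map_smul, LinearMap.smul_apply, vermaY_pow_single_zero,
    smul_smul, smul_smul, mul_assoc _ _ (t.1 ! : ℂ), inv_mul_cancel₀ h3, mul_one]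

/-- Apply a relation to Y^(j) v, with j the least exponent of X that occurs. Terms with a larger
exponent vanish, and a term with exponent exactly j gives a multiple of Y^(m) v whose coefficient is
binom(ν, j) binom(ν, n). Comparing coefficients for infinitely many ν leaves a relation between the
polynomials binom(ν, n), which have distinct degrees. -/
theorem linearIndependent_pbwC : LinearIndependent ℂ pbwC := by
  classical
  rw [linearIndependent_iff']
  intro s c hc
  by_contra! hne
  obtain ⟨t0, ht0, hct0⟩ := hne
  -- a term of minimal exponent of `X`
  obtain ⟨t1, ht1, hmin⟩ := Finset.exists_min_image (s.filter fun t => c t ≠ 0) (fun t => t.2.2)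
    ⟨t0, by simp [ht0, hct0]⟩
  rw [Finset.mem_filter] at ht1
  -- the polynomial in the highest weight that has to vanish
  let S := s.filter fun t => t.1 = t1.1 ∧ t.2.2 = t1.2.2
  have hzero : ∑ t ∈ S, C (c t) * binomPoly t.2.1 = 0 := by
    refine eq_of_infinite_eval_eq _ _ ?_
    refine Set.Infinite.mono (s := Set.range (fun n : ℕ => (-(n : ℂ) - 1))) ?_
      (Set.infinite_range_of_injective fun a b h => by simpa using h)
    rintro _ ⟨n, rfl⟩
    -- Negative integers avoid the zeros of ν(ν - 1)⋯, so the factor common to all surviving terms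
    -- can be cancelled.
    set ν : ℂ := -(n : ℂ) - 1 with hν
    have hprod : ((t1.2.2 ! : ℂ)⁻¹ * ∏ i ∈ Finset.range t1.2.2, (ν - i)) ≠ 0 := by
      refine mul_ne_zero (inv_ne_zero (by exact_mod_cast Nat.factorial_ne_zero _)) ?_
      refine Finset.prod_ne_zero_iff.mpr fun i _ h => ?_
      have h2 : ((n + 1 + i : ℕ) : ℂ) = 0 := by
        push_cast
        linear_combination -h + hν
      exact absurd (Nat.cast_eq_zero.mp h2) (by omega)
    have h1 := congrFun (congrArg (fun u => vermaRep ν u (Pi.single t1.2.2 1)) hc) t1.1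
    simp only [map_sum, map_smul, map_zero, LinearMap.sum_apply, LinearMap.smul_apply,
      LinearMap.zero_apply, Finset.sum_apply, Pi.smul_apply, Pi.zero_apply] at h1
    rw [Set.mem_ofPred_eq, eval_finsetSum, eval_zero]
    refine (mul_right_inj' hprod).mp ?_
    rw [mul_zero, ← h1, Finset.mul_sum]
    refine Finset.sum_subset_zero_on_sdiff (Finset.filter_subset _ _) ?_ ?_
    · intro t ht
      simp only [S, Finset.mem_sdiff, Finset.mem_filter, not_and] at ht
      by_cases hct : c t = 0
      · simp [hct]
      · have hle := hmin t (by simp [ht.1, hct])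
        rcases hle.lt_or_eq with hlt | heq
        · rw [vermaRep_pbwC_lt ν t hlt]
          simp
        · have hne1 : t.1 ≠ t1.1 := fun h => ht.2 ht.1 h heq.symm
          rw [heq, vermaRep_pbwC_self, Pi.smul_apply, Pi.single_apply, if_neg hne1.symm]
          simp
    · intro t ht
      simp only [S, Finset.mem_filter] at ht
      have h2 := vermaRep_pbwC_self ν t
      rw [ht.2.2] at h2
      rw [h2, ht.2.1]
      simp
      ring
  have hdeg : ∀ t ∈ S, t ≠ t1 → t.2.1 ≠ t1.2.1 := by
    intro t ht hne h
    simp only [S, Finset.mem_filter] at ht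
    exact hne (Prod.ext ht.2.1 (Prod.ext h ht.2.2))
  -- a term of maximal degree in `H`
  obtain ⟨t2, ht2, hmax⟩ := Finset.exists_max_image (S.filter fun t => c t ≠ 0) (fun t => t.2.1)
    ⟨t1, by simp [S, ht1.1, ht1.2]⟩
  rw [Finset.mem_filter] at ht2
  have hcoeff := congrArg (fun f => f.coeff t2.2.1) hzero
  simp only [finsetSum_coeff, coeff_C_mul, coeff_zero] at hcoeff
  rw [Finset.sum_eq_single_of_mem t2 ht2.1] at hcoeff
  · have h4 : (binomPoly t2.2.1).coeff t2.2.1 ≠ 0 := by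
      have := binomPoly_leadingCoeff t2.2.1
      rw [leadingCoeff, binomPoly_natDegree] at this
      rw [this]
      exact inv_ne_zero (by exact_mod_cast Nat.factorial_ne_zero _)
    exact (mul_ne_zero ht2.2 h4) hcoeff
  · intro t ht hne
    by_cases hct : c t = 0
    · simp [hct]
    · have hle := hmax t (by simp [ht, hct])
      have hne2 : t.2.1 ≠ t2.2.1 := by
        intro h
        have ha := ht
        have hb := ht2.1
        simp only [S, Finset.mem_filter] at ha hb
        exact hne (Prod.ext (ha.2.1.trans hb.2.1.symm) (Prod.ext h (ha.2.2.trans hb.2.2.symm)))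
      rw [coeff_eq_zero_of_natDegree_lt, mul_zero]
      rw [binomPoly_natDegree]
      omega

end Verma

/-! ### The PBW basis over ℤ. -/

section Basis

lemma linearIndependent_pbwUZ :
    LinearIndependent ℤ (fun t => (⟨pbwC t, pbwC_mem t⟩ : UZ)) := by
  have h : LinearIndependent ℤ pbwC :=
    linearIndependent_pbwC.restrict_scalars (by
      intro a b hab
      simpa using hab)
  exact LinearIndependent.of_comp UZ.val.toLinearMap h

/-- The PBW basis of the integral form. -/
noncomputable def pbwBasisUZ : Module.Basis (ℕ × ℕ × ℕ) ℤ UZ :=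
  Module.Basis.mk linearIndependent_pbwUZ (by
    rintro ⟨u, hu⟩ -
    have h := mem_span_pbwC_of_mem_UZ hu
    have h2 : Submodule.map UZ.val.toLinearMap
        (Submodule.span ℤ (Set.range (fun t => (⟨pbwC t, pbwC_mem t⟩ : UZ)))) =
        Submodule.span ℤ (Set.range pbwC) := by
      rw [Submodule.map_span, ← Set.range_comp]
      rfl
    rw [← h2] at h
    obtain ⟨v, hv, hvu⟩ := h
    have : v = ⟨u, hu⟩ := Subtype.ext hvu
    rwa [← this])

lemma pbwBasisUZ_apply (t : ℕ × ℕ × ℕ) : pbwBasisUZ t = ⟨pbwC t, pbwC_mem t⟩ := by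
  rw [pbwBasisUZ, Module.Basis.mk_apply]

end Basis

end SL2Hyper

namespace SL2Hyper

/-! ### Base change to k, and the Cartan part as functions on ℤ. -/

section BaseChange

open Polynomial

variable (k : Type*) [Field k]

/-- The ring homomorphism from the integral form to `U`. -/
noncomputable def ofUZ : UZ →+* U k :=
  (Algebra.TensorProduct.includeRight : UZ →ₐ[ℤ] k ⊗[ℤ] UZ).toRingHom

lemma ofUC_eq {u : UC} (h : u ∈ UZ) : ofUC k u = ofUZ k ⟨u, h⟩ := by
  exact dif_pos h

lemma Xd_eq (m : ℕ) : Xd k m = ofUZ k ⟨dpow XC m, dpow_XC_mem m⟩ := ofUC_eq k _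

lemma Yd_eq (m : ℕ) : Yd k m = ofUZ k ⟨dpow YC m, dpow_YC_mem m⟩ := ofUC_eq k _

lemma binomHC_mem (c : ℤ) (m : ℕ) : binomHC c m ∈ UZ := by
  rw [binomHC_eq]
  exact aeval_HC_mem (isIntValued_binomPoly_comp m c)

lemma binomH_eq (c : ℤ) (m : ℕ) : binomH k c m = ofUZ k ⟨binomHC c m, binomHC_mem c m⟩ :=
  ofUC_eq k _

lemma pbw_eq (t : ℕ × ℕ × ℕ) : pbw k t = ofUZ k (pbwBasisUZ t) := by
  rw [pbw, Xd_eq, Yd_eq, binomH_eq, ← map_mul, ← map_mul, pbwBasisUZ_apply]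
  congr 1
  ext
  simp [pbwC, binomHC_zero_eq]

/-- The PBW basis of `U`. -/
noncomputable def pbwBasis : Module.Basis (ℕ × ℕ × ℕ) k (U k) :=
  pbwBasisUZ.baseChange k

lemma pbwBasis_apply (t : ℕ × ℕ × ℕ) : pbwBasis k t = pbw k t := by
  rw [pbw_eq]
  exact Module.Basis.baseChange_apply k pbwBasisUZ t

lemma coe_pbwBasis : ⇑(pbwBasis k) = pbw k := funext (pbwBasis_apply k)

/-- Independence of the monomials makes `leftInverse` a true left inverse, so `Fr'` takes its
intended values. -/
lemma pbwCoord_pbw (t : ℕ × ℕ × ℕ) : pbwCoord k (pbw k t) = Finsupp.single t 1 := by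
  have hli : LinearIndependent k (pbw k) := coe_pbwBasis k ▸ (pbwBasis k).linearIndependent
  have h := LinearMap.leftInverse_comp_of_inj (LinearMap.ker_eq_bot.mpr hli)
  have h2 := LinearMap.congr_fun h (Finsupp.single t 1)
  simpa [pbwCoord] using h2

lemma Fr'_pbw (p : ℕ) (t : ℕ × ℕ × ℕ) :
    Fr' k p (pbw k t) = pbw k (t.1 * p, t.2.1 * p, t.2.2 * p) := by
  simp [Fr', pbwCoord_pbw]

/-- The function `z ↦ binom(z + c, n)` on the integers with values in `k`. -/
def binFun (c : ℤ) (n : ℕ) : ℤ → k := fun z => ((Ring.choose (z + c) n : ℤ) : k)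

/-- The span of the functions `z ↦ binom(z, n)`. -/
def binSpan : Submodule k (ℤ → k) := Submodule.span k (Set.range (binFun k 0))

lemma binFun_natCast (n i : ℕ) : binFun k 0 n (i : ℤ) = (i.choose n : k) := by
  rw [binFun, add_zero, Ring.choose_natCast]
  simp

/-- Triangularity: at the least index n₁ of a relation, all binom(n₁, n) with n > n₁ vanish. -/
lemma linearIndependent_binFun : LinearIndependent k (binFun k 0) := by
  classical
  rw [linearIndependent_iff']
  intro s c hc
  by_contra! hne
  obtain ⟨n0, hn0, hc0⟩ := hne
  obtain ⟨n1, hn1, hmin⟩ := Finset.exists_min_image (s.filter fun n => c n ≠ 0) id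
    ⟨n0, by simp [hn0, hc0]⟩
  rw [Finset.mem_filter] at hn1
  have h := congrFun hc (n1 : ℤ)
  rw [Finset.sum_apply, Finset.sum_eq_single_of_mem n1 hn1.1] at h
  · rw [Pi.smul_apply, binFun_natCast, Nat.choose_self] at h
    simp at h
    exact hn1.2 h
  · intro n hn hne
    rw [Pi.smul_apply, binFun_natCast]
    by_cases hcn : c n = 0
    · simp [hcn]
    · have : n1 ≤ n := hmin n (by simp [hn, hcn])
      rw [Nat.choose_eq_zero_of_lt (by omega)]
      simp

/-- The element `f(H)` of `U`, for a function `f : ℤ → k` in the span of the functions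
`z ↦ binom(z, n)`. -/
noncomputable def hel : (ℤ → k) →ₗ[k] U k :=
  Finsupp.linearCombination k (binomH k 0) ∘ₗ
    (Finsupp.linearCombination k (binFun k 0)).leftInverse

/-- Functions on ℤ make the Cartan part transparent: commuting with X and Y is translation,
membership in U_r is periodicity, and idempotents are indicator functions. The binomial functions
remain independent over k, so `hel` takes the expected values on them. -/
lemma hel_binFun_zero (n : ℕ) : hel k (binFun k 0 n) = binomH k 0 n := by
  have h := LinearMap.leftInverse_comp_of_inj
    (LinearMap.ker_eq_bot.mpr (linearIndependent_binFun k))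
  have h2 := LinearMap.congr_fun h (Finsupp.single n 1)
  simp only [LinearMap.comp_apply, Finsupp.linearCombination_single, one_smul,
    LinearMap.id_apply] at h2
  simp [hel, h2]

lemma binFun_zero_mem (n : ℕ) : binFun k 0 n ∈ binSpan k := Submodule.subset_span ⟨n, rfl⟩

lemma ofUZ_zsmul (a : ℤ) (u : UZ) : ofUZ k (a • u) = (a : k) • ofUZ k u := by
  rw [map_zsmul, Int.cast_smul_eq_zsmul]

/-- Integer-valued polynomials in `H`. -/
lemma hel_of_eval {f : ℂ[X]} (hf : IsIntValued f) {v : ℤ → ℤ}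
    (hv : ∀ z : ℤ, f.eval (z : ℂ) = v z) :
    (fun z => (v z : k)) ∈ binSpan k ∧
      hel k (fun z => (v z : k)) = ofUZ k ⟨aeval HC f, aeval_HC_mem hf⟩ := by
  obtain ⟨a, ha⟩ := hf.exists_eq_sum
  have h1 : (fun z => (v z : k)) =
      ∑ n ∈ Finset.range (f.natDegree + 1), (a n : k) • binFun k 0 n := by
    ext z
    have h2 : v z = ∑ n ∈ Finset.range (f.natDegree + 1), a n * Ring.choose z n := by
      have h3 : (v z : ℂ) =
          ((∑ n ∈ Finset.range (f.natDegree + 1), a n * Ring.choose z n : ℤ) : ℂ) := by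
        rw [← hv z]
        conv_lhs => rw [ha]
        rw [eval_finsetSum]
        push_cast
        refine Finset.sum_congr rfl fun n _ => ?_
        rw [zsmul_eq_mul, eval_mul, binomPoly_eval_int]
        simp
      exact_mod_cast h3
    rw [h2, Finset.sum_apply]
    push_cast
    simp [binFun]
  refine ⟨?_, ?_⟩
  · rw [h1]
    exact sum_mem fun n _ => Submodule.smul_mem _ _ (binFun_zero_mem k n)
  · have h4 : (⟨aeval HC f, aeval_HC_mem hf⟩ : UZ) =
        ∑ n ∈ Finset.range (f.natDegree + 1), a n • ⟨binomHC 0 n, binomHC_mem 0 n⟩ := by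
      ext
      refine (congrArg (aeval HC) ha).trans ?_
      simp [binomHC_zero_eq]
    rw [h1, h4, map_sum, map_sum]
    refine Finset.sum_congr rfl fun n _ => ?_
    rw [map_smul, hel_binFun_zero, binomH_eq, ofUZ_zsmul]

lemma binFun_mem_and_hel_binFun (c : ℤ) (n : ℕ) :
    binFun k c n ∈ binSpan k ∧ hel k (binFun k c n) = binomH k c n := by
  have h := hel_of_eval k (isIntValued_binomPoly_comp n c) (v := fun z => Ring.choose (z + c) n)
    (fun z => by rw [← binomPoly_eval_int]; simp [eval_comp])
  refine ⟨h.1, h.2.trans ?_⟩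
  rw [binomH_eq]
  congr 1
  ext
  simp [binomHC_eq]

lemma binFun_mem (c : ℤ) (n : ℕ) : binFun k c n ∈ binSpan k := (binFun_mem_and_hel_binFun k c n).1

lemma hel_binFun (c : ℤ) (n : ℕ) : hel k (binFun k c n) = binomH k c n :=
  (binFun_mem_and_hel_binFun k c n).2

/-- A product of integer-valued polynomials is integer-valued, so the multiplication rule already
holds over ℤ and survives base change. -/
lemma binFun_mul_mem_and_hel (m n : ℕ) : binFun k 0 m * binFun k 0 n ∈ binSpan k ∧
    hel k (binFun k 0 m * binFun k 0 n) = hel k (binFun k 0 m) * hel k (binFun k 0 n) := by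
  have h := hel_of_eval k ((isIntValued_binomPoly m).mul (isIntValued_binomPoly n))
    (v := fun z => Ring.choose z m * Ring.choose z n)
    (fun z => by rw [eval_mul, binomPoly_eval_int, binomPoly_eval_int]; push_cast; rfl)
  have h1 : (fun z => ((Ring.choose z m * Ring.choose z n : ℤ) : k)) =
      binFun k 0 m * binFun k 0 n := by
    ext z
    simp [binFun]
  rw [h1] at h
  refine ⟨h.1, h.2.trans ?_⟩
  rw [hel_binFun, hel_binFun, binomH_eq, binomH_eq, ← map_mul]
  congr 1
  ext
  simp [binomHC_zero_eq]

variable {k}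

lemma mul_mem_binSpan_and_hel_mul {f g : ℤ → k} (hf : f ∈ binSpan k) (hg : g ∈ binSpan k) :
    f * g ∈ binSpan k ∧ hel k (f * g) = hel k f * hel k g := by
  rw [binSpan] at hf hg
  induction hf using Submodule.span_induction with
  | zero => simp
  | add a b _ _ ha hb =>
    rw [add_mul, map_add, map_add, add_mul, ha.2, hb.2]
    exact ⟨add_mem ha.1 hb.1, rfl⟩
  | smul c a _ ha =>
    rw [smul_mul_assoc, map_smul, map_smul, smul_mul_assoc, ha.2]
    exact ⟨Submodule.smul_mem _ _ ha.1, rfl⟩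
  | mem a ha =>
    obtain ⟨m, rfl⟩ := ha
    induction hg using Submodule.span_induction with
    | zero => simp
    | add a b _ _ ha hb =>
      rw [mul_add, map_add, map_add, mul_add, ha.2, hb.2]
      exact ⟨add_mem ha.1 hb.1, rfl⟩
    | smul c a _ ha =>
      rw [mul_smul_comm, map_smul, map_smul, mul_smul_comm, ha.2]
      exact ⟨Submodule.smul_mem _ _ ha.1, rfl⟩
    | mem a ha =>
      obtain ⟨n, rfl⟩ := ha
      exact binFun_mul_mem_and_hel k m n

lemma mul_mem_binSpan {f g : ℤ → k} (hf : f ∈ binSpan k) (hg : g ∈ binSpan k) :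
    f * g ∈ binSpan k := (mul_mem_binSpan_and_hel_mul hf hg).1

lemma hel_mul {f g : ℤ → k} (hf : f ∈ binSpan k) (hg : g ∈ binSpan k) :
    hel k (f * g) = hel k f * hel k g := (mul_mem_binSpan_and_hel_mul hf hg).2

lemma binFun_zero_right (c : ℤ) : binFun k c 0 = 1 := by
  ext z
  simp [binFun]

lemma one_mem_binSpan : (1 : ℤ → k) ∈ binSpan k := binFun_zero_right (k := k) 0 ▸ binFun_mem k 0 0

lemma binomH_zero (c : ℤ) : binomH k c 0 = 1 := by
  rw [binomH_eq, ← map_one (ofUZ k)]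
  congr 1
  ext
  simp [binomHC_eq]

lemma hel_one : hel k 1 = 1 := by
  rw [← binFun_zero_right 0, hel_binFun, binomH_zero]

lemma hel_commute {f g : ℤ → k} (hf : f ∈ binSpan k) (hg : g ∈ binSpan k) :
    hel k f * hel k g = hel k g * hel k f := by
  rw [← hel_mul hf hg, ← hel_mul hg hf, mul_comm]

/-- The translate `z ↦ f (z + c)`. -/
def shiftFun (c : ℤ) : (ℤ → k) →ₗ[k] (ℤ → k) := LinearMap.funLeft k k (· + c)

@[simp] lemma shiftFun_apply (c : ℤ) (f : ℤ → k) (z : ℤ) : shiftFun c f z = f (z + c) := rfl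

lemma shiftFun_binFun (c d : ℤ) (n : ℕ) : shiftFun c (binFun k d n) = binFun k (c + d) n := by
  ext z
  simp [binFun, add_assoc]

lemma shiftFun_mul (c : ℤ) (f g : ℤ → k) : shiftFun c (f * g) = shiftFun c f * shiftFun c g := rfl

lemma shiftFun_shiftFun (c d : ℤ) (f : ℤ → k) : shiftFun c (shiftFun d f) = shiftFun (c + d) f := by
  ext z
  simp [add_assoc]

@[simp] lemma shiftFun_zero (f : ℤ → k) : shiftFun 0 f = f := by
  ext z
  simp

lemma shiftFun_mem {f : ℤ → k} (hf : f ∈ binSpan k) (c : ℤ) : shiftFun c f ∈ binSpan k := by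
  have h : binSpan k ≤ (binSpan k).comap (shiftFun c) := by
    refine Submodule.span_le.mpr ?_
    rintro _ ⟨n, rfl⟩
    rw [SetLike.mem_coe, Submodule.mem_comap, shiftFun_binFun]
    exact binFun_mem k _ _
  exact h hf

lemma Xd_mul_hel {f : ℤ → k} (hf : f ∈ binSpan k) (m : ℕ) :
    Xd k m * hel k f = hel k (shiftFun (-(2 * m)) f) * Xd k m := by
  have h : binSpan k ≤ LinearMap.eqLocus (LinearMap.mulLeft k (Xd k m) ∘ₗ hel k)
      (LinearMap.mulRight k (Xd k m) ∘ₗ hel k ∘ₗ shiftFun (-(2 * m))) := by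
    refine Submodule.span_le.mpr ?_
    rintro _ ⟨n, rfl⟩
    simp only [SetLike.mem_coe, LinearMap.mem_eqLocus, LinearMap.comp_apply,
      LinearMap.mulLeft_apply, LinearMap.mulRight_apply, shiftFun_binFun, hel_binFun, binomH_eq,
      Xd_eq, ← map_mul]
    congr 1
    ext
    simp only [MulMemClass.coe_mul, binomHC_eq, dpow_XC_mul_aeval_HC, add_zero, Int.cast_zero,
      Polynomial.C_0, Polynomial.comp_X]
  exact h hf

lemma hel_mul_Yd {f : ℤ → k} (hf : f ∈ binSpan k) (m : ℕ) :
    hel k f * Yd k m = Yd k m * hel k (shiftFun (-(2 * m)) f) := by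
  have h : binSpan k ≤ LinearMap.eqLocus (LinearMap.mulRight k (Yd k m) ∘ₗ hel k)
      (LinearMap.mulLeft k (Yd k m) ∘ₗ hel k ∘ₗ shiftFun (-(2 * m))) := by
    refine Submodule.span_le.mpr ?_
    rintro _ ⟨n, rfl⟩
    simp only [SetLike.mem_coe, LinearMap.mem_eqLocus, LinearMap.comp_apply,
      LinearMap.mulLeft_apply, LinearMap.mulRight_apply, shiftFun_binFun, hel_binFun, binomH_eq,
      Yd_eq, ← map_mul]
    congr 1
    ext
    simp only [MulMemClass.coe_mul, binomHC_eq, aeval_HC_mul_dpow_YC, add_zero, Int.cast_zero,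
      Polynomial.C_0, Polynomial.comp_X]
  exact h hf

lemma Yd_mul_hel {f : ℤ → k} (hf : f ∈ binSpan k) (m : ℕ) :
    Yd k m * hel k f = hel k (shiftFun (2 * m) f) * Yd k m := by
  rw [hel_mul_Yd (shiftFun_mem hf _), shiftFun_shiftFun]
  simp

variable (k)

lemma Xd_zero : Xd k 0 = 1 := by
  rw [Xd_eq, ← map_one (ofUZ k)]
  congr 1
  ext
  simp

lemma Yd_zero : Yd k 0 = 1 := by
  rw [Yd_eq, ← map_one (ofUZ k)]
  congr 1
  ext
  simp

lemma Xd_mul_Xd (m n : ℕ) : Xd k m * Xd k n = ((m + n).choose m : k) • Xd k (m + n) := by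
  rw [Xd_eq, Xd_eq, Xd_eq, ← map_mul, Nat.cast_smul_eq_nsmul, ← map_nsmul]
  congr 1
  ext
  simp [dpow_mul_dpow]

lemma Yd_mul_Yd (m n : ℕ) : Yd k m * Yd k n = ((m + n).choose m : k) • Yd k (m + n) := by
  rw [Yd_eq, Yd_eq, Yd_eq, ← map_mul, Nat.cast_smul_eq_nsmul, ← map_nsmul]
  congr 1
  ext
  simp [dpow_mul_dpow]

/-- `Y^(b - j)` if `j ≤ b`, else `0`. -/
noncomputable def YdSub (b j : ℕ) : U k := if j ≤ b then Yd k (b - j) else 0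

lemma YdSub_eq (b j : ℕ) : YdSub k b j = ofUZ k ⟨dpowSub YC b j, dpowSub_YC_mem b j⟩ := by
  by_cases h : j ≤ b
  · simp only [YdSub, h, if_true, Yd_eq, dpowSub]
  · simp only [YdSub, h, if_false, dpowSub]
    exact (map_zero (ofUZ k)).symm

/-- Kostant's commutation formula in `U`. -/
theorem Xd_mul_Yd (a b : ℕ) : Xd k a * Yd k b = ∑ j ∈ Finset.range (a + 1),
    YdSub k b j * hel k (binFun k (2 * j - a - b) j) * Xd k (a - j) := by
  simp only [hel_binFun, YdSub_eq, binomH_eq, Xd_eq, Yd_eq, ← map_mul, ← map_sum]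
  congr 1
  ext
  simp [binomHC_eq, dpow_XC_mul_dpow_YC]

lemma Xd_commute (m n : ℕ) : Xd k m * Xd k n = Xd k n * Xd k m := by
  rw [Xd_mul_Xd, Xd_mul_Xd, add_comm n m, Nat.choose_symm_add]

lemma Yd_commute (m n : ℕ) : Yd k m * Yd k n = Yd k n * Yd k m := by
  rw [Yd_mul_Yd, Yd_mul_Yd, add_comm n m, Nat.choose_symm_add]

lemma pbw_eq_hel (m n m' : ℕ) : pbw k (m, n, m') = Yd k m * hel k (binFun k 0 n) * Xd k m' := by
  rw [hel_binFun, pbw]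

variable {k}

/-- Uniqueness of the normal form. -/
lemma eq_zero_of_sum_Yd_hel_Xd_eq_zero {ι : Type*} (s : Finset ι) (m m' : ι → ℕ)
    (hinj : Set.InjOn (fun i => (m i, m' i)) s) (f : ι → ℤ → k) (hf : ∀ i ∈ s, f i ∈ binSpan k)
    (h : ∑ i ∈ s, Yd k (m i) * hel k (f i) * Xd k (m' i) = 0) : ∀ i ∈ s, f i = 0 := by
  classical
  have hspan : ∀ i ∈ s, ∃ c : ℕ →₀ k, Finsupp.linearCombination k (binFun k 0) c = f i := by
    intro i hi
    have := hf i hi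
    rw [binSpan, ← Finsupp.range_linearCombination] at this
    exact this
  choose! c hc using hspan
  have hterm : ∀ i ∈ s, Yd k (m i) * hel k (f i) * Xd k (m' i) =
      Finsupp.linearCombination k (pbw k) ((c i).mapDomain fun n => (m i, n, m' i)) := by
    intro i hi
    rw [← hc i hi, Finsupp.linearCombination_mapDomain, Finsupp.linearCombination_apply,
      Finsupp.linearCombination_apply, Finsupp.sum, Finsupp.sum, map_sum, Finset.mul_sum,
      Finset.sum_mul]
    refine Finset.sum_congr rfl fun n _ => ?_
    rw [map_smul, mul_smul_comm, smul_mul_assoc, Function.comp_apply, pbw_eq_hel]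
  rw [Finset.sum_congr rfl hterm, ← map_sum] at h
  have hli : LinearIndependent k (pbw k) := coe_pbwBasis k ▸ (pbwBasis k).linearIndependent
  have h0 := (linearIndependent_iff.mp hli) _ h
  intro i hi
  have hci : c i = 0 := by
    ext n
    have h1 := DFunLike.congr_fun h0 (m i, n, m' i)
    rw [Finsupp.finsetSum_apply, Finset.sum_eq_single_of_mem i hi] at h1
    · rw [Finsupp.mapDomain_apply (fun a b hab => by simpa using hab)] at h1
      exact h1
    · intro j hj hne
      refine Finsupp.mapDomain_of_notMem_range _ _ ?_
      rintro ⟨n', hn'⟩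
      refine hne (hinj hj hi ?_)
      simp only [Prod.mk.injEq] at hn' ⊢
      exact ⟨hn'.1, hn'.2.2⟩
  rw [← hc i hi, hci, map_zero]

end BaseChange

end SL2Hyper

namespace SL2Hyper

/-! ### Characteristic p: periodicity, Lucas' theorem, residue-class idempotents. -/

section Periodic

set_option linter.unusedSectionVars false

variable {k : Type*} [Field k]

lemma periodic_ext {q : ℕ} (hq : 0 < q) {f g : ℤ → k} (hf : Function.Periodic f (q : ℤ))
    (hg : Function.Periodic g (q : ℤ)) (h : ∀ i < q, f (i : ℤ) = g (i : ℤ)) : f = g := by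
  have key : ∀ {f : ℤ → k}, Function.Periodic f (q : ℤ) → ∀ z : ℤ,
      f z = f (((z % q).toNat : ℕ) : ℤ) := by
    intro f hf z
    rw [Int.toNat_of_nonneg (Int.emod_nonneg _ (by omega))]
    have h1 := hf.sub_zsmul_eq (x := z) (z / q)
    rw [← h1]
    congr 1
    rw [smul_eq_mul, Int.emod_def, mul_comm]
  ext z
  rw [key hf z, key hg z]
  refine h _ ?_
  have := Int.emod_lt_of_pos z (show (0 : ℤ) < q by omega)
  have := Int.emod_nonneg z (show (q : ℤ) ≠ 0 by omega)
  omega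

variable (k) (p : ℕ) [hp : Fact p.Prime] [CharP k p]

lemma pow_pos_of_prime (r : ℕ) : 0 < p ^ r := pow_pos hp.out.pos r

/-- Vandermonde's identity, together with p ∣ binom(p^r, j) for 0 < j < p^r. -/
lemma binFun_periodic {n r : ℕ} (h : n < p ^ r) (c : ℤ) :
    Function.Periodic (binFun k c n) ((p ^ r : ℕ) : ℤ) := by
  intro z
  have h1 : z + (p ^ r : ℕ) + c = (z + c) + (p ^ r : ℕ) := by ring
  rw [binFun, binFun, h1, Ring.add_choose_eq n (Commute.all _ _)]
  push_cast
  rw [Finset.sum_eq_single_of_mem (n, 0) (by simp)]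
  · simp
  · rintro ⟨i, j⟩ hij hne
    have hij := Finset.HasAntidiagonal.mem_antidiagonal.mp hij
    have hj : j ≠ 0 := by
      rintro rfl
      exact hne (by simpa using hij)
    have h2 : p ∣ (p ^ r).choose j := hp.out.dvd_choose_pow hj (by dsimp at hij; omega)
    have h3 : ((Ring.choose ((p : ℤ) ^ r) j : ℤ) : k) = 0 := by
      have h4 : (p : ℤ) ^ r = ((p ^ r : ℕ) : ℤ) := by push_cast; rfl
      rw [h4, Ring.choose_natCast]
      have := (CharP.cast_eq_zero_iff k p _).mpr h2
      exact_mod_cast this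
    simp only [h3, mul_zero]

/-- Newton interpolation at 0, …, p^r - 1 gives the coefficients; both sides are p^r-periodic, so
agreement there suffices. Thus arbitrary p^r-periodic functions are available as f(H). -/
lemma exists_eq_sum_binFun_of_periodic {r : ℕ} {f : ℤ → k}
    (hf : Function.Periodic f ((p ^ r : ℕ) : ℤ)) :
    ∃ a : ℕ → k, f = ∑ n ∈ Finset.range (p ^ r), a n • binFun k 0 n := by
  obtain ⟨a, ha⟩ := exists_newton_interpolation (fun i : ℕ => f i) (p ^ r)
  refine ⟨a, periodic_ext (pow_pos_of_prime p r) hf ?_ ?_⟩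
  · intro z
    simp only [Finset.sum_apply, Pi.smul_apply]
    refine Finset.sum_congr rfl fun n hn => ?_
    rw [binFun_periodic k p (Finset.mem_range.mp hn) 0 z]
  · intro i hi
    rw [ha i hi, Finset.sum_apply]
    refine Finset.sum_congr rfl fun n _ => ?_
    rw [Pi.smul_apply, binFun_natCast, smul_eq_mul]

variable {k}

lemma mem_binSpan_of_periodic {r : ℕ} {f : ℤ → k}
    (hf : Function.Periodic f ((p ^ r : ℕ) : ℤ)) : f ∈ binSpan k := by
  obtain ⟨a, rfl⟩ := exists_eq_sum_binFun_of_periodic k p hf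
  exact sum_mem fun n _ => Submodule.smul_mem _ _ (binFun_zero_mem k n)

variable (k)

lemma cast_choose_lucas (n m : ℕ) :
    (n.choose m : k) = ((n % p).choose (m % p) : k) * ((n / p).choose (m / p) : k) := by
  have h := Choose.choose_modEq_choose_mod_mul_choose_div_nat (n := n) (k := m) (p := p)
  have h2 := (CharP.cast_eq_iff_mod_eq k p).mpr h
  exact_mod_cast h2

/-- For natural arguments this is Lucas' theorem. Both sides have a common period p^(R+1), which
extends it to negative integers. -/
lemma binFun_lucas (n i : ℕ) (hi : i < p) (z : ℤ) :
    binFun k 0 (n * p + i) z = binFun k 0 n (z / p) * binFun k 0 i z := by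
  have hp1 : 1 < p := hp.out.one_lt
  have hp0 : (p : ℤ) ≠ 0 := by exact_mod_cast hp.out.ne_zero
  obtain ⟨R, hR⟩ : ∃ R, n < p ^ R := ⟨n, Nat.lt_pow_self hp1⟩
  have hlt : n * p + i < p ^ (R + 1) := by
    rw [pow_succ]
    calc n * p + i < n * p + p := by omega
      _ = (n + 1) * p := by ring
      _ ≤ p ^ R * p := Nat.mul_le_mul_right _ hR
  have hi' : i < p ^ (R + 1) := by omega
  revert z
  refine fun z => congrFun (periodic_ext (pow_pos_of_prime p (R + 1))
    (g := fun z => binFun k 0 n (z / p) * binFun k 0 i z)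
    (binFun_periodic k p hlt 0) ?_ ?_) z
  · intro z
    have h1 : (z + (p ^ (R + 1) : ℕ)) / (p : ℤ) = z / p + (p ^ R : ℕ) := by
      rw [pow_succ, Nat.cast_mul, Int.add_mul_ediv_right _ _ hp0]
    simp only [h1, binFun_periodic k p hR 0 _, binFun_periodic k p hi' 0 z]
  · intro j _
    have h1 : (j : ℤ) / (p : ℤ) = ((j / p : ℕ) : ℤ) := by simp
    rw [h1, binFun_natCast, binFun_natCast, binFun_natCast, cast_choose_lucas k p j (n * p + i),
      cast_choose_lucas k p j i, Nat.mod_eq_of_lt hi, Nat.div_eq_of_lt hi, Nat.choose_zero_right]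
    have h2 : (n * p + i) % p = i := by
      rw [mul_comm, Nat.mul_add_mod, Nat.mod_eq_of_lt hi]
    have h3 : (n * p + i) / p = n := by
      rw [mul_comm, Nat.mul_add_div hp.out.pos, Nat.div_eq_of_lt hi, add_zero]
    rw [h2, h3, mul_comm]
    simp

/-- The function `z ↦ f ⌊z / p⌋`. -/
def frobFun : (ℤ → k) →ₗ[k] (ℤ → k) := LinearMap.funLeft k k (· / (p : ℤ))

variable {k}

@[simp] lemma frobFun_apply (f : ℤ → k) (z : ℤ) : frobFun k p f z = f (z / p) := rfl

lemma frobFun_mul (f g : ℤ → k) : frobFun k p (f * g) = frobFun k p f * frobFun k p g := rfl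

lemma frobFun_one : frobFun k p 1 = 1 := rfl

lemma frobFun_shiftFun (c : ℤ) (f : ℤ → k) :
    frobFun k p (shiftFun c f) = shiftFun (p * c) (frobFun k p f) := by
  ext z
  have hp0 : (p : ℤ) ≠ 0 := by exact_mod_cast hp.out.ne_zero
  simp [Int.add_mul_ediv_left _ _ hp0]

/-- By Lucas' theorem, `Fr'` acts on the Cartan part as composition with z ↦ ⌊z/p⌋, and is therefore
multiplicative there. -/
lemma frobFun_binFun (n : ℕ) : frobFun k p (binFun k 0 n) = binFun k 0 (n * p) := by
  ext z
  have := binFun_lucas k p n 0 hp.out.pos z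
  rw [add_zero, binFun_zero_right, Pi.one_apply, mul_one] at this
  rw [this, frobFun_apply]

lemma frobFun_mem {f : ℤ → k} (hf : f ∈ binSpan k) : frobFun k p f ∈ binSpan k := by
  have h : binSpan k ≤ (binSpan k).comap (frobFun k p) := by
    refine Submodule.span_le.mpr ?_
    rintro _ ⟨n, rfl⟩
    rw [SetLike.mem_coe, Submodule.mem_comap, frobFun_binFun]
    exact binFun_mem k _ _
  exact h hf

lemma Fr'_apply {f : ℤ → k} (hf : f ∈ binSpan k) (c d : ℕ) :
    Fr' k p (Yd k c * hel k f * Xd k d) =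
      Yd k (c * p) * hel k (frobFun k p f) * Xd k (d * p) := by
  have h : binSpan k ≤ LinearMap.eqLocus
      (Fr' k p ∘ₗ LinearMap.mulRight k (Xd k d) ∘ₗ LinearMap.mulLeft k (Yd k c) ∘ₗ hel k)
      (LinearMap.mulRight k (Xd k (d * p)) ∘ₗ LinearMap.mulLeft k (Yd k (c * p)) ∘ₗ hel k ∘ₗ
        frobFun k p) := by
    refine Submodule.span_le.mpr ?_
    rintro _ ⟨n, rfl⟩
    simp only [SetLike.mem_coe, LinearMap.mem_eqLocus, LinearMap.comp_apply,
      LinearMap.mulRight_apply, LinearMap.mulLeft_apply, frobFun_binFun]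
    rw [← pbw_eq_hel, ← pbw_eq_hel, Fr'_pbw]
  exact h hf

lemma Fr'_one : Fr' k p 1 = 1 := by
  have := Fr'_apply p (one_mem_binSpan (k := k)) 0 0
  simpa [Yd_zero, Xd_zero, hel_one, frobFun_one] using this

open Classical in
/-- The indicator function of the residue class of `a` modulo `p`. -/
noncomputable def resFun (a : ℤ) : ℤ → k := fun z => if (p : ℤ) ∣ z - a then 1 else 0

lemma resFun_mul_self (a : ℤ) : resFun (k := k) p a * resFun p a = resFun p a := by
  ext z
  simp [resFun]

lemma resFun_periodic (a : ℤ) : Function.Periodic (resFun (k := k) p a) ((p ^ 1 : ℕ) : ℤ) := by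
  intro z
  have h : (p : ℤ) ∣ z + ((p ^ 1 : ℕ) : ℤ) - a ↔ (p : ℤ) ∣ z - a := by
    have : z + ((p ^ 1 : ℕ) : ℤ) - a = (z - a) + p := by push_cast; ring
    rw [this, dvd_add_self_right]
  simp only [resFun, h]

lemma resFun_mem (a : ℤ) : resFun (k := k) p a ∈ binSpan k :=
  mem_binSpan_of_periodic p (resFun_periodic p a)

lemma shiftFun_resFun (a c : ℤ) : shiftFun c (resFun (k := k) p a) = resFun p (a - c) := by
  ext z
  have : z + c - a = z - (a - c) := by ring
  simp only [shiftFun_apply, resFun, this]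

lemma resFun_congr {a b : ℤ} (h : (p : ℤ) ∣ a - b) : resFun (k := k) p a = resFun p b := by
  ext z
  have : (p : ℤ) ∣ z - a ↔ (p : ℤ) ∣ z - b := by
    have e : z - b = (z - a) + (a - b) := by ring
    rw [e, dvd_add_left h]
  simp only [resFun, this]

lemma resFun_mul_of_not_dvd {a b : ℤ} (h : ¬ (p : ℤ) ∣ a - b) :
    resFun (k := k) p a * resFun p b = 0 := by
  ext z
  by_cases h1 : (p : ℤ) ∣ z - a
  · have h2 : ¬ (p : ℤ) ∣ z - b := fun h2 => h (by
      have e : a - b = (z - b) - (z - a) := by ring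
      exact e ▸ dvd_sub h2 h1)
    simp [resFun, h2]
  · simp [resFun, h1]

/-- Among 0 ≤ i < p, binom(i, p - 1) is nonzero only for i = p - 1. This is why μ_a is an
idempotent. -/
lemma binFun_pred_eq_resFun : binFun k 0 (p - 1) = resFun p (-1) := by
  have hp1 : 1 < p := hp.out.one_lt
  refine periodic_ext (pow_pos_of_prime p 1) (binFun_periodic k p (by rw [pow_one]; omega) 0)
    (resFun_periodic p (-1)) ?_
  intro i hi
  rw [pow_one] at hi
  rw [binFun_natCast]
  by_cases h : i = p - 1
  · subst h
    have : (p : ℤ) ∣ ((p - 1 : ℕ) : ℤ) - -1 := ⟨1, by push_cast [hp1.le]; ring⟩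
    simp only [resFun, this, if_true, Nat.choose_self, Nat.cast_one]
  · rw [Nat.choose_eq_zero_of_lt (by omega), Nat.cast_zero]
    have : ¬ (p : ℤ) ∣ (i : ℤ) - -1 := by
      rintro ⟨c, hc⟩
      have h1 : (0 : ℤ) < p * c := by omega
      have h2 : (p : ℤ) * c < p * 1 := by omega
      have h3 : c < 1 := lt_of_mul_lt_mul_left h2 (by omega)
      have h4 : 0 < c := pos_of_mul_pos_right h1 (by omega)
      omega
    simp only [resFun, this, if_false]

lemma mu_eq (a : ℕ) : mu k p a = hel k (resFun p a) := by
  rw [mu, ← hel_binFun]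
  congr 1
  have h : binFun k (-(a : ℤ) - 1) (p - 1) = shiftFun (-(a : ℤ) - 1) (binFun k 0 (p - 1)) := by
    rw [shiftFun_binFun, add_zero]
  rw [h, binFun_pred_eq_resFun, shiftFun_resFun]
  congr 1
  ring

/-- Kummer's theorem: the addition of m and n in base p has a carry into position r. -/
lemma cast_choose_eq_zero_of_carry {m n r : ℕ} (hm : m < p ^ r) (hn : n < p ^ r)
    (h : p ^ r ≤ m + n) : ((m + n).choose m : k) = 0 := by
  rw [CharP.cast_eq_zero_iff k p]
  have hv := padicValNat_choose' (p := p) (n := n) (k := m) (b := Nat.log p (n + m) + 1)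
    (Nat.lt_succ_self _)
  refine dvd_of_one_le_padicValNat ?_
  rw [add_comm m n, hv]
  refine Finset.card_pos.mpr ⟨r, ?_⟩
  rw [Finset.mem_filter, Finset.mem_Ico, Nat.mod_eq_of_lt hm, Nat.mod_eq_of_lt hn]
  refine ⟨⟨?_, Nat.lt_succ_of_le (Nat.le_log_of_pow_le hp.out.one_lt (by omega))⟩, h⟩
  rcases r with _ | r
  · simp at hm hn h
    omega
  · omega

/-- Lucas' theorem reduces the binomial to the leading base-p digit of m, which is prime to p. -/
lemma cast_choose_ne_zero_of_top_digit {m i : ℕ} (h1 : p ^ i ≤ m) (h2 : m < p ^ (i + 1)) :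
    (m.choose (p ^ i) : k) ≠ 0 := by
  induction i generalizing m with
  | zero =>
    rw [pow_zero, Nat.choose_one_right, Ne, CharP.cast_eq_zero_iff k p]
    intro h
    have := Nat.le_of_dvd (by rw [pow_zero] at h1; omega) h
    rw [zero_add, pow_one] at h2
    omega
  | succ i ih =>
    have e1 : p ^ (i + 1) % p = 0 := by rw [pow_succ]; simp
    have e2 : p ^ (i + 1) / p = p ^ i := by
      rw [pow_succ, Nat.mul_div_cancel _ hp.out.pos]
    rw [cast_choose_lucas k p, e1, e2, Nat.choose_zero_right, Nat.cast_one, one_mul]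
    refine ih ?_ ?_
    · rw [Nat.le_div_iff_mul_le hp.out.pos, ← pow_succ]
      exact h1
    · rw [Nat.div_lt_iff_lt_mul hp.out.pos, ← pow_succ]
      exact h2

variable (k)

lemma Xd_mul_Xd_eq_zero {m n r : ℕ} (hm : m < p ^ r) (hn : n < p ^ r) (h : p ^ r ≤ m + n) :
    Xd k m * Xd k n = 0 := by
  rw [Xd_mul_Xd, cast_choose_eq_zero_of_carry p hm hn h, zero_smul]

lemma Yd_mul_Yd_eq_zero {m n r : ℕ} (hm : m < p ^ r) (hn : n < p ^ r) (h : p ^ r ≤ m + n) :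
    Yd k m * Yd k n = 0 := by
  rw [Yd_mul_Yd, cast_choose_eq_zero_of_carry p hm hn h, zero_smul]

end Periodic

end SL2Hyper

namespace SL2Hyper

/-! ### The commutative degree-zero part, and A_r in terms of the PBW basis. -/

section DegreeZero

set_option linter.unusedSectionVars false

variable {k : Type*} [Field k]

lemma hel_mul_YdSub {f : ℤ → k} (hf : f ∈ binSpan k) (l j : ℕ) :
    hel k f * YdSub k l j = YdSub k l j * hel k (shiftFun (-(2 * (l - j : ℕ))) f) := by
  rw [YdSub]
  split_ifs
  · exact hel_mul_Yd hf _
  · simp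

/-- The product of two elements in normal form. -/
lemma normal_form_mul {f g : ℤ → k} (hf : f ∈ binSpan k) (hg : g ∈ binSpan k) (m m' l l' : ℕ) :
    Yd k m * hel k f * Xd k m' * (Yd k l * hel k g * Xd k l') =
      ∑ j ∈ Finset.range (m' + 1), (Yd k m * YdSub k l j) *
        hel k (shiftFun (-(2 * (l - j : ℕ))) f * binFun k (2 * j - m' - l) j *
          shiftFun (-(2 * (m' - j : ℕ))) g) * (Xd k (m' - j) * Xd k l') := by
  have h1 : Yd k m * hel k f * Xd k m' * (Yd k l * hel k g * Xd k l') =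
      Yd k m * hel k f * (Xd k m' * Yd k l) * (hel k g * Xd k l') := by
    simp only [mul_assoc]
  rw [h1, Xd_mul_Yd, Finset.mul_sum, Finset.sum_mul]
  refine Finset.sum_congr rfl fun j _ => ?_
  have h2 : Yd k m * hel k f * (YdSub k l j * hel k (binFun k (2 * j - m' - l) j) *
      Xd k (m' - j)) * (hel k g * Xd k l') =
      Yd k m * (hel k f * YdSub k l j) * hel k (binFun k (2 * j - m' - l) j) *
      (Xd k (m' - j) * hel k g) * Xd k l' := by
    simp only [mul_assoc]
  rw [h2, hel_mul_YdSub hf, Xd_mul_hel hg, hel_mul (mul_mem_binSpan (shiftFun_mem hf _)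
    (binFun_mem k _ _)) (shiftFun_mem hg _), hel_mul (shiftFun_mem hf _) (binFun_mem k _ _)]
  simp only [mul_assoc]

variable (k) in
/-- The span of the elements `Y^(m) binom(H, n) X^(m)`. -/
noncomputable def degSpan : Submodule k (U k) :=
  Submodule.span k (Set.range fun t : ℕ × ℕ => pbw k (t.1, t.2, t.1))

lemma normal_form_mem_degSpan {f : ℤ → k} (hf : f ∈ binSpan k) (m : ℕ) :
    Yd k m * hel k f * Xd k m ∈ degSpan k := by
  have h : binSpan k ≤ (degSpan k).comap
      (LinearMap.mulRight k (Xd k m) ∘ₗ LinearMap.mulLeft k (Yd k m) ∘ₗ hel k) := by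
    refine Submodule.span_le.mpr ?_
    rintro _ ⟨n, rfl⟩
    simp only [SetLike.mem_coe, Submodule.mem_comap, LinearMap.comp_apply,
      LinearMap.mulRight_apply, LinearMap.mulLeft_apply]
    rw [← pbw_eq_hel]
    exact Submodule.subset_span ⟨(m, n), rfl⟩
  exact h hf

/-- Induction on elements of degree zero. -/
@[elab_as_elim]
lemma degSpan_induction {P : (u : U k) → u ∈ degSpan k → Prop} (zero : P 0 (zero_mem _))
    (add : ∀ u v hu hv, P u hu → P v hv → P (u + v) (add_mem hu hv))
    (smul : ∀ (c : k) u hu, P u hu → P (c • u) (Submodule.smul_mem _ c hu))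
    (normal : ∀ (m : ℕ) (f : ℤ → k) (hf : f ∈ binSpan k),
      P (Yd k m * hel k f * Xd k m) (normal_form_mem_degSpan hf m))
    {u : U k} (hu : u ∈ degSpan k) : P u hu := by
  induction hu using Submodule.span_induction with
  | zero => exact zero
  | add a b ha' hb' ha hb => exact add a b ha' hb' ha hb
  | smul c a ha' ha => exact smul c a ha' ha
  | mem a ha =>
    obtain ⟨t, rfl⟩ := ha
    have := normal t.1 (binFun k 0 t.2) (binFun_mem k _ _)
    simpa only [← pbw_eq_hel] using this

lemma mul_mem_degSpan {u v : U k} (hu : u ∈ degSpan k) (hv : v ∈ degSpan k) :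
    u * v ∈ degSpan k := by
  induction hu using degSpan_induction with
  | zero => rw [zero_mul]; exact zero_mem _
  | add a b _ _ ha hb => rw [add_mul]; exact add_mem ha hb
  | smul c a _ ha => rw [smul_mul_assoc]; exact Submodule.smul_mem _ _ ha
  | normal m f hf =>
    induction hv using degSpan_induction with
    | zero => rw [mul_zero]; exact zero_mem _
    | add a b _ _ ha hb => rw [mul_add]; exact add_mem ha hb
    | smul c a _ ha => rw [mul_smul_comm]; exact Submodule.smul_mem _ _ ha
    | normal l g hg =>
      rw [normal_form_mul hf hg]
      refine sum_mem fun j hj => ?_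
      have hj' : j ≤ m := by simpa [Nat.lt_succ_iff] using hj
      rw [YdSub]
      split_ifs with hjl
      · have e : m - j + l = m + (l - j) := by omega
        rw [Yd_mul_Yd, Xd_mul_Xd, e, smul_mul_assoc, smul_mul_smul_comm]
        exact Submodule.smul_mem _ _ (normal_form_mem_degSpan (mul_mem_binSpan (mul_mem_binSpan
          (shiftFun_mem hf _) (binFun_mem k _ _)) (shiftFun_mem hg _)) _)
      · simp

lemma hel_mem_degSpan {f : ℤ → k} (hf : f ∈ binSpan k) : hel k f ∈ degSpan k := by
  have := normal_form_mem_degSpan hf 0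
  simpa [Yd_zero, Xd_zero] using this

lemma Yd_mul_Xd_mem_degSpan (m : ℕ) : Yd k m * Xd k m ∈ degSpan k := by
  have := normal_form_mem_degSpan (one_mem_binSpan (k := k)) m
  simpa [hel_one] using this

lemma one_mem_degSpan : (1 : U k) ∈ degSpan k := hel_one (k := k) ▸ hel_mem_degSpan one_mem_binSpan

lemma hel_commute_Yd_mul_Xd {f : ℤ → k} (hf : f ∈ binSpan k) (m : ℕ) :
    Commute (hel k f) (Yd k m * Xd k m) := by
  rw [commute_iff_eq, ← mul_assoc, hel_mul_Yd hf, mul_assoc, mul_assoc, Xd_mul_hel hf]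

/-- Expand both orders by Kostant's formula. In the longer expansion the terms with j > m vanish;
the remaining terms agree because the two binomial coefficients are exchanged by symmetry. -/
lemma Yd_mul_Xd_mul_aux {m l : ℕ} (h : m ≤ l) :
    Yd k m * Xd k m * (Yd k l * Xd k l) = Yd k l * Xd k l * (Yd k m * Xd k m) := by
  have h1 := normal_form_mul (one_mem_binSpan (k := k)) one_mem_binSpan m m l l
  have h2 := normal_form_mul (one_mem_binSpan (k := k)) one_mem_binSpan l l m m
  have hs : ∀ c : ℤ, shiftFun c (1 : ℤ → k) = 1 := fun c => rfl
  simp only [hel_one, mul_one, hs, one_mul] at h1 h2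
  rw [h1, h2]
  refine Finset.sum_subset_zero_on_sdiff ?_ ?_ ?_
  · intro j hj
    rw [Finset.mem_range] at hj ⊢
    omega
  · intro j hj
    rw [Finset.mem_sdiff, Finset.mem_range, Finset.mem_range] at hj
    rw [YdSub, if_neg (by omega)]
    simp
  · intro j hj
    have hj' : j ≤ m := by simpa [Nat.lt_succ_iff] using hj
    rw [YdSub, YdSub, if_pos hj', if_pos (hj'.trans h), Yd_mul_Yd, Yd_mul_Yd, Xd_mul_Xd, Xd_mul_Xd]
    have e1 : l + (m - j) = m + (l - j) := by omega
    have e2 : m - j + l = m + (l - j) := by omega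
    have e3 : l - j + m = m + (l - j) := by omega
    have e4 : (2 * (j : ℤ) - m - l) = 2 * j - l - m := by ring
    rw [e1, e2, e3, e4]
    simp only [smul_mul_assoc, mul_smul_comm, smul_smul]
    congr 1
    have c1 : (m + (l - j)).choose (m - j) = (m + (l - j)).choose l :=
      Nat.choose_symm_of_eq_add (by omega)
    have c2 : (m + (l - j)).choose (l - j) = (m + (l - j)).choose m :=
      Nat.choose_symm_of_eq_add (by omega)
    rw [c1, c2, mul_comm]

lemma Yd_mul_Xd_commute (m l : ℕ) : Commute (Yd k m * Xd k m) (Yd k l * Xd k l) := by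
  rcases le_total m l with h | h
  · exact Yd_mul_Xd_mul_aux h
  · exact (Yd_mul_Xd_mul_aux h).symm

lemma normal_form_eq {f : ℤ → k} (hf : f ∈ binSpan k) (m : ℕ) :
    Yd k m * hel k f * Xd k m = hel k (shiftFun (2 * m) f) * (Yd k m * Xd k m) := by
  rw [Yd_mul_hel hf, mul_assoc]

/-- Elements of degree zero commute. -/
lemma degSpan_commute {u v : U k} (hu : u ∈ degSpan k) (hv : v ∈ degSpan k) : Commute u v := by
  induction hu using degSpan_induction with
  | zero => exact Commute.zero_left _
  | add a b _ _ ha hb => exact ha.add_left hb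
  | smul c a _ ha => exact ha.smul_left c
  | normal m f hf =>
    induction hv using degSpan_induction with
    | zero => exact Commute.zero_right _
    | add a b _ _ ha hb => exact ha.add_right hb
    | smul c a _ ha => exact ha.smul_right c
    | normal l g hg =>
      rw [normal_form_eq hf, normal_form_eq hg]
      have hf' := shiftFun_mem hf (2 * m)
      have hg' := shiftFun_mem hg (2 * l)
      have h1 : Commute (hel k (shiftFun (2 * m) f)) (hel k (shiftFun (2 * l) g)) :=
        hel_commute hf' hg'
      exact (h1.mul_right (hel_commute_Yd_mul_Xd hf' l)).mul_left
        (((hel_commute_Yd_mul_Xd hg' m).symm).mul_right (Yd_mul_Xd_commute m l))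

variable (k) in
/-- The subalgebra of elements of degree zero. -/
noncomputable def degSubalgebra : Subalgebra k (U k) :=
  (degSpan k).toSubalgebra one_mem_degSpan fun _ _ => mul_mem_degSpan

variable (k) (p : ℕ) [hp : Fact p.Prime] [CharP k p]

/-- The span of the basis elements with all exponents less than `p ^ r`. -/
noncomputable def boxSpan (r : ℕ) : Submodule k (U k) :=
  Submodule.span k (pbw k '' {t | t.1 < p ^ r ∧ t.2.1 < p ^ r ∧ t.2.2 < p ^ r})

variable {k}

lemma normal_form_mem_boxSpan {r : ℕ} {f : ℤ → k} (hf : Function.Periodic f ((p ^ r : ℕ) : ℤ))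
    {m m' : ℕ} (hm : m < p ^ r) (hm' : m' < p ^ r) :
    Yd k m * hel k f * Xd k m' ∈ boxSpan k p r := by
  obtain ⟨a, rfl⟩ := exists_eq_sum_binFun_of_periodic k p hf
  rw [map_sum, Finset.mul_sum, Finset.sum_mul]
  refine sum_mem fun n hn => ?_
  rw [map_smul, mul_smul_comm, smul_mul_assoc, ← pbw_eq_hel]
  exact Submodule.smul_mem _ _ (Submodule.subset_span
    ⟨(m, n, m'), ⟨hm, Finset.mem_range.mp hn, hm'⟩, rfl⟩)

lemma shiftFun_periodic {q : ℤ} {f : ℤ → k} (hf : Function.Periodic f q) (c : ℤ) :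
    Function.Periodic (shiftFun c f) q := by
  intro z
  have : z + q + c = z + c + q := by ring
  rw [shiftFun_apply, shiftFun_apply, this, hf]

lemma one_mem_boxSpan (r : ℕ) : (1 : U k) ∈ boxSpan k p r := by
  have h := normal_form_mem_boxSpan (k := k) p (r := r) (f := 1) (fun z => rfl)
    (pow_pos_of_prime p r) (pow_pos_of_prime p r)
  simpa [Yd_zero, Xd_zero, hel_one] using h

/-- An exponent reaching p^r comes from an addition with carry, so its coefficient is zero; the
Cartan factors stay p^r-periodic. -/
lemma mul_mem_boxSpan {r : ℕ} {u v : U k} (hu : u ∈ boxSpan k p r) (hv : v ∈ boxSpan k p r) :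
    u * v ∈ boxSpan k p r := by
  rw [boxSpan] at hu hv
  induction hu using Submodule.span_induction with
  | zero => rw [zero_mul]; exact zero_mem _
  | add a b _ _ ha hb => rw [add_mul]; exact add_mem ha hb
  | smul c a _ ha => rw [smul_mul_assoc]; exact Submodule.smul_mem _ _ ha
  | mem a ha =>
    induction hv using Submodule.span_induction with
    | zero => rw [mul_zero]; exact zero_mem _
    | add a b _ _ ha hb => rw [mul_add]; exact add_mem ha hb
    | smul c a _ ha => rw [mul_smul_comm]; exact Submodule.smul_mem _ _ ha
    | mem b hb =>
      obtain ⟨⟨m, n, m'⟩, ⟨hm, hn, hm'⟩, rfl⟩ := ha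
      obtain ⟨⟨l, n', l'⟩, ⟨hl, hn', hl'⟩, rfl⟩ := hb
      dsimp only at hm hn hm' hl hn' hl'
      rw [pbw_eq_hel, pbw_eq_hel, normal_form_mul (binFun_mem k _ _) (binFun_mem k _ _)]
      refine sum_mem fun j hj => ?_
      have hj' : j ≤ m' := by simpa [Nat.lt_succ_iff] using hj
      rw [YdSub]
      split_ifs with hjl
      · by_cases h1 : p ^ r ≤ m + (l - j)
        · rw [Yd_mul_Yd_eq_zero k p hm (by omega) h1]
          simp
        by_cases h2 : p ^ r ≤ (m' - j) + l'
        · rw [Xd_mul_Xd_eq_zero k p (by omega) hl' h2]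
          simp
        rw [Yd_mul_Yd, Xd_mul_Xd, smul_mul_assoc, smul_mul_smul_comm]
        refine Submodule.smul_mem _ _ (normal_form_mem_boxSpan p ?_ (by omega) (by omega))
        exact ((shiftFun_periodic (binFun_periodic k p hn 0) _).mul
          (binFun_periodic k p (by omega) _)).mul (shiftFun_periodic (binFun_periodic k p hn' 0) _)
      · simp

lemma Ur_le_boxSpan {r : ℕ} {u : U k} (hu : u ∈ Ur k p r) : u ∈ boxSpan k p r := by
  have h : Ur k p r ≤ (boxSpan k p r).toSubalgebra (one_mem_boxSpan p r)
      fun _ _ => mul_mem_boxSpan p := by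
    refine Algebra.adjoin_le ?_
    rintro _ ⟨i, hi, rfl | rfl⟩
    · have := normal_form_mem_boxSpan (k := k) p (r := r) (f := 1) (fun z => rfl)
        (pow_pos_of_prime p r) (Nat.pow_lt_pow_right hp.out.one_lt hi)
      simpa [Yd_zero, hel_one] using this
    · have := normal_form_mem_boxSpan (k := k) p (r := r) (f := 1) (fun z => rfl)
        (Nat.pow_lt_pow_right hp.out.one_lt hi) (pow_pos_of_prime p r)
      simpa [Xd_zero, hel_one] using this
  exact h hu

lemma exists_top_digit {n : ℕ} (hn : n ≠ 0) :
    ∃ i, p ^ i ≤ n ∧ n < p ^ (i + 1) :=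
  ⟨Nat.log p n, Nat.pow_log_le_self p hn, Nat.lt_pow_succ_log_self hp.out.one_lt n⟩

lemma binomH_mem_of_forall_le (S : Subalgebra k (U k)) (c : ℤ) (n : ℕ)
    (h : ∀ l ≤ n, binomH k 0 l ∈ S) : binomH k c n ∈ S := by
  have h1 : binFun k c n = ∑ ij ∈ Finset.HasAntidiagonal.antidiagonal n,
      ((Ring.choose c ij.2 : ℤ) : k) • binFun k 0 ij.1 := by
    ext z
    rw [binFun, Ring.add_choose_eq n (Commute.all _ _), Finset.sum_apply]
    push_cast
    refine Finset.sum_congr rfl fun ij _ => ?_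
    simp [binFun, mul_comm]
  rw [← hel_binFun, h1, map_sum]
  refine sum_mem fun ij hij => ?_
  rw [map_smul, hel_binFun]
  refine Subalgebra.smul_mem _ (h _ ?_) _
  have := Finset.HasAntidiagonal.mem_antidiagonal.mp hij
  omega

/-- Split off the leading power p^i of n: binom(n, p^i) binom(H, n) = binom(H, p^i) binom(H - p^i, n
- p^i), with an invertible scalar on the left. The hypothesis may assume the binomials below p^i
because in U_r the element binom(H, p^i) is itself obtained from them. -/
lemma binomH_mem_of_prime_pow_mem (S : Subalgebra k (U k)) (r : ℕ)
    (h : ∀ i < r, (∀ l < p ^ i, binomH k 0 l ∈ S) → binomH k 0 (p ^ i) ∈ S) :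
    ∀ n < p ^ r, binomH k 0 n ∈ S := by
  intro n
  induction n using Nat.strong_induction_on with
  | _ n ih =>
    intro hn
    rcases eq_or_ne n 0 with rfl | hn0
    · rw [binomH_zero]
      exact one_mem _
    obtain ⟨i, hi1, hi2⟩ := exists_top_digit p hn0
    have hir : i < r := (Nat.pow_lt_pow_iff_right hp.out.one_lt).mp (hi1.trans_lt hn)
    have hpi := pow_pos_of_prime p i
    have hgen : binomH k 0 (p ^ i) ∈ S :=
      h i hir fun l hl => ih l (hl.trans_le hi1) ((hl.trans_le hi1).trans hn)
    have h1 : (n.choose (p ^ i) : k) • binFun k 0 n =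
        binFun k 0 (p ^ i) * binFun k (-((p ^ i : ℕ) : ℤ)) (n - p ^ i) := by
      ext z
      have h2 := Ring.choose_smul_choose z hi1
      rw [nsmul_eq_mul] at h2
      have h3 := congrArg (Int.cast (R := k)) h2
      push_cast at h3
      simpa [binFun, sub_eq_add_neg] using h3
    have h4 := congrArg (hel k) h1
    rw [map_smul, hel_mul (binFun_mem k _ _) (binFun_mem k _ _), hel_binFun, hel_binFun,
      hel_binFun] at h4
    have h5 : binomH k 0 n = (n.choose (p ^ i) : k)⁻¹ •
        (binomH k 0 (p ^ i) * binomH k (-((p ^ i : ℕ) : ℤ)) (n - p ^ i)) := by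
      rw [← h4, inv_smul_smul₀ (cast_choose_ne_zero_of_top_digit p hi1 hi2)]
    rw [h5]
    refine Subalgebra.smul_mem _ (mul_mem hgen (binomH_mem_of_forall_le S _ _ fun l hl => ?_)) _
    exact ih l (by omega) (by omega)

lemma hel_mem_of_binomH_mem (S : Subalgebra k (U k)) (h : ∀ n, binomH k 0 n ∈ S) {f : ℤ → k}
    (hf : f ∈ binSpan k) : hel k f ∈ S := by
  have h1 : binSpan k ≤ (Subalgebra.toSubmodule S).comap (hel k) := by
    refine Submodule.span_le.mpr ?_
    rintro _ ⟨n, rfl⟩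
    rw [SetLike.mem_coe, Submodule.mem_comap, hel_binFun]
    exact h n
  exact h1 hf

lemma hel_mem_A {f : ℤ → k} (hf : f ∈ binSpan k) : hel k f ∈ A k p := by
  refine Algebra.subset_adjoin (Or.inl ?_)
  refine hel_mem_of_binomH_mem (Uzero k p) (fun n => ?_) hf
  exact binomH_mem_of_prime_pow_mem p (Uzero k p) n
    (fun i _ _ => Algebra.subset_adjoin ⟨i, rfl⟩) n (Nat.lt_pow_self hp.out.one_lt)

/-- With p^i the leading power of m and b = m - p^i, the j = 0 term of the product of Y^(p^i)
X^(p^i) and Y^(b) X^(b) is an invertible multiple of Y^(m) X^(m); all other terms have smaller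
exponents. -/
lemma Yd_mul_Xd_mem_A (m : ℕ) : Yd k m * Xd k m ∈ A k p := by
  induction m using Nat.strong_induction_on with
  | _ m ih =>
    rcases eq_or_ne m 0 with rfl | hm0
    · rw [Yd_zero, Xd_zero, one_mul]
      exact one_mem _
    obtain ⟨i, hi1, hi2⟩ := exists_top_digit p hm0
    have hpi := pow_pos_of_prime p i
    obtain ⟨b, rfl⟩ := Nat.exists_eq_add_of_le hi1
    have h1 := normal_form_mul (one_mem_binSpan (k := k)) one_mem_binSpan (p ^ i) (p ^ i) b b
    have hs : ∀ c : ℤ, shiftFun c (1 : ℤ → k) = 1 := fun c => rfl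
    simp only [hel_one, mul_one, hs, one_mul] at h1
    rw [Finset.sum_range_succ', binFun_zero_right, hel_one, YdSub, if_pos (Nat.zero_le _),
      Nat.sub_zero, Nat.sub_zero, mul_one, Yd_mul_Yd, Xd_mul_Xd, smul_mul_smul_comm,
      ← sub_eq_iff_eq_add'] at h1
    have hc := cast_choose_ne_zero_of_top_digit (k := k) p hi1 hi2
    rw [← inv_smul_smul₀ (mul_ne_zero hc hc) (Yd k (p ^ i + b) * Xd k (p ^ i + b)), ← h1]
    refine Subalgebra.smul_mem _ (sub_mem (mul_mem ?_ (ih b (by omega))) (sum_mem fun j hj => ?_)) _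
    · exact Algebra.subset_adjoin (Or.inr ⟨i, rfl⟩)
    · rw [Finset.mem_range] at hj
      rw [YdSub]
      split_ifs with hjb
      · have e : p ^ i - (j + 1) + b = p ^ i + (b - (j + 1)) := by omega
        rw [Yd_mul_Yd, Xd_mul_Xd, e, smul_mul_assoc, smul_mul_smul_comm,
          normal_form_eq (binFun_mem k _ _)]
        exact Subalgebra.smul_mem _ (mul_mem (hel_mem_A p (shiftFun_mem (binFun_mem k _ _) _))
          (ih _ (by omega))) _
      · simp

lemma mem_A_iff {u : U k} : u ∈ A k p ↔ u ∈ degSpan k := by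
  constructor
  · intro hu
    have h : A k p ≤ degSubalgebra k := by
      refine Algebra.adjoin_le (Set.union_subset ?_ ?_)
      · have h2 : Uzero k p ≤ degSubalgebra k := by
          refine Algebra.adjoin_le ?_
          rintro _ ⟨i, rfl⟩
          rw [← hel_binFun]
          exact hel_mem_degSpan (binFun_mem k _ _)
        exact h2
      · rintro _ ⟨i, rfl⟩
        exact Yd_mul_Xd_mem_degSpan _
    exact h hu
  · intro hu
    induction hu using degSpan_induction with
    | zero => exact zero_mem _
    | add a b _ _ ha hb => exact add_mem ha hb
    | smul c a _ ha => exact Subalgebra.smul_mem _ ha _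
    | normal m f hf =>
      rw [normal_form_eq hf]
      exact mul_mem (hel_mem_A p (shiftFun_mem hf _)) (Yd_mul_Xd_mem_A p m)

lemma Xd_mem_Ur {r m : ℕ} (hm : m < p ^ r) : Xd k m ∈ Ur k p r := by
  induction m using Nat.strong_induction_on with
  | _ m ih =>
    rcases eq_or_ne m 0 with rfl | hm0
    · rw [Xd_zero]
      exact one_mem _
    obtain ⟨i, hi1, hi2⟩ := exists_top_digit p hm0
    have hpi := pow_pos_of_prime p i
    have hir : i < r := (Nat.pow_lt_pow_iff_right hp.out.one_lt).mp (hi1.trans_lt hm)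
    obtain ⟨b, rfl⟩ := Nat.exists_eq_add_of_le hi1
    have h1 := Xd_mul_Xd k (p ^ i) b
    rw [← inv_smul_smul₀ (cast_choose_ne_zero_of_top_digit (k := k) p hi1 hi2)
      (Xd k (p ^ i + b)), ← h1]
    refine Subalgebra.smul_mem _ (mul_mem ?_ (ih b (by omega) (by omega))) _
    exact Algebra.subset_adjoin ⟨i, hir, Or.inl rfl⟩

lemma Yd_mem_Ur {r m : ℕ} (hm : m < p ^ r) : Yd k m ∈ Ur k p r := by
  induction m using Nat.strong_induction_on with
  | _ m ih =>
    rcases eq_or_ne m 0 with rfl | hm0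
    · rw [Yd_zero]
      exact one_mem _
    obtain ⟨i, hi1, hi2⟩ := exists_top_digit p hm0
    have hpi := pow_pos_of_prime p i
    have hir : i < r := (Nat.pow_lt_pow_iff_right hp.out.one_lt).mp (hi1.trans_lt hm)
    obtain ⟨b, rfl⟩ := Nat.exists_eq_add_of_le hi1
    have h1 := Yd_mul_Yd k (p ^ i) b
    rw [← inv_smul_smul₀ (cast_choose_ne_zero_of_top_digit (k := k) p hi1 hi2)
      (Yd k (p ^ i + b)), ← h1]
    refine Subalgebra.smul_mem _ (mul_mem ?_ (ih b (by omega) (by omega))) _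
    exact Algebra.subset_adjoin ⟨i, hir, Or.inr rfl⟩

/-- The element binom(H, p^i) is the last term of Kostant's formula for X^(p^i) Y^(p^i), and the
earlier terms involve only smaller binomials. -/
lemma binomH_mem_Ur {r n : ℕ} (hn : n < p ^ r) : binomH k 0 n ∈ Ur k p r := by
  refine binomH_mem_of_prime_pow_mem p (Ur k p r) r (fun i hi hl => ?_) n hn
  have hlt : p ^ i < p ^ r := Nat.pow_lt_pow_right hp.out.one_lt hi
  have h := Xd_mul_Yd k (p ^ i) (p ^ i)
  have h0 : (2 * ((p ^ i : ℕ) : ℤ) - (p ^ i : ℕ) - (p ^ i : ℕ)) = 0 := by ring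
  rw [Finset.sum_range_succ, h0, YdSub, if_pos le_rfl, Nat.sub_self, Xd_zero, Yd_zero, one_mul,
    mul_one, hel_binFun, ← sub_eq_iff_eq_add'] at h
  rw [← h]
  refine sub_mem (mul_mem (Xd_mem_Ur p hlt) (Yd_mem_Ur p hlt)) (sum_mem fun j hj => ?_)
  rw [Finset.mem_range] at hj
  refine mul_mem (mul_mem ?_ ?_) (Xd_mem_Ur p (by omega))
  · rw [YdSub]
    split_ifs
    · exact Yd_mem_Ur p (by omega)
    · exact zero_mem _
  · rw [hel_binFun]
    exact binomH_mem_of_forall_le _ _ _ fun l hl' => hl l (by omega)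

lemma hel_mem_Ur {r : ℕ} {f : ℤ → k} (hf : Function.Periodic f ((p ^ r : ℕ) : ℤ)) :
    hel k f ∈ Ur k p r := by
  obtain ⟨a, rfl⟩ := exists_eq_sum_binFun_of_periodic k p hf
  rw [map_sum]
  refine sum_mem fun n hn => ?_
  rw [map_smul, hel_binFun]
  exact Subalgebra.smul_mem _ (binomH_mem_Ur p (Finset.mem_range.mp hn)) _

variable (k) in
/-- The finitely many basis elements of degree zero with exponents less than `p ^ r`. -/
noncomputable def degBox (r : ℕ) : Finset (U k) :=
  open Classical in
  (Finset.range (p ^ r) ×ˢ Finset.range (p ^ r)).image fun t => pbw k (t.1, t.2, t.1)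

lemma degBox_card_le (r : ℕ) : (degBox k p r).card ≤ (p ^ 2) ^ r := by
  classical
  refine Finset.card_image_le.trans ?_
  rw [Finset.card_product, Finset.card_range, ← pow_mul, ← pow_add]
  exact (congrArg _ (by ring)).le

/-- Being in A and in U_r are both conditions on PBW coordinates, so they can be intersected. The
resulting bound p^{2r} on the dimension is what the counting argument for the B's needs. -/
lemma mem_Ar_iff {r : ℕ} {u : U k} :
    u ∈ Ar k p r ↔ u ∈ Submodule.span k (degBox k p r : Set (U k)) := by
  classical
  constructor
  · rintro ⟨hA, hU⟩
    have h1 : u ∈ degSpan k := (mem_A_iff p).mp hA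
    have h2 := Ur_le_boxSpan p hU
    have e1 : degSpan k = Submodule.span k (pbwBasis k '' {t | t.1 = t.2.2}) := by
      rw [degSpan, coe_pbwBasis]
      congr 1
      ext v
      constructor
      · rintro ⟨t, rfl⟩
        exact ⟨(t.1, t.2, t.1), rfl, rfl⟩
      · rintro ⟨⟨m, n, m'⟩, h, rfl⟩
        exact ⟨(m, n), by dsimp at h; subst h; rfl⟩
    rw [e1, Module.Basis.mem_span_image] at h1
    rw [boxSpan, ← coe_pbwBasis, Module.Basis.mem_span_image] at h2
    have h3 : u ∈ Submodule.span k (pbwBasis k '' ({t | t.1 = t.2.2} ∩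
        {t | t.1 < p ^ r ∧ t.2.1 < p ^ r ∧ t.2.2 < p ^ r})) :=
      (Module.Basis.mem_span_image _).mpr (Set.subset_inter h1 h2)
    refine Submodule.span_mono ?_ h3
    rintro _ ⟨⟨m, n, m'⟩, ⟨h, hb⟩, rfl⟩
    dsimp at h hb
    subst h
    rw [degBox, Finset.coe_image]
    exact ⟨(m, n), by simp [hb.1, hb.2.1], by rw [pbwBasis_apply]⟩
  · intro hu
    have h : Submodule.span k (degBox k p r : Set (U k)) ≤ Subalgebra.toSubmodule (Ar k p r) := by
      refine Submodule.span_le.mpr ?_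
      intro v hv
      rw [degBox, Finset.coe_image] at hv
      obtain ⟨⟨m, n⟩, hmn, rfl⟩ := hv
      simp only [Finset.coe_product, Set.mem_prod, Finset.mem_coe, Finset.mem_range] at hmn
      refine ⟨(mem_A_iff p).mpr (Submodule.subset_span ⟨(m, n), rfl⟩), ?_⟩
      exact mul_mem (mul_mem (Yd_mem_Ur p hmn.1) (binomH_mem_Ur p hmn.2)) (Xd_mem_Ur p hmn.1)
    exact h hu

end DegreeZero

end SL2Hyper

namespace SL2Hyper

/-! ### Polynomials in YX on a single weight space. -/

section Powers

set_option linter.unusedSectionVars false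

open Polynomial

variable (k : Type*) [Field k]

lemma Yd_one_pow (m : ℕ) : Yd k 1 ^ m = (m ! : k) • Yd k m := by
  induction m with
  | zero => simp [Yd_zero]
  | succ m ih =>
    rw [pow_succ, ih, smul_mul_assoc, Yd_mul_Yd, smul_smul, Nat.choose_symm_add,
      Nat.choose_one_right, Nat.factorial_succ, mul_comm]
    push_cast
    rfl

lemma Xd_one_pow (m : ℕ) : Xd k 1 ^ m = (m ! : k) • Xd k m := by
  induction m with
  | zero => simp [Xd_zero]
  | succ m ih =>
    rw [pow_succ, ih, smul_mul_assoc, Xd_mul_Xd, smul_smul, Nat.choose_symm_add,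
      Nat.choose_one_right, Nat.factorial_succ, mul_comm]
    push_cast
    rfl

variable {k}

lemma hel_mul_Yd_pow {f : ℤ → k} (hf : f ∈ binSpan k) (m : ℕ) :
    hel k f * Yd k 1 ^ m = Yd k 1 ^ m * hel k (shiftFun (-(2 * m)) f) := by
  rw [Yd_one_pow, mul_smul_comm, hel_mul_Yd hf, smul_mul_assoc]

lemma Xd_pow_mul_hel {f : ℤ → k} (hf : f ∈ binSpan k) (m : ℕ) :
    Xd k 1 ^ m * hel k f = hel k (shiftFun (-(2 * m)) f) * Xd k 1 ^ m := by
  rw [Xd_one_pow, mul_smul_comm, smul_mul_assoc, Xd_mul_hel hf]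

variable (k) in
/-- The element `Y X`. -/
noncomputable def yx : U k := Yd k 1 * Xd k 1

lemma yx_mem_degSpan : yx k ∈ degSpan k := Yd_mul_Xd_mem_degSpan 1

lemma aeval_yx_mem_degSpan (g : k[X]) : aeval (yx k) g ∈ degSpan k := by
  have h : Algebra.adjoin k {yx k} ≤ degSubalgebra k :=
    Algebra.adjoin_le (Set.singleton_subset_iff.mpr yx_mem_degSpan)
  exact h (aeval_mem_adjoin_singleton k _)

/-- The function `z ↦ z` with values in `k`. -/
def idFun (k : Type*) [Field k] : ℤ → k := fun z => (z : k)

lemma idFun_eq : idFun k = binFun k 0 1 := by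
  ext z
  simp [idFun, binFun]

lemma Xd_one_mul_Yd_one : Xd k 1 * Yd k 1 = yx k + hel k (idFun k) := by
  have h := Xd_mul_Yd k 1 1
  rw [Finset.sum_range_succ, Finset.sum_range_one, binFun_zero_right, hel_one] at h
  simpa [YdSub, Xd_zero, Yd_zero, idFun_eq, yx] using h

lemma idFun_mem : idFun k ∈ binSpan k := idFun_eq (k := k) ▸ binFun_mem k 0 1

lemma Xd_one_mul_Yd_pow (m : ℕ) : Xd k 1 * Yd k 1 ^ (m + 1) =
    Yd k 1 ^ (m + 1) * Xd k 1 +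
      ((m : k) + 1) • (Yd k 1 ^ m * (hel k (idFun k) - algebraMap k (U k) m)) := by
  induction m with
  | zero => simp [Xd_one_mul_Yd_one, yx]
  | succ m ih =>
    have h1 : hel k (idFun k) * Yd k 1 ^ (m + 1) =
        Yd k 1 ^ (m + 1) * (hel k (idFun k) - algebraMap k (U k) (2 * (m + 1))) := by
      rw [hel_mul_Yd_pow idFun_mem]
      congr 1
      have : shiftFun (-(2 * (m + 1 : ℕ))) (idFun k) =
          idFun k - (2 * ((m : k) + 1)) • (1 : ℤ → k) := by
        ext z
        simp [idFun]
        ring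
      rw [this, map_sub, map_smul, hel_one, Algebra.algebraMap_eq_smul_one]
    rw [pow_succ' _ (m + 1), ← mul_assoc, Xd_one_mul_Yd_one, add_mul, h1, yx, mul_assoc, ih,
      mul_add, mul_smul_comm, ← mul_assoc, ← mul_assoc, ← pow_succ', ← pow_succ', add_assoc]
    congr 1
    rw [← mul_smul_comm, ← mul_smul_comm, ← mul_add]
    congr 1
    simp only [Algebra.algebraMap_eq_smul_one]
    push_cast
    module

variable (p : ℕ) [hp : Fact p.Prime] [CharP k p]

lemma Yd_pow_eq_zero {m : ℕ} (hm : p ≤ m) : Yd k 1 ^ m = 0 := by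
  have h : (m ! : k) = 0 := (CharP.cast_eq_zero_iff k p _).mpr
    ((Nat.Prime.dvd_factorial hp.out).mpr hm)
  rw [Yd_one_pow, h, zero_smul]

lemma cast_factorial_ne_zero {m : ℕ} (hm : m < p) : (m ! : k) ≠ 0 := by
  rw [Ne, CharP.cast_eq_zero_iff k p, Nat.Prime.dvd_factorial hp.out]
  omega

/-- A function restricted to a residue class on which it is constant. -/
lemma mul_resFun_eq_smul {f : ℤ → k} (hf : Function.Periodic f (p : ℤ)) (a : ℤ) :
    f * resFun p a = f a • resFun p a := by
  ext z
  rw [Pi.mul_apply, Pi.smul_apply, smul_eq_mul]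
  by_cases h : (p : ℤ) ∣ z - a
  · obtain ⟨c, hc⟩ := h
    have h1 := hf.sub_zsmul_eq (x := z) c
    have hz : z - c • (p : ℤ) = a := by rw [smul_eq_mul]; linarith
    rw [← h1, hz]
  · simp [resFun, h]

lemma idFun_mul_resFun (a : ℤ) : idFun k * resFun p a = (a : k) • resFun p a :=
  mul_resFun_eq_smul p (fun z => by simp [idFun]) a

/-- The idempotent of the residue class of `a`. -/
noncomputable def wt (k : Type*) [Field k] (p : ℕ) (a : ℤ) : U k := hel k (resFun p a)

lemma wt_mem_degSpan (a : ℤ) : wt k p a ∈ degSpan k := hel_mem_degSpan (resFun_mem p a)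

lemma wt_mul_self (a : ℤ) : wt k p a * wt k p a = wt k p a := by
  rw [wt, ← hel_mul (resFun_mem p a) (resFun_mem p a), resFun_mul_self]

lemma wt_congr {a b : ℤ} (h : (p : ℤ) ∣ a - b) : wt k p a = wt k p b := by
  rw [wt, wt, resFun_congr p h]

lemma wt_mul_of_not_dvd {a b : ℤ} (h : ¬ (p : ℤ) ∣ a - b) : wt k p a * wt k p b = 0 := by
  rw [wt, wt, ← hel_mul (resFun_mem p a) (resFun_mem p b), resFun_mul_of_not_dvd p h, map_zero]

lemma wt_mul_Yd_pow (a : ℤ) (m : ℕ) :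
    wt k p a * Yd k 1 ^ m = Yd k 1 ^ m * wt k p (a + 2 * m) := by
  rw [wt, hel_mul_Yd_pow (resFun_mem p a), shiftFun_resFun, wt, sub_neg_eq_add]

lemma Xd_pow_mul_wt (a : ℤ) (m : ℕ) :
    Xd k 1 ^ m * wt k p a = wt k p (a + 2 * m) * Xd k 1 ^ m := by
  rw [wt, Xd_pow_mul_hel (resFun_mem p a), shiftFun_resFun, wt, sub_neg_eq_add]

lemma hel_idFun_mul_wt (a : ℤ) : hel k (idFun k) * wt k p a = (a : k) • wt k p a := by
  rw [wt, ← hel_mul idFun_mem (resFun_mem p a), idFun_mul_resFun, map_smul]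

lemma wt_commute {u : U k} (hu : u ∈ degSpan k) (a : ℤ) : wt k p a * u = u * wt k p a :=
  degSpan_commute (wt_mem_degSpan p a) hu

/-- For b = a + 2m the scalar becomes m(m + a + 1), which is where the roots of φ come from. -/
lemma yx_mul_Yd_pow_mul_wt (m : ℕ) (b : ℤ) :
    yx k * (Yd k 1 ^ m * wt k p b) =
      Yd k 1 ^ (m + 1) * Xd k 1 * wt k p b + ((m : k) * (b - m + 1)) • (Yd k 1 ^ m * wt k p b) := by
  rcases m with _ | m
  · simp [yx]
  · rw [yx, mul_assoc, ← mul_assoc (Xd k 1), Xd_one_mul_Yd_pow, add_mul, smul_mul_assoc,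
      mul_assoc _ (_ - _), sub_mul, hel_idFun_mul_wt, mul_add, mul_smul_comm, ← mul_assoc,
      ← mul_assoc, ← pow_succ', ← Algebra.smul_def, ← sub_smul, mul_smul_comm, mul_smul_comm,
      ← mul_assoc, ← pow_succ', smul_smul]
    congr 2
    push_cast
    ring

variable (k)

/-- The polynomial `∏_{s ≤ i < m} (x - i (i + a + 1))`. -/
noncomputable def phiIco (a : ℤ) (s m : ℕ) : k[X] :=
  ∏ i ∈ Finset.Ico s m, (X - C ((i : k) * (i + a + 1)))

lemma phiIco_self (a : ℤ) (s : ℕ) : phiIco k a s s = 1 := by simp [phiIco]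

lemma phiIco_mul_phiIco (a : ℤ) {s m n : ℕ} (h1 : s ≤ m) (h2 : m ≤ n) :
    phiIco k a s m * phiIco k a m n = phiIco k a s n := by
  rw [phiIco, phiIco, phiIco, Finset.prod_Ico_consecutive _ h1 h2]

lemma phiIco_monic (a : ℤ) (s m : ℕ) : (phiIco k a s m).Monic :=
  monic_prod_of_monic _ _ fun _ _ => monic_X_sub_C _

lemma phiIco_natDegree (a : ℤ) (s m : ℕ) : (phiIco k a s m).natDegree = m - s := by
  rw [phiIco, natDegree_prod_of_monic _ _ fun i _ => monic_X_sub_C _]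
  simp only [natDegree_X_sub_C, Finset.sum_const, Nat.card_Ico, smul_eq_mul, mul_one]

variable {k}

/-- Each factor YX - m(m + a + 1) cancels the scalar part and raises the exponents of Y and X by
one. Stopping at m = p, where Y^p = 0, gives the annihilating polynomial. -/
lemma aeval_phiIco_mul (a : ℤ) {s m : ℕ} (h : s ≤ m) :
    aeval (yx k) (phiIco k a s m) * (Yd k 1 ^ s * wt k p (a + 2 * s)) =
      Yd k 1 ^ m * Xd k 1 ^ (m - s) * wt k p (a + 2 * s) := by
  induction m, h using Nat.le_induction with
  | base => simp [phiIco_self]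
  | succ m hm ih =>
    have e1 : phiIco k a s (m + 1) = (X - C ((m : k) * (m + a + 1))) * phiIco k a s m := by
      rw [phiIco, Finset.prod_Ico_succ_top hm, mul_comm, phiIco]
    have e2 : m + 1 - s = m - s + 1 := by omega
    rw [e1, map_mul, mul_assoc, ih, map_sub, aeval_X, aeval_C, mul_assoc, Xd_pow_mul_wt, e2]
    have h1 := yx_mul_Yd_pow_mul_wt (k := k) p m (a + 2 * s + 2 * (m - s : ℕ))
    have h2 : ((m : k) * (m + a + 1)) = (m : k) * (((a + 2 * s + 2 * (m - s : ℕ) : ℤ) : k) - m + 1) := by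
      push_cast [Nat.cast_sub hm]
      ring
    rw [← mul_assoc (Yd k 1 ^ m), ← mul_assoc, sub_mul, h2, ← Algebra.smul_def, h1,
      add_sub_cancel_right, mul_assoc, mul_assoc, ← Xd_pow_mul_wt, ← mul_assoc (Xd k 1),
      ← pow_succ', mul_assoc]

lemma aeval_phiIco_zero_mul_wt (a : ℤ) (m : ℕ) :
    aeval (yx k) (phiIco k a 0 m) * wt k p a = Yd k 1 ^ m * Xd k 1 ^ m * wt k p a := by
  have := aeval_phiIco_mul (k := k) p a (Nat.zero_le m)
  simpa using this

/-- The polynomial describing `X ^ n Y ^ n` on the weight space of weight `a`. -/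
noncomputable def chiPoly (k : Type*) [Field k] (a : ℤ) (n : ℕ) : k[X] :=
  ∏ i ∈ Finset.range n, (X + C (((i : k) + 1) * (a - i)))

/-- The counterpart for the opposite order of X and Y, used where a power of Y is needed on the
right. -/
lemma aeval_chiPoly_mul_wt (a : ℤ) (n : ℕ) :
    aeval (yx k) (chiPoly k a n) * wt k p a = Xd k 1 ^ n * Yd k 1 ^ n * wt k p a := by
  induction n with
  | zero => simp [chiPoly]
  | succ n ih =>
    have e1 : chiPoly k a (n + 1) = (X + C (((n : k) + 1) * (a - n))) * chiPoly k a n := by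
      rw [chiPoly, Finset.prod_range_succ, mul_comm, chiPoly]
    have h1 : Xd k 1 * Yd k 1 ^ (n + 1) * wt k p a =
        Yd k 1 ^ n * (yx k * wt k p a) + (((n : k) + 1) * (a - n)) • (Yd k 1 ^ n * wt k p a) := by
      rw [Xd_one_mul_Yd_pow, add_mul, smul_mul_assoc, mul_assoc _ (_ - _), sub_mul,
        hel_idFun_mul_wt, ← Algebra.smul_def, ← sub_smul, mul_smul_comm, smul_smul, pow_succ, yx]
      simp only [mul_assoc]
    have hdeg : Xd k 1 ^ n * Yd k 1 ^ n * wt k p a ∈ degSpan k := by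
      rw [← ih]
      exact mul_mem_degSpan (aeval_yx_mem_degSpan _) (wt_mem_degSpan p a)
    have h2 : Xd k 1 ^ (n + 1) * Yd k 1 ^ (n + 1) * wt k p a =
        Xd k 1 ^ n * (Xd k 1 * Yd k 1 ^ (n + 1) * wt k p a) := by
      rw [pow_succ (Xd k 1)]
      simp only [mul_assoc]
    rw [e1, map_mul, mul_assoc, ih, map_add, aeval_X, aeval_C, add_mul, ← Algebra.smul_def,
      (degSpan_commute yx_mem_degSpan hdeg).eq, h2, h1, mul_add, mul_smul_comm,
      ← wt_commute p yx_mem_degSpan]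
    simp only [mul_assoc]

end Powers

end SL2Hyper

namespace SL2Hyper

/-! ### Where the Frobenius splitting `Fr'` is multiplicative. -/

section FrobeniusSplitting

set_option linter.unusedSectionVars false

variable {k : Type*} [Field k] (p : ℕ) [hp : Fact p.Prime] [CharP k p]

variable (k) in
lemma cast_choose_mul_prime (n m : ℕ) : ((n * p).choose (m * p) : k) = (n.choose m : k) := by
  rw [cast_choose_lucas k p, Nat.mul_mod_left, Nat.mul_mod_left, Nat.choose_zero_right,
    Nat.mul_div_cancel _ hp.out.pos, Nat.mul_div_cancel _ hp.out.pos]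
  simp

lemma Yd_mul_prime (m n : ℕ) :
    Yd k (m * p) * Yd k (n * p) = ((m + n).choose m : k) • Yd k ((m + n) * p) := by
  rw [Yd_mul_Yd, ← add_mul, cast_choose_mul_prime]

lemma Xd_mul_prime (m n : ℕ) :
    Xd k (m * p) * Xd k (n * p) = ((m + n).choose m : k) • Xd k ((m + n) * p) := by
  rw [Xd_mul_Xd, ← add_mul, cast_choose_mul_prime]

lemma Yd_add_mul_prime {i : ℕ} (hi : i < p) (e : ℕ) :
    Yd k (i + e * p) = Yd k i * Yd k (e * p) := by
  have h1 : ((i + e * p).choose i : k) = 1 := by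
    rw [cast_choose_lucas k p, Nat.add_mul_mod_self_right, Nat.mod_eq_of_lt hi, Nat.choose_self,
      Nat.div_eq_of_lt hi, Nat.choose_zero_right]
    simp
  rw [Yd_mul_Yd, h1, one_smul]

lemma Xd_add_mul_prime {i : ℕ} (hi : i < p) (e : ℕ) :
    Xd k (i + e * p) = Xd k i * Xd k (e * p) := by
  have h1 : ((i + e * p).choose i : k) = 1 := by
    rw [cast_choose_lucas k p, Nat.add_mul_mod_self_right, Nat.mod_eq_of_lt hi, Nat.choose_self,
      Nat.div_eq_of_lt hi, Nat.choose_zero_right]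
    simp
  rw [Xd_mul_Xd, h1, one_smul]

/-- Induction on elements of `U` in normal form. -/
lemma normal_form_induction {P : U k → Prop} (zero : P 0)
    (add : ∀ u v, P u → P v → P (u + v)) (smul : ∀ (c : k) u, P u → P (c • u))
    (normal : ∀ (m m' : ℕ) (f : ℤ → k), f ∈ binSpan k → P (Yd k m * hel k f * Xd k m'))
    (u : U k) : P u := by
  have hu : u ∈ Submodule.span k (Set.range (pbwBasis k)) := by
    rw [(pbwBasis k).span_eq]
    trivial
  induction hu using Submodule.span_induction with
  | zero => exact zero
  | add a b _ _ ha hb => exact add a b ha hb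
  | smul c a _ ha => exact smul c a ha
  | mem a ha =>
    obtain ⟨t, rfl⟩ := ha
    rw [pbwBasis_apply, pbw_eq_hel]
    exact normal _ _ _ (binFun_mem k _ _)

/-- Binomials of multiples of p reduce by Lucas' theorem, so `Fr'` respects left factors from Y and
H and right factors from X. Only moving an X past a Y can break multiplicativity. -/
lemma Fr'_Yd_mul (c : ℕ) (u : U k) : Fr' k p (Yd k c * u) = Yd k (c * p) * Fr' k p u := by
  induction u using normal_form_induction with
  | zero => simp
  | add u v hu hv => rw [mul_add, map_add, hu, hv, map_add, mul_add]
  | smul a u hu => rw [mul_smul_comm, map_smul, hu, map_smul, mul_smul_comm]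
  | normal m m' f hf =>
    rw [← mul_assoc, ← mul_assoc, Yd_mul_Yd, smul_mul_assoc, smul_mul_assoc, map_smul,
      Fr'_apply p hf, Fr'_apply p hf, ← mul_assoc, ← mul_assoc, Yd_mul_prime, smul_mul_assoc,
      smul_mul_assoc]

lemma Fr'_mul_Xd (d : ℕ) (u : U k) : Fr' k p (u * Xd k d) = Fr' k p u * Xd k (d * p) := by
  induction u using normal_form_induction with
  | zero => simp
  | add u v hu hv => rw [add_mul, map_add, hu, hv, map_add, add_mul]
  | smul a u hu => rw [smul_mul_assoc, map_smul, hu, map_smul, smul_mul_assoc]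
  | normal m m' f hf =>
    rw [mul_assoc, Xd_mul_Xd, mul_smul_comm, map_smul, Fr'_apply p hf, Fr'_apply p hf,
      mul_assoc _ (Xd k (m' * p)), Xd_mul_prime, mul_smul_comm]

lemma Fr'_hel_mul {f : ℤ → k} (hf : f ∈ binSpan k) (u : U k) :
    Fr' k p (hel k f * u) = hel k (frobFun k p f) * Fr' k p u := by
  induction u using normal_form_induction with
  | zero => simp
  | add u v hu hv => rw [mul_add, map_add, hu, hv, map_add, mul_add]
  | smul a u hu => rw [mul_smul_comm, map_smul, hu, map_smul, mul_smul_comm]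
  | normal m m' g hg =>
    rw [← mul_assoc, ← mul_assoc, hel_mul_Yd hf, mul_assoc (Yd k m),
      ← hel_mul (shiftFun_mem hf _) hg, Fr'_apply p (mul_mem_binSpan (shiftFun_mem hf _) hg),
      Fr'_apply p hg, frobFun_mul, hel_mul (frobFun_mem p (shiftFun_mem hf _)) (frobFun_mem p hg),
      frobFun_shiftFun, ← mul_assoc, ← mul_assoc, ← mul_assoc, hel_mul_Yd (frobFun_mem p hf)]
    have e : (p : ℤ) * -(2 * m) = -(2 * (m * p : ℕ)) := by push_cast; ring
    rw [e]

lemma Fr'_mem_degSpan {z : U k} (hz : z ∈ degSpan k) : Fr' k p z ∈ degSpan k := by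
  induction hz using degSpan_induction with
  | zero => rw [map_zero]; exact zero_mem _
  | add a b _ _ ha hb => rw [map_add]; exact add_mem ha hb
  | smul c a _ ha => rw [map_smul]; exact Submodule.smul_mem _ _ ha
  | normal m f hf =>
    rw [Fr'_apply p hf]
    exact normal_form_mem_degSpan (frobFun_mem p hf) _

/-- The condition on `v` under which `v * Fr' u * Fr' u' = v * Fr' (u * u')`: it lies in the right
weight space of weight `w` and is killed by sufficiently high divided powers of `Y`. -/
structure IsAdmissible (w : ℕ) (v : U k) : Prop where
  mul_wt : v * wt k p w = v
  mul_Yd : ∀ i, p ≤ i + w → i < p → v * Yd k i = 0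

lemma IsAdmissible.mul_Yd_prime {w : ℕ} {v : U k} (h : IsAdmissible p w v) (c : ℕ) :
    IsAdmissible p w (v * Yd k (c * p)) where
  mul_wt := by
    rw [wt, mul_assoc, Yd_mul_hel (resFun_mem p _), shiftFun_resFun]
    have e : resFun (k := k) p ((w : ℤ) - 2 * (c * p : ℕ)) = resFun p (w : ℤ) :=
      resFun_congr p ⟨-(2 * c), by push_cast; ring⟩
    rw [e, ← mul_assoc, ← wt, h.mul_wt]
  mul_Yd i h1 h2 := by
    rw [mul_assoc, Yd_commute, ← mul_assoc, h.mul_Yd i h1 h2, zero_mul]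

lemma IsAdmissible.mul_hel {w : ℕ} {v : U k} (h : IsAdmissible p w v) {f : ℤ → k}
    (hf : f ∈ binSpan k) : IsAdmissible p w (v * hel k f) where
  mul_wt := by
    rw [wt, mul_assoc, hel_commute hf (resFun_mem p _), ← mul_assoc, ← wt, h.mul_wt]
  mul_Yd i h1 h2 := by
    rw [mul_assoc, hel_mul_Yd hf, ← mul_assoc, h.mul_Yd i h1 h2, zero_mul]

/-- These are the terms of Kostant's formula for X^(dp) Y^(cp) with no counterpart under `Fr'`.
Write J = j₁p + j₀ with 0 < j₀ < p. The Y-part contains Y^(p - j₀), and the binomial contributes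
binom(w, j₀) at weight w. This scalar is zero if w < j₀; otherwise (p - j₀) + w ≥ p and
admissibility kills Y^(p - j₀). -/
lemma IsAdmissible.mul_YdSub_mul_hel_eq_zero {w : ℕ} {v : U k}
    (h : IsAdmissible p w v) (c d J : ℕ) (hJ : ¬ p ∣ J) :
    v * (YdSub k (c * p) J * hel k (binFun k (2 * J - (d * p : ℕ) - (c * p : ℕ)) J)) = 0 := by
  rw [YdSub]
  split_ifs with hJc
  swap
  · simp
  have hp0 := hp.out.pos
  set j0 := J % p with hj0
  set j1 := J / p with hj1
  have hJeq : J = j1 * p + j0 := by rw [hj0, hj1, mul_comm]; exact (Nat.div_add_mod J p).symm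
  have hj0p : j0 < p := Nat.mod_lt _ hp0
  have hj0pos : 0 < j0 := Nat.pos_of_ne_zero fun h0 => hJ (Nat.dvd_of_mod_eq_zero (hj0 ▸ h0))
  have hj1c : j1 < c := by
    by_contra hcon
    have : c * p ≤ j1 * p := Nat.mul_le_mul_right p (not_lt.mp hcon)
    omega
  obtain ⟨e, rfl⟩ := Nat.exists_eq_add_of_lt hj1c
  have hsub : (j1 + e + 1) * p - J = (p - j0) + e * p := by
    rw [hJeq, add_mul, add_mul, one_mul]
    omega
  have hY : Yd k ((j1 + e + 1) * p - J) = Yd k (p - j0) * Yd k (e * p) := by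
    rw [hsub, Yd_add_mul_prime p (by omega)]
  have hshift : (2 * (((j1 + e + 1) * p - J : ℕ) : ℤ) +
      (2 * J - (d * p : ℕ) - ((j1 + e + 1) * p : ℕ))) = p * (j1 + e + 1 - d) := by
    push_cast [Nat.cast_sub hJc]
    ring
  have hB : binFun k (p * (j1 + e + 1 - d)) J =
      shiftFun (p * (j1 + e + 1 - d)) (frobFun k p (binFun k 0 j1)) * binFun k 0 j0 := by
    have h1 : binFun k 0 J = frobFun k p (binFun k 0 j1) * binFun k 0 j0 := by
      ext z
      rw [hJeq, binFun_lucas k p j1 j0 hj0p z]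
      rfl
    have hper : Function.Periodic (binFun k 0 j0) (p : ℤ) := by
      have := binFun_periodic k p (n := j0) (r := 1) (by rwa [pow_one]) 0
      rwa [pow_one] at this
    have h2 : shiftFun (p * (j1 + e + 1 - d)) (binFun k 0 j0) = binFun k 0 j0 := by
      ext z
      have := hper.sub_zsmul_eq (x := z) (-(j1 + e + 1 - d))
      rw [neg_smul, sub_neg_eq_add, smul_eq_mul, mul_comm] at this
      rw [shiftFun_apply, this]
    rw [← add_zero (p * (j1 + e + 1 - d) : ℤ), ← shiftFun_binFun, h1, shiftFun_mul, add_zero, h2]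
  have hF := shiftFun_mem (frobFun_mem p (binFun_mem k 0 j1)) (p * (j1 + e + 1 - d))
  have hvB : v * hel k (binFun k 0 j0) = (w.choose j0 : k) • v := by
    have hper : Function.Periodic (binFun k 0 j0) (p : ℤ) := by
      have := binFun_periodic k p (n := j0) (r := 1) (by rwa [pow_one]) 0
      rwa [pow_one] at this
    rw [← h.mul_wt, mul_assoc, wt, ← hel_mul (resFun_mem p _) (binFun_mem k _ _), mul_comm,
      mul_resFun_eq_smul p hper, map_smul, mul_smul_comm, binFun_natCast]
  rw [Yd_mul_hel (binFun_mem k _ _), shiftFun_binFun, hshift, hB, mul_comm,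
    hel_mul (binFun_mem k _ _) hF, hY, ← mul_assoc, ← mul_assoc, ← mul_assoc, hvB]
  rcases lt_or_ge w j0 with hwj | hwj
  · simp [Nat.choose_eq_zero_of_lt hwj]
  · rw [smul_mul_assoc, smul_mul_assoc, (h.mul_hel p hF).mul_Yd _ (by omega) (by omega)]
    simp

/-- Compare the image under `Fr'` of Kostant's formula for X^(d) Y^(c) with the formula for X^(dp)
Y^(cp): indices divisible by p match, the others vanish after multiplication by v. -/
lemma IsAdmissible.mul_Xd_mul_Fr' {w : ℕ} {v : U k} (h : IsAdmissible p w v) (d : ℕ)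
    (u : U k) : v * (Xd k (d * p) * Fr' k p u) = v * Fr' k p (Xd k d * u) := by
  have hp0 := hp.out.pos
  induction u using normal_form_induction with
  | zero => simp
  | add u v hu hv => rw [map_add, mul_add, mul_add, hu, hv, mul_add, map_add, mul_add]
  | smul a u hu =>
    rw [mul_smul_comm, map_smul, map_smul, mul_smul_comm, mul_smul_comm, mul_smul_comm, hu]
  | normal c d' g hg =>
    have h1 : Xd k d * (Yd k c * hel k g * Xd k d') = ∑ j ∈ Finset.range (d + 1),
        YdSub k c j * hel k (binFun k (2 * j - d - c) j * shiftFun (-(2 * (d - j : ℕ))) g) *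
          Xd k (d - j) * Xd k d' := by
      rw [← mul_assoc, ← mul_assoc, Xd_mul_Yd, Finset.sum_mul, Finset.sum_mul]
      refine Finset.sum_congr rfl fun j _ => ?_
      rw [hel_mul (binFun_mem k _ _) (shiftFun_mem hg _), mul_assoc _ _ (hel k g), Xd_mul_hel hg]
      simp only [mul_assoc]
    have h2 : Xd k (d * p) * (Yd k (c * p) * hel k (frobFun k p g) * Xd k (d' * p)) =
        ∑ J ∈ Finset.range (d * p + 1), YdSub k (c * p) J *
          hel k (binFun k (2 * J - (d * p : ℕ) - (c * p : ℕ)) J) *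
          (hel k (shiftFun (-(2 * (d * p - J : ℕ))) (frobFun k p g)) *
            Xd k (d * p - J) * Xd k (d' * p)) := by
      rw [← mul_assoc, ← mul_assoc, Xd_mul_Yd, Finset.sum_mul, Finset.sum_mul]
      refine Finset.sum_congr rfl fun j _ => ?_
      rw [mul_assoc _ _ (hel k (frobFun k p g)), Xd_mul_hel (frobFun_mem p hg)]
      simp only [mul_assoc]
    rw [Fr'_apply p hg, h1, h2, map_sum, Finset.mul_sum, Finset.mul_sum]
    have hinj : Set.InjOn (fun j : ℕ => j * p) (Finset.range (d + 1)) := fun a _ b _ hab =>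
      Nat.eq_of_mul_eq_mul_right hp0 hab
    have hsub : (Finset.range (d + 1)).image (fun j => j * p) ⊆ Finset.range (d * p + 1) := by
      intro J hJ
      rw [Finset.mem_image] at hJ
      obtain ⟨j, hj, rfl⟩ := hJ
      rw [Finset.mem_range, Nat.lt_succ_iff] at hj ⊢
      exact Nat.mul_le_mul_right p hj
    rw [← Finset.sum_subset hsub, Finset.sum_image hinj]
    · refine Finset.sum_congr rfl fun j hj => ?_
      have hjd : j ≤ d := by simpa [Nat.lt_succ_iff] using hj
      rw [Fr'_mul_Xd, YdSub, YdSub]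
      by_cases hjc : j ≤ c
      · have hjc' : j * p ≤ c * p := Nat.mul_le_mul_right p hjc
        rw [if_pos hjc, if_pos hjc', Fr'_apply p (mul_mem_binSpan (binFun_mem k _ _)
          (shiftFun_mem hg _)), frobFun_mul, frobFun_shiftFun,
          ← add_zero (2 * (j : ℤ) - d - c), ← shiftFun_binFun, frobFun_shiftFun, frobFun_binFun,
          shiftFun_binFun, hel_mul (binFun_mem k _ _) (shiftFun_mem (frobFun_mem p hg) _),
          Nat.sub_mul, Nat.sub_mul]
        have e1 : (p : ℤ) * (2 * j - d - c) + 0 =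
            2 * (j * p : ℕ) - (d * p : ℕ) - (c * p : ℕ) := by
          push_cast; ring
        have e2 : (p : ℤ) * -(2 * (d - j : ℕ)) = -(2 * (d * p - j * p : ℕ)) := by
          rw [← Nat.sub_mul]
          push_cast
          ring
        rw [e1, e2]
        simp only [mul_assoc]
      · have hjc' : ¬ j * p ≤ c * p := fun h => hjc (Nat.le_of_mul_le_mul_right h hp0)
        rw [if_neg hjc, if_neg hjc']
        simp
    · intro J hJ hJ'
      have hpJ : ¬ p ∣ J := by
        rintro ⟨j, rfl⟩
        refine hJ' (Finset.mem_image.mpr ⟨j, ?_, mul_comm _ _⟩)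
        rw [Finset.mem_range, Nat.lt_succ_iff] at hJ ⊢
        exact Nat.le_of_mul_le_mul_left (by rwa [mul_comm d p] at hJ) hp0
      rw [← mul_assoc, h.mul_YdSub_mul_hel_eq_zero p c d J hpJ, zero_mul]

/-- Multiplicativity of the Frobenius splitting on admissible elements. -/
theorem IsAdmissible.mul_Fr'_mul_Fr' {w : ℕ} {v : U k} (h : IsAdmissible p w v)
    (u u' : U k) : v * (Fr' k p u * Fr' k p u') = v * Fr' k p (u * u') := by
  induction u using normal_form_induction with
  | zero => simp
  | add a b ha hb => simp only [map_add, add_mul, mul_add, ha, hb]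
  | smul a u hu =>
    rw [map_smul, smul_mul_assoc, smul_mul_assoc, map_smul, mul_smul_comm, mul_smul_comm, hu]
  | normal c d f hf =>
    have h1 := h.mul_Yd_prime p c
    have h2 := h1.mul_hel p (frobFun_mem p hf)
    have h3 := h2.mul_Xd_mul_Fr' p d u'
    rw [Fr'_apply p hf, mul_assoc (_ * _) _ u', mul_assoc (Yd k c), Fr'_Yd_mul, Fr'_hel_mul p hf]
    simp only [mul_assoc] at h3 ⊢
    exact h3

end FrobeniusSplitting

end SL2Hyper

namespace SL2Hyper

/-! ### The elements g(YX) Y^s Fr'(z) X^s μ_a: products and injectivity. -/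

section Zeta

set_option linter.unusedSectionVars false

open Polynomial

variable {k : Type*} [Field k] (p : ℕ) [hp : Fact p.Prime] [CharP k p]

lemma Yd_pow_mul_mul_Xd_pow_mem {z : U k} (hz : z ∈ degSpan k) (s : ℕ) :
    Yd k 1 ^ s * z * Xd k 1 ^ s ∈ degSpan k := by
  induction hz using degSpan_induction with
  | zero => simp
  | add a b _ _ ha hb => rw [mul_add, add_mul]; exact add_mem ha hb
  | smul c a _ ha => rw [mul_smul_comm, smul_mul_assoc]; exact Submodule.smul_mem _ _ ha
  | normal m f hf =>
    rw [← mul_assoc, ← mul_assoc, mul_assoc _ (Xd k m), Yd_one_pow, Xd_one_pow, smul_mul_assoc,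
      Yd_mul_Yd, mul_smul_comm, Xd_mul_Xd, add_comm m s]
    simp only [smul_mul_assoc, mul_smul_comm]
    iterate 4 refine Submodule.smul_mem _ _ ?_
    exact normal_form_mem_degSpan hf _

lemma Xd_pow_mul_Yd_pow_mem (s : ℕ) : Xd k 1 ^ s * Yd k 1 ^ s ∈ degSpan k := by
  rw [Yd_one_pow, Xd_one_pow, smul_mul_smul_comm, Xd_mul_Yd]
  refine Submodule.smul_mem _ _ (sum_mem fun j _ => ?_)
  rw [YdSub]
  split_ifs
  · exact normal_form_mem_degSpan (binFun_mem k _ _) _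
  · simp

/-- The element `g(Y X) Y^s Fr'(z) X^s μ_a`. -/
noncomputable def zeta (a : ℤ) (s : ℕ) (g : k[X]) (z : U k) : U k :=
  aeval (yx k) g * (Yd k 1 ^ s * Fr' k p z * Xd k 1 ^ s) * wt k p a

lemma zeta_mem_degSpan (a : ℤ) (s : ℕ) (g : k[X]) {z : U k} (hz : z ∈ degSpan k) :
    zeta p a s g z ∈ degSpan k :=
  mul_mem_degSpan (mul_mem_degSpan (aeval_yx_mem_degSpan g)
    (Yd_pow_mul_mul_Xd_pow_mem (Fr'_mem_degSpan p hz) s)) (wt_mem_degSpan p a)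

lemma zeta_eq (a : ℤ) (s : ℕ) (g : k[X]) {z : U k} (hz : z ∈ degSpan k) :
    zeta p a s g z =
      aeval (yx k) g * (Yd k 1 ^ s * wt k p (a + 2 * s)) * (Fr' k p z * Xd k 1 ^ s) := by
  rw [zeta, mul_assoc, mul_assoc (Yd k 1 ^ s * _), Xd_pow_mul_wt, mul_assoc (Yd k 1 ^ s),
    ← mul_assoc (Fr' k p z), ← wt_commute p (Fr'_mem_degSpan p hz)]
  simp only [mul_assoc]

lemma zeta_zero_right (a : ℤ) (s : ℕ) (g : k[X]) : zeta p a s g 0 = 0 := by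
  simp [zeta]

lemma Yd_pow_mul_Xd_pow_mul_Yd_pow (a : ℤ) (s : ℕ) :
    Yd k 1 ^ s * (Xd k 1 ^ s * Yd k 1 ^ s) * wt k p (a + 2 * s) =
      aeval (yx k) (phiIco k a 0 s) * (Yd k 1 ^ s * wt k p (a + 2 * s)) := by
  have h := congrArg (· * Yd k 1 ^ s) (aeval_phiIco_zero_mul_wt (k := k) p a s)
  simp only [mul_assoc, wt_mul_Yd_pow] at h
  simp only [mul_assoc]
  exact h.symm

/-- Commutativity in degree zero brings X^s Y^s next to Y^s on the weight space, where it turns into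
φ_{a,s}(YX). Admissibility then merges the two values of `Fr'`. -/
lemma zeta_mul_zeta (a : ℤ) (s : ℕ) (g g' : k[X]) {z z' : U k} (hz : z ∈ degSpan k)
    (hz' : z' ∈ degSpan k) {w : ℕ}
    (hadm : IsAdmissible p w (aeval (yx k) (phiIco k a 0 s * (g * g')) *
      (Yd k 1 ^ s * wt k p (a + 2 * s)))) :
    zeta p a s g z * zeta p a s g' z' = zeta p a s (phiIco k a 0 s * (g * g')) (z * z') := by
  have hF := Fr'_mem_degSpan p hz
  have hF' := Fr'_mem_degSpan p hz'
  have hS := Yd_pow_mul_mul_Xd_pow_mem hF s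
  have hS' := Yd_pow_mul_mul_Xd_pow_mem hF' s
  have hG := aeval_yx_mem_degSpan (k := k) g
  have hG' := aeval_yx_mem_degSpan (k := k) g'
  have hT := Xd_pow_mul_Yd_pow_mem (k := k) s
  have h1 : zeta p a s g z * zeta p a s g' z' = aeval (yx k) (g * g') *
      ((Yd k 1 ^ s * Fr' k p z * Xd k 1 ^ s) * (Yd k 1 ^ s * Fr' k p z' * Xd k 1 ^ s) *
        wt k p a) := by
    rw [zeta, zeta, map_mul]
    have e1 : aeval (yx k) g' * (Yd k 1 ^ s * Fr' k p z' * Xd k 1 ^ s) * wt k p a =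
        wt k p a * (aeval (yx k) g' * (Yd k 1 ^ s * Fr' k p z' * Xd k 1 ^ s)) :=
      (wt_commute p (mul_mem_degSpan hG' hS') a).symm
    have e2 : (Yd k 1 ^ s * Fr' k p z * Xd k 1 ^ s) * aeval (yx k) g' =
        aeval (yx k) g' * (Yd k 1 ^ s * Fr' k p z * Xd k 1 ^ s) := degSpan_commute hS hG'
    rw [e1, mul_assoc (aeval (yx k) g * _), ← mul_assoc (wt k p a), wt_mul_self, ← e1, mul_assoc,
      ← mul_assoc (_ * Xd k 1 ^ s), ← mul_assoc (_ * Xd k 1 ^ s), e2]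
    simp only [mul_assoc]
  have h2 : (Yd k 1 ^ s * Fr' k p z * Xd k 1 ^ s) * (Yd k 1 ^ s * Fr' k p z' * Xd k 1 ^ s) *
      wt k p a = aeval (yx k) (phiIco k a 0 s) * (Yd k 1 ^ s * wt k p (a + 2 * s)) *
        ((Fr' k p z * Fr' k p z') * Xd k 1 ^ s) := by
    have e1 : (Yd k 1 ^ s * Fr' k p z * Xd k 1 ^ s) * (Yd k 1 ^ s * Fr' k p z' * Xd k 1 ^ s) *
        wt k p a = Yd k 1 ^ s * (Fr' k p z * (Xd k 1 ^ s * Yd k 1 ^ s)) * Fr' k p z' *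
          (Xd k 1 ^ s * wt k p a) := by simp only [mul_assoc]
    have e2 : Fr' k p z * (Xd k 1 ^ s * Yd k 1 ^ s) = (Xd k 1 ^ s * Yd k 1 ^ s) * Fr' k p z :=
      degSpan_commute hF hT
    have e3 := wt_commute p (mul_mem_degSpan hF hF') (a + 2 * s)
    rw [e1, e2, Xd_pow_mul_wt, ← Yd_pow_mul_Xd_pow_mul_Yd_pow]
    have e4 : Yd k 1 ^ s * (Xd k 1 ^ s * Yd k 1 ^ s * Fr' k p z) * Fr' k p z' *
        (wt k p (a + 2 * s) * Xd k 1 ^ s) = Yd k 1 ^ s * (Xd k 1 ^ s * Yd k 1 ^ s) *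
        (Fr' k p z * Fr' k p z' * wt k p (a + 2 * s)) * Xd k 1 ^ s := by
      simp only [mul_assoc]
    rw [e4, ← e3]
    simp only [mul_assoc]
  have h3 := congrArg (· * Xd k 1 ^ s) (hadm.mul_Fr'_mul_Fr' p z z')
  rw [h1, h2, zeta_eq p a s _ (mul_mem_degSpan hz hz')]
  have hM : aeval (yx k) (phiIco k a 0 s * (g * g')) =
      aeval (yx k) (g * g') * aeval (yx k) (phiIco k a 0 s) := by rw [mul_comm, map_mul]
  rw [hM] at h3 ⊢
  simp only [mul_assoc] at h3 ⊢
  exact h3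

/-- The factors of φ with indices from s to p - 1 turn Y^s into Y^p = 0. So g matters only modulo
`phiIco k a s p`. -/
lemma zeta_eq_zero_of_dvd (a : ℤ) {s : ℕ} (hs : s ≤ p) {g : k[X]} (h : phiIco k a s p ∣ g)
    {z : U k} (hz : z ∈ degSpan k) : zeta p a s g z = 0 := by
  obtain ⟨q, rfl⟩ := h
  rw [zeta_eq p a s _ hz, mul_comm (phiIco k a s p), map_mul,
    mul_assoc (aeval (yx k) q), aeval_phiIco_mul p a hs, Yd_pow_eq_zero p le_rfl]
  simp

lemma zeta_sub (a : ℤ) (s : ℕ) (g g' : k[X]) (z : U k) :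
    zeta p a s (g - g') z = zeta p a s g z - zeta p a s g' z := by
  simp [zeta, sub_mul]

lemma zeta_congr (a : ℤ) {s : ℕ} (hs : s ≤ p) {g g' : k[X]} (h : phiIco k a s p ∣ g - g')
    {z : U k} (hz : z ∈ degSpan k) : zeta p a s g z = zeta p a s g' z := by
  rw [← sub_eq_zero, ← zeta_sub, zeta_eq_zero_of_dvd p a hs h hz]

/-- Expansion of a polynomial in a Newton basis. -/
lemma exists_newton_basis_expansion (r : ℕ → k) (n : ℕ) (g : k[X]) (hg : g.degree < n) :
    ∃ c : ℕ → k, g = ∑ m ∈ Finset.range n, C (c m) * ∏ i ∈ Finset.range m, (X - C (r i)) := by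
  induction n generalizing g with
  | zero =>
    refine ⟨0, ?_⟩
    have : g = 0 := by
      by_contra h
      rw [degree_eq_natDegree h] at hg
      exact absurd hg (by simp)
    simp [this]
  | succ n ih =>
    have hmon : (∏ i ∈ Finset.range n, (X - C (r i))).Monic :=
      monic_prod_of_monic _ _ fun _ _ => monic_X_sub_C _
    have hdeg : (∏ i ∈ Finset.range n, (X - C (r i))).natDegree = n := by
      rw [natDegree_prod_of_monic _ _ fun _ _ => monic_X_sub_C _]
      simp only [natDegree_X_sub_C, Finset.sum_const, Finset.card_range, smul_eq_mul, mul_one]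
    obtain ⟨c, hc⟩ := ih (g - C (g.coeff n) * ∏ i ∈ Finset.range n, (X - C (r i))) (by
      rw [degree_lt_iff_coeff_zero]
      intro m hm
      rcases hm.lt_or_eq with h | rfl
      · have h0 : (∏ i ∈ Finset.range n, (X - C (r i))).coeff m = 0 :=
          coeff_eq_zero_of_natDegree_lt (by rw [hdeg]; exact h)
        rw [coeff_sub, coeff_C_mul, h0, mul_zero, sub_zero]
        exact coeff_eq_zero_of_degree_lt (hg.trans_le (by exact_mod_cast h))
      · have h1 : (∏ i ∈ Finset.range n, (X - C (r i))).coeff n = 1 := by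
          have := hmon.coeff_natDegree
          rwa [hdeg] at this
        rw [coeff_sub, coeff_C_mul, h1, mul_one, sub_self])
    refine ⟨Function.update c n (g.coeff n), ?_⟩
    rw [Finset.sum_range_succ, Function.update_self, ← sub_eq_iff_eq_add, hc]
    refine Finset.sum_congr rfl fun m hm => ?_
    rw [Function.update_of_ne (Finset.mem_range.mp hm).ne]

lemma exists_phiIco_expansion (a : ℤ) (s n : ℕ) (g : k[X])
    (hg : g.degree < (n - s : ℕ)) :
    ∃ c : ℕ → k, g = ∑ m ∈ Finset.Ico s n, C (c m) * phiIco k a s m := by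
  obtain ⟨c, hc⟩ := exists_newton_basis_expansion
    (fun i => ((s + i : ℕ) : k) * ((s + i : ℕ) + a + 1)) (n - s) g hg
  refine ⟨fun m => c (m - s), ?_⟩
  rw [Finset.sum_Ico_eq_sum_range, hc]
  refine Finset.sum_congr rfl fun m _ => ?_
  dsimp only
  rw [phiIco, Finset.prod_Ico_eq_prod_range, Nat.add_sub_cancel_left]

lemma aeval_sum_phiIco_mul (a : ℤ) {s : ℕ} (S : Finset ℕ) (hS : ∀ m ∈ S, s ≤ m) (c : ℕ → k) :
    aeval (yx k) (∑ m ∈ S, C (c m) * phiIco k a s m) * (Yd k 1 ^ s * wt k p (a + 2 * s)) =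
    ∑ m ∈ S, c m • (Yd k 1 ^ m * Xd k 1 ^ (m - s) * wt k p (a + 2 * s)) := by
  rw [map_sum, Finset.sum_mul]
  refine Finset.sum_congr rfl fun m hm => ?_
  rw [map_mul, aeval_C, mul_assoc, aeval_phiIco_mul p a (hS m hm), ← Algebra.smul_def]

lemma Yd_pow_mul_Yd_eq_zero {m i : ℕ} (hm : m < p) (hi : i < p) (h : p ≤ m + i) :
    Yd k 1 ^ m * Yd k i = 0 := by
  rw [Yd_one_pow, smul_mul_assoc, Yd_mul_Yd_eq_zero k p (r := 1) (by rwa [pow_one])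
    (by rwa [pow_one]) (by rwa [pow_one]), smul_zero]

/-- The correction terms of Kostant's formula contain Y^(p - i) with 1 ≤ i ≤ l ≤ m, which Y^m kills
by a carry. -/
lemma Yd_pow_mul_Xd_pow_mul_Yd_prime {m l : ℕ} (hlm : l ≤ m) (hm : m < p) (c : ℕ) :
    Yd k 1 ^ m * (Xd k 1 ^ l * Yd k (c * p)) = Yd k 1 ^ m * (Yd k (c * p) * Xd k 1 ^ l) := by
  rw [Xd_one_pow, smul_mul_assoc, mul_smul_comm, mul_smul_comm, mul_smul_comm, Xd_mul_Yd,
    Finset.sum_range_succ', binFun_zero_right, hel_one, mul_one, Nat.sub_zero, mul_add,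
    Finset.mul_sum, Finset.sum_eq_zero, zero_add, YdSub, if_pos (Nat.zero_le _), Nat.sub_zero]
  intro j hj
  rw [Finset.mem_range] at hj
  rw [YdSub]
  split_ifs with hjc
  · rcases c with _ | c
    · omega
    have e : (c + 1) * p - (j + 1) = (p - (j + 1)) + c * p := by
      rw [add_mul, one_mul]
      omega
    rw [e, Yd_add_mul_prime p (by omega), ← mul_assoc, ← mul_assoc, ← mul_assoc,
      Yd_pow_mul_Yd_eq_zero p hm (by omega) (by omega)]
    simp
  · simp

/-- This puts each term into PBW normal form. The exponent m + cp records both m and c, which is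
what makes injectivity of `zeta` in z provable. -/
lemma zeta_term (a : ℤ) {s m : ℕ} (hsm : s ≤ m) (hm : m < p) (c : ℕ) {f : ℤ → k}
    (hf : f ∈ binSpan k) :
    Yd k 1 ^ m * Xd k 1 ^ (m - s) * wt k p (a + 2 * s) *
        (Fr' k p (Yd k c * hel k f * Xd k c) * Xd k 1 ^ s) =
      Yd k (m + c * p) * hel k (((m ! : k) * (m ! : k)) •
        (shiftFun (-(2 * (m - s : ℕ))) (frobFun k p f) * resFun p (a + 2 * m))) *
        Xd k (m + c * p) := by
  have hF := frobFun_mem p hf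
  have h1 : wt k p (a + 2 * s) * (Fr' k p (Yd k c * hel k f * Xd k c) * Xd k 1 ^ s) =
      Fr' k p (Yd k c * hel k f * Xd k c) * (Xd k 1 ^ s * wt k p a) := by
    rw [← mul_assoc, wt_commute p (Fr'_mem_degSpan p (normal_form_mem_degSpan hf c)), mul_assoc,
      Xd_pow_mul_wt]
  rw [mul_assoc, h1, Fr'_apply p hf]
  have h2 : Yd k 1 ^ m * Xd k 1 ^ (m - s) * (Yd k (c * p) * hel k (frobFun k p f) *
      Xd k (c * p) * (Xd k 1 ^ s * wt k p a)) =
      Yd k 1 ^ m * (Xd k 1 ^ (m - s) * Yd k (c * p)) * hel k (frobFun k p f) *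
      Xd k (c * p) * (Xd k 1 ^ s * wt k p a) := by simp only [mul_assoc]
  have h3 : Xd k 1 ^ (m - s) * Xd k (c * p) = Xd k (c * p) * Xd k 1 ^ (m - s) := by
    rw [Xd_one_pow, smul_mul_assoc, Xd_commute, mul_smul_comm]
  have h4 : Yd k 1 ^ m * (Yd k (c * p) * Xd k 1 ^ (m - s)) * hel k (frobFun k p f) *
      Xd k (c * p) * (Xd k 1 ^ s * wt k p a) =
      (Yd k 1 ^ m * Yd k (c * p)) * (Xd k 1 ^ (m - s) * hel k (frobFun k p f)) *
      Xd k (c * p) * (Xd k 1 ^ s * wt k p a) := by simp only [mul_assoc]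
  have h5 : (Yd k 1 ^ m * Yd k (c * p)) * (hel k (shiftFun (-(2 * (m - s : ℕ))) (frobFun k p f)) *
      Xd k 1 ^ (m - s)) * Xd k (c * p) * (Xd k 1 ^ s * wt k p a) =
      (Yd k 1 ^ m * Yd k (c * p)) * hel k (shiftFun (-(2 * (m - s : ℕ))) (frobFun k p f)) *
      (Xd k 1 ^ (m - s) * Xd k (c * p) * Xd k 1 ^ s) * wt k p a := by simp only [mul_assoc]
  have h6 : Xd k (c * p) * Xd k 1 ^ (m - s) * Xd k 1 ^ s = (m ! : k) • Xd k (m + c * p) := by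
    rw [mul_assoc, ← pow_add, Nat.sub_add_cancel hsm, Xd_one_pow, mul_smul_comm, Xd_commute,
      ← Xd_add_mul_prime p hm]
  have h7 : Yd k 1 ^ m * Yd k (c * p) = (m ! : k) • Yd k (m + c * p) := by
    rw [Yd_one_pow, smul_mul_assoc, ← Yd_add_mul_prime p hm]
  have h8 : Xd k (m + c * p) * wt k p a = wt k p (a + 2 * m) * Xd k (m + c * p) := by
    rw [wt, Xd_mul_hel (resFun_mem p a), shiftFun_resFun, wt]
    have e : resFun (k := k) p (a - -(2 * (m + c * p : ℕ))) = resFun p (a + 2 * m) :=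
      resFun_congr p ⟨2 * c, by push_cast; ring⟩
    rw [e]
  rw [h2, Yd_pow_mul_Xd_pow_mul_Yd_prime p (Nat.sub_le _ _) hm, h4, Xd_pow_mul_hel hF, h5, h3, h6,
    h7, map_smul, hel_mul (shiftFun_mem hF _) (resFun_mem p _), ← wt]
  simp only [smul_mul_assoc, mul_smul_comm, smul_smul]
  congr 1
  rw [mul_assoc _ (Xd k _), h8]
  simp only [mul_assoc]

/-- Every fibre of z ↦ ⌊(z + c)/p⌋ meets the residue class of a, so no value of f is lost. -/
lemma eq_zero_of_frobFun_mul_resFun {f : ℤ → k} {c a : ℤ}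
    (h : shiftFun c (frobFun k p f) * resFun p a = 0) : f = 0 := by
  have hp0 : (p : ℤ) ≠ 0 := by exact_mod_cast hp.out.ne_zero
  ext z
  obtain ⟨y, hy⟩ : ∃ y : ℤ, y = z - (a + c) / p := ⟨_, rfl⟩
  have h1 := congrFun h (a + p * y)
  have h2 : (p : ℤ) ∣ a + p * y - a := ⟨y, by ring⟩
  have h3 : (a + p * y + c) / (p : ℤ) = z := by
    have : a + p * y + c = (a + c) + p * y := by ring
    rw [this, Int.add_mul_ediv_left _ _ hp0, hy]
    ring
  simpa [resFun, h3] using h1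

/-- Elements of degree zero as finite sums, one term for each exponent. -/
lemma exists_eq_sum_of_mem_degSpan {z : U k} (hz : z ∈ degSpan k) :
    ∃ F : ℕ →₀ (ℤ → k), (∀ c, F c ∈ binSpan k) ∧
      z = F.sum fun c f => Yd k c * hel k f * Xd k c := by
  induction hz using degSpan_induction with
  | zero => exact ⟨0, by simp, by simp⟩
  | add a b _ _ ha hb =>
    obtain ⟨F, hF, rfl⟩ := ha
    obtain ⟨G, hG, rfl⟩ := hb
    refine ⟨F + G, fun c => add_mem (hF c) (hG c), ?_⟩
    rw [Finsupp.sum_add_index']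
    · simp
    · intro c f g
      rw [map_add, mul_add, add_mul]
  | smul r a _ ha =>
    obtain ⟨F, hF, rfl⟩ := ha
    refine ⟨r • F, fun c => Submodule.smul_mem _ _ (hF c), ?_⟩
    rw [Finsupp.sum_smul_index' (by simp), Finsupp.smul_sum]
    simp
  | normal m f hf =>
    classical
    refine ⟨Finsupp.single m f, fun c => ?_, ?_⟩
    · rw [Finsupp.single_apply]
      split_ifs
      exacts [hf, zero_mem _]
    · rw [Finsupp.sum_single_index (by simp)]

/-- Injectivity of `zeta` in its last argument. -/
theorem eq_zero_of_zeta_eq_zero (a : ℤ) {s : ℕ} {g : k[X]} (hg : g ≠ 0)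
    (hdeg : g.degree < (p - s : ℕ)) {z : U k} (hz : z ∈ degSpan k) (h : zeta p a s g z = 0) :
    z = 0 := by
  obtain ⟨c, hc⟩ := exists_phiIco_expansion a s p g hdeg
  obtain ⟨F, hF, rfl⟩ := exists_eq_sum_of_mem_degSpan hz
  obtain ⟨m0, hm0, hcm0⟩ : ∃ m ∈ Finset.Ico s p, c m ≠ 0 := by
    by_contra! hcon
    refine hg (hc.trans (Finset.sum_eq_zero fun m hm => ?_))
    rw [hcon m hm, C_0, zero_mul]
  rw [zeta_eq p a s g hz] at h
  rw [hc, aeval_sum_phiIco_mul p a _ fun m hm => (Finset.mem_Ico.mp hm).1, Finsupp.sum, map_sum, Finset.sum_mul, Finset.sum_mul] at h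
  have h1 : ∑ i ∈ Finset.Ico s p ×ˢ F.support, Yd k (i.1 + i.2 * p) *
      hel k (c i.1 • (((i.1 ! : k) * (i.1 ! : k)) •
        (shiftFun (-(2 * (i.1 - s : ℕ))) (frobFun k p (F i.2)) * resFun p (a + 2 * i.1)))) *
        Xd k (i.1 + i.2 * p) = 0 := by
    rw [Finset.sum_product, ← h]
    refine Finset.sum_congr rfl fun m hm => ?_
    rw [Finset.mul_sum]
    refine Finset.sum_congr rfl fun j _ => ?_
    rw [Finset.mem_Ico] at hm
    rw [smul_mul_assoc, zeta_term p a hm.1 hm.2 j (hF j), map_smul _ (c m), mul_smul_comm,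
      smul_mul_assoc]
  have h2 := eq_zero_of_sum_Yd_hel_Xd_eq_zero _ _ _ ?_ _ ?_ h1
  · rw [Finsupp.sum]
    refine Finset.sum_eq_zero fun j hj => ?_
    have h3 := h2 (m0, j) (Finset.mem_product.mpr ⟨hm0, hj⟩)
    have hfac := cast_factorial_ne_zero (k := k) p (Finset.mem_Ico.mp hm0).2
    dsimp only at h3
    rw [smul_eq_zero_iff_right hcm0, smul_eq_zero_iff_right (mul_ne_zero hfac hfac)] at h3
    rw [eq_zero_of_frobFun_mul_resFun p h3]
    simp
  · rintro ⟨m, j⟩ hmj ⟨m', j'⟩ hmj' heq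
    simp only [Finset.coe_product, Set.mem_prod, Finset.mem_coe, Finset.mem_Ico] at hmj hmj'
    simp only [Prod.mk.injEq, and_self] at heq
    -- The remainder modulo p of m + jp is m, since m < p; then j is determined too.
    have e1 := congrArg (· % p) heq
    simp only [Nat.add_mul_mod_self_right, Nat.mod_eq_of_lt hmj.1.2,
      Nat.mod_eq_of_lt hmj'.1.2] at e1
    subst e1
    have e2 : j * p = j' * p := by omega
    rw [Nat.eq_of_mul_eq_mul_right hp.out.pos e2]
  · intro i _
    exact Submodule.smul_mem _ _ (Submodule.smul_mem _ _ (mul_mem_binSpan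
      (shiftFun_mem (frobFun_mem p (hF _)) _) (resFun_mem p _)))

end Zeta

end SL2Hyper

namespace SL2Hyper

/-! ### The polynomials ψ: idempotent and nilpotent elements modulo ψ for odd p. -/

section PsiPolynomials

set_option linter.unusedSectionVars false

open Polynomial

variable (p : ℕ) [hp : Fact p.Prime]

lemma prod_X_sub_C_zmod : ∏ i : ZMod p, (X - C i) = (X ^ p - X : (ZMod p)[X]) := by
  have hcard : Fintype.card (ZMod p) = p := ZMod.card p
  have hmon : (X ^ p - X : (ZMod p)[X]).Monic := by
    refine monic_X_pow_sub ?_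
    rw [degree_X]
    exact_mod_cast hp.out.one_lt
  have hroots := FiniteField.roots_X_pow_card_sub_X (ZMod p)
  rw [hcard] at hroots
  have h := prod_multiset_X_sub_C_of_monic_of_roots_card_eq hmon (by
    rw [hroots, FiniteField.X_pow_card_sub_X_natDegree_eq _ hp.out.one_lt]
    exact hcard)
  rw [hroots] at h
  exact h

lemma prod_erase_X_sub_C_zmod :
    ∏ i ∈ Finset.univ.erase (0 : ZMod p), (X - C i) = (X ^ (p - 1) - 1 : (ZMod p)[X]) := by
  have h := prod_X_sub_C_zmod p
  rw [← Finset.mul_prod_erase _ _ (Finset.mem_univ (0 : ZMod p)), C_0, sub_zero] at h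
  refine mul_left_cancel₀ (X_ne_zero (R := ZMod p)) ?_
  rw [h, mul_sub, mul_one, ← pow_succ', Nat.sub_add_cancel hp.out.one_le]

/-- Substituting X² for X factors X² - i² as (X - i)(X + i), so Fermat's product appears twice. The
square exhibits the nonzero squares as double roots. -/
lemma prod_erase_X_sub_C_sq (h2 : p ≠ 2) :
    ∏ i ∈ Finset.univ.erase (0 : ZMod p), (X - C (i ^ 2)) =
      ((X ^ ((p - 1) / 2) - 1) ^ 2 : (ZMod p)[X]) := by
  have hodd := hp.out.odd_of_ne_two h2
  refine expand_injective (n := 2) (by norm_num) ?_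
  have e : 2 * ((p - 1) / 2) = p - 1 := by
    obtain ⟨m, hm⟩ := hodd
    omega
  have h1 : ∏ i ∈ Finset.univ.erase (0 : ZMod p), (X + C i) = (X ^ (p - 1) - 1 : (ZMod p)[X]) := by
    rw [← prod_erase_X_sub_C_zmod]
    refine Finset.prod_nbij' (fun i => -i) (fun i => -i) ?_ ?_ ?_ ?_ ?_ <;> simp
  rw [map_prod, map_pow, map_sub, map_pow, expand_X, map_one, ← pow_mul, e, sq]
  nth_rw 1 [← prod_erase_X_sub_C_zmod]
  rw [← h1, ← Finset.prod_mul_distrib]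
  refine Finset.prod_congr rfl fun i _ => ?_
  rw [map_sub, expand_X, expand_C, C_pow]
  ring

/-- The product of the factors of `psi` with indices different from `± j`. -/
noncomputable def psiCompl (j : ZMod p) : (ZMod p)[X] :=
  ∏ i ∈ Finset.univ \ {j, -j}, (X - C (i ^ 2))

lemma two_ne_zero_zmod (h2 : p ≠ 2) : (2 : ZMod p) ≠ 0 := by
  intro h
  have h1 : ((2 : ℕ) : ZMod p) = 0 := by exact_mod_cast h
  rw [ZMod.natCast_eq_zero_iff] at h1
  exact h2 ((Nat.prime_dvd_prime_iff_eq hp.out Nat.prime_two).mp h1)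

lemma ne_neg_self_of_ne_zero (h2 : p ≠ 2) {j : ZMod p} (hj : j ≠ 0) : j ≠ -j := by
  intro h
  have h1 : 2 * j = 0 := by linear_combination h
  rcases mul_eq_zero.mp h1 with h | h
  exacts [two_ne_zero_zmod p h2 h, hj h]

lemma psiCompl_zero :
    psiCompl p 0 = ∏ i ∈ Finset.univ.erase (0 : ZMod p), (X - C (i ^ 2)) := by
  rw [psiCompl]
  congr 1
  ext i
  simp

lemma psi_eq_X_mul : psi p = X * psiCompl p 0 := by
  rw [psiCompl_zero, psi, ← Finset.mul_prod_erase _ _ (Finset.mem_univ (0 : ZMod p))]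
  simp

lemma psiCompl_eq_X_mul {j : ZMod p} (hj : j ≠ 0) :
    psiCompl p j = X * ∏ i ∈ Finset.univ \ {0, j, -j}, (X - C (i ^ 2)) := by
  have hmem : (0 : ZMod p) ∈ (Finset.univ \ {j, -j} : Finset (ZMod p)) := by
    simp [hj, eq_comm]
  rw [psiCompl, ← Finset.mul_prod_erase _ _ hmem]
  congr 1
  · simp
  · congr 1
    ext i
    simp

lemma psi_eq_sq_mul (h2 : p ≠ 2) {j : ZMod p} (hj : j ≠ 0) :
    psi p = (X - C (j ^ 2)) ^ 2 * psiCompl p j := by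
  rw [psi, psiCompl, ← Finset.prod_sdiff (Finset.subset_univ {j, -j}), mul_comm,
    Finset.prod_pair (ne_neg_self_of_ne_zero p h2 hj), neg_sq, ← sq]

lemma psiEps_zero_zero : psiEps p 0 0 = psiCompl p 0 := by
  rw [psiCompl_zero]
  simp [psiEps]

lemma psiEps_one_zero : psiEps p 1 0 = psiCompl p 0 := by
  have h : psiEps p 1 0 = psi p / X := by simp [psiEps]
  rw [h, psi_eq_X_mul]
  exact mul_div_cancel_left₀ _ X_ne_zero

lemma psiEps_zero_eq {j : ZMod p} (hj : j ≠ 0) :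
    psiEps p 0 j = 2 * (X + C (j ^ 2)) * psiCompl p j := by
  rw [psiCompl_eq_X_mul p hj, psiEps, if_neg (by decide), if_neg hj]
  ring

lemma psiEps_one_eq (h2 : p ≠ 2) {j : ZMod p} (hj : j ≠ 0) :
    psiEps p 1 j = (X - C (j ^ 2)) * psiCompl p j := by
  rw [psiEps, if_pos rfl, psi_eq_sq_mul p h2 hj, sq, mul_assoc]
  exact mul_div_cancel_left₀ _ (X_sub_C_ne_zero _)

lemma psiCompl_dvd_psiEps (h2 : p ≠ 2) (ε : Fin 2) (j : ZMod p) : psiCompl p j ∣ psiEps p ε j := by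
  by_cases hj : j = 0
  · subst hj
    fin_cases ε
    · exact (psiEps_zero_zero p).symm ▸ dvd_rfl
    · exact (psiEps_one_zero p).symm ▸ dvd_rfl
  · fin_cases ε
    · exact Dvd.intro_left _ (psiEps_zero_eq p hj).symm
    · exact Dvd.intro_left _ (psiEps_one_eq p h2 hj).symm

lemma psiCompl_monic (j : ZMod p) : (psiCompl p j).Monic :=
  monic_prod_of_monic _ _ fun _ _ => monic_X_sub_C _

lemma psi_natDegree : (psi p).natDegree = p := by
  rw [psi, natDegree_prod_of_monic _ _ fun _ _ => monic_X_sub_C _]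
  simp only [natDegree_X_sub_C, Finset.sum_const, Finset.card_univ, ZMod.card, smul_eq_mul, mul_one]

lemma psiEps_ne_zero_and_natDegree_lt (h2 : p ≠ 2) (ε : Fin 2) (j : ZMod p) :
    psiEps p ε j ≠ 0 ∧ (psiEps p ε j).natDegree < p := by
  have hd := psi_natDegree p
  have hm := psiCompl_monic p j
  by_cases hj : j = 0
  · subst hj
    have h1 : psiEps p ε 0 = psiCompl p 0 := by
      fin_cases ε
      exacts [psiEps_zero_zero p, psiEps_one_zero p]
    rw [psi_eq_X_mul, natDegree_X_mul hm.ne_zero] at hd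
    rw [h1]
    exact ⟨hm.ne_zero, by omega⟩
  · have h3 : (C 2 * (X + C (j ^ 2)) : (ZMod p)[X]).natDegree = 1 := by
      rw [natDegree_C_mul (two_ne_zero_zmod p h2), natDegree_X_add_C]
    have h3' : (C 2 * (X + C (j ^ 2)) : (ZMod p)[X]) ≠ 0 := fun h => by rw [h] at h3; simp at h3
    rw [psi_eq_sq_mul p h2 hj, natDegree_mul (pow_ne_zero _ (X_sub_C_ne_zero _)) hm.ne_zero,
      natDegree_pow, natDegree_X_sub_C] at hd
    fin_cases ε
    · change psiEps p 0 j ≠ 0 ∧ (psiEps p 0 j).natDegree < p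
      have h4 : (2 : (ZMod p)[X]) = C 2 := rfl
      rw [psiEps_zero_eq p hj, h4, natDegree_mul h3' hm.ne_zero, h3]
      exact ⟨mul_ne_zero h3' hm.ne_zero, by omega⟩
    · change psiEps p 1 j ≠ 0 ∧ (psiEps p 1 j).natDegree < p
      rw [psiEps_one_eq p h2 hj, natDegree_mul (X_sub_C_ne_zero _) hm.ne_zero, natDegree_X_sub_C]
      exact ⟨mul_ne_zero (X_sub_C_ne_zero _) hm.ne_zero, by omega⟩

lemma X_dvd_psiEps_zero_zero_sub_one (h2 : p ≠ 2) : X ∣ psiEps p 0 0 - 1 := by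
  have h3 : (p - 1) / 2 ≠ 0 := by
    have := hp.out.two_le
    omega
  rw [psiEps_zero_zero, psiCompl_zero, prod_erase_X_sub_C_sq p h2]
  have e : ((X ^ ((p - 1) / 2) - 1) ^ 2 - 1 : (ZMod p)[X]) =
      X ^ ((p - 1) / 2) * (X ^ ((p - 1) / 2) - 2) := by ring
  rw [e]
  exact Dvd.dvd.mul_right (dvd_pow_self _ h3) _

/-- This is why ψ_j^{(0)} has its particular form: it is 1 to second order at the double root j²,
besides vanishing at the other roots. With m = (p - 1)/2 and X^m - 1 = t q, the factors away from 0
and ±j multiply to q², and a differential equation for q gives the expansion at t = 0. -/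
lemma sq_dvd_psiEps_zero_sub_one (h2 : p ≠ 2) {j : ZMod p} (hj : j ≠ 0) :
    (X - C (j ^ 2)) ^ 2 ∣ psiEps p 0 j - 1 := by
  have hodd := hp.out.odd_of_ne_two h2
  have hm2 : 2 * ((p - 1) / 2) + 1 = p := by
    obtain ⟨m, hm⟩ := hodd
    omega
  set m := (p - 1) / 2 with hm
  have hm2' : (2 * (m : (ZMod p)[X]) + 1) = 0 := by
    have : ((2 * m + 1 : ℕ) : (ZMod p)[X]) = 0 := by
      rw [hm2]
      exact CharP.cast_eq_zero _ p
    exact_mod_cast this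
  have hmpos : m ≠ 0 := by
    rintro h
    rw [h] at hm2
    exact hp.out.one_lt.ne hm2
  set t : (ZMod p)[X] := X - C (j ^ 2) with ht
  have hN : ((X ^ m - 1) ^ 2 : (ZMod p)[X]) =
      t ^ 2 * ∏ i ∈ Finset.univ \ {0, j, -j}, (X - C (i ^ 2)) := by
    refine mul_left_cancel₀ (X_ne_zero (R := ZMod p)) ?_
    rw [← prod_erase_X_sub_C_sq p h2, ← psiCompl_zero, ← psi_eq_X_mul, psi_eq_sq_mul p h2 hj,
      psiCompl_eq_X_mul p hj]
    ring
  have hdvd : t ∣ X ^ m - 1 := by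
    have h1 : t ∣ (X ^ m - 1) ^ 2 := by
      rw [hN, sq, mul_assoc]
      exact dvd_mul_right _ _
    exact (prime_X_sub_C _).dvd_of_dvd_pow h1
  obtain ⟨q, hq⟩ := hdvd
  have hR : ∏ i ∈ Finset.univ \ {0, j, -j}, (X - C (i ^ 2)) = q ^ 2 := by
    refine mul_left_cancel₀ (pow_ne_zero 2 (X_sub_C_ne_zero (j ^ 2))) ?_
    rw [← ht, ← hN, hq]
    ring
  have hdt : derivative t = 1 := by rw [ht, derivative_sub, derivative_X, derivative_C, sub_zero]
  have h1 : (m : (ZMod p)[X]) * X ^ m = X * (q + t * derivative q) := by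
    have := congrArg derivative hq
    rw [derivative_sub, derivative_X_pow, derivative_one, sub_zero, derivative_mul, hdt, one_mul]
      at this
    rw [← this, C_eq_natCast]
    obtain ⟨n, hn⟩ := Nat.exists_eq_succ_of_ne_zero hmpos
    rw [hn, Nat.succ_sub_one, pow_succ]
    ring
  -- Since 2m = -1 in characteristic p, X^m can be eliminated between X^m - 1 = t q and its
  -- derivative; `h4` is the derivative of the resulting equation.
  have h3 : 2 * X * q + t * q + 2 * t * X * derivative q + 1 = 0 := by
    linear_combination (-2) * h1 + X ^ m * hm2' - hq
  have h4 : 3 * q + 4 * X * derivative q +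
      t * (3 * derivative q + 2 * X * derivative (derivative q)) = 0 := by
    have := congrArg derivative h3
    simp only [derivative_add, derivative_mul, hdt, derivative_X, derivative_ofNat, derivative_one,
      derivative_zero] at this
    linear_combination this
  -- Put r = q + 2Xq'. Then 2Xq = -(1 + t r) turns the polynomial into 1 + t(2r + q) + t²(r² + qr),
  -- and `h4` shows that 2r + q is divisible by t.
  refine ⟨-(3 * derivative q + 2 * X * derivative (derivative q)) +
    (q + 2 * X * derivative q) ^ 2 + q * (q + 2 * X * derivative q), ?_⟩
  have hX : (X : (ZMod p)[X]) + C (j ^ 2) = 2 * X - t := by rw [ht]; ring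
  rw [psiEps_zero_eq p hj, psiCompl_eq_X_mul p hj, hR, hX]
  linear_combination (2 * X * q - (1 + t * (q + 2 * X * derivative q)) - t * q) * h3 + t * h4

lemma psi_dvd_psiEps_zero_mul_sub (h2 : p ≠ 2) (ε : Fin 2) (j : ZMod p) :
    psi p ∣ psiEps p 0 j * psiEps p ε j - psiEps p ε j := by
  have e : psiEps p 0 j * psiEps p ε j - psiEps p ε j =
    (psiEps p 0 j - 1) * psiEps p ε j := by ring
  rw [e]
  by_cases hj : j = 0
  · subst hj
    rw [psi_eq_X_mul]
    exact mul_dvd_mul (X_dvd_psiEps_zero_zero_sub_one p h2) (psiCompl_dvd_psiEps p h2 ε 0)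
  · rw [psi_eq_sq_mul p h2 hj]
    exact mul_dvd_mul (sq_dvd_psiEps_zero_sub_one p h2 hj) (psiCompl_dvd_psiEps p h2 ε j)

lemma psi_dvd_psiEps_one_mul_self (h2 : p ≠ 2) {j : ZMod p} (hj : j ≠ 0) :
    psi p ∣ psiEps p 1 j * psiEps p 1 j := by
  rw [psiEps_one_eq p h2 hj, psi_eq_sq_mul p h2 hj]
  exact ⟨psiCompl p j, by ring⟩

lemma prod_dvd_psiEps (h2 : p ≠ 2) (ε : Fin 2) (j : ZMod p) {s : Finset (ZMod p)} (h1 : j ∉ s)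
    (h1' : -j ∉ s) : ∏ i ∈ s, (X - C (i ^ 2)) ∣ psiEps p ε j := by
  refine (Finset.prod_dvd_prod_of_subset _ _ _ fun i hi => ?_).trans (psiCompl_dvd_psiEps p h2 ε j)
  simp only [Finset.mem_sdiff, Finset.mem_univ, Finset.mem_insert, Finset.mem_singleton, true_and]
  rintro (rfl | rfl)
  exacts [h1 hi, h1' hi]

/-- The first factor has all roots of ψ except those from ±j, and the second supplies these because
j' is neither j nor -j. -/
lemma psi_dvd_psiEps_mul_psiEps (h2 : p ≠ 2) {j j' : ZMod p} (h : j ≠ j') (h' : j ≠ -j')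
    (ε ε' : Fin 2) : psi p ∣ psiEps p ε j * psiEps p ε' j' := by
  have e : psi p = psiCompl p j * ∏ i ∈ {j, -j}, (X - C (i ^ 2)) := by
    rw [psi, psiCompl, Finset.prod_sdiff (Finset.subset_univ {j, -j})]
  rw [e]
  refine mul_dvd_mul (psiCompl_dvd_psiEps p h2 ε j) (prod_dvd_psiEps p h2 ε' j' ?_ ?_)
  · simp only [Finset.mem_insert, Finset.mem_singleton, not_or]
    exact ⟨h.symm, fun hc => h' (by rw [hc, neg_neg])⟩
  · simp only [Finset.mem_insert, Finset.mem_singleton, not_or]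
    exact ⟨h'.symm, fun hc => h (neg_injective hc).symm⟩

end PsiPolynomials

end SL2Hyper

namespace SL2Hyper

/-! ### The block polynomials and the divisibilities that justify the shift s(a,j). -/

section BlockPolynomials

set_option linter.unusedSectionVars false

open Polynomial

variable (p : ℕ) [hp : Fact p.Prime]

/-- The polynomial `F` with `B1 ε x = F(Y X) μ_a`. -/
noncomputable def blockPoly (ε : Fin 2) (x : ℕ × ℚ) : (ZMod p)[X] :=
  if p = 2 then
    if x = (0, 1 / 2) then (if ε = 0 then 1 else X)
    else if x = (1, 0) then X else X + 1
  else (psiEps p ε (x.2 : ZMod p)).comp (X + C ((((x.1 : ZMod p) + 1) / 2) ^ 2))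

lemma phi_eq_phiIco (a m : ℕ) : phi p a m = phiIco (ZMod p) a 0 m := by
  simp [phi, phiIco]

lemma isShifted_iff (h2 : p ≠ 2) (a j : ℕ) : IsShifted p (a, (j : ℚ)) ↔
    (Even a ∧ p + 1 ≤ 2 * j + a) ∨ (Odd a ∧ 2 * j + 1 ≤ a) := by
  rw [IsShifted, if_neg h2]
  refine or_congr (and_congr_right fun _ => ?_) (and_congr_right fun _ => ?_)
  · rw [div_le_iff₀ (by norm_num)]
    constructor
    · intro h
      have : ((p + 1 : ℕ) : ℚ) ≤ (2 * j + a : ℕ) := by push_cast; linarith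
      exact_mod_cast this
    · intro h
      have : ((p + 1 : ℕ) : ℚ) ≤ (2 * j + a : ℕ) := by exact_mod_cast h
      push_cast at this
      linarith
  · rw [le_div_iff₀ (by norm_num)]
    constructor
    · intro h
      have : ((2 * j + 1 : ℕ) : ℚ) ≤ (a : ℕ) := by push_cast; linarith
      exact_mod_cast this
    · intro h
      have : ((2 * j + 1 : ℕ) : ℚ) ≤ (a : ℕ) := by exact_mod_cast h
      push_cast at this
      linarith

lemma mem_P_odd (h2 : p ≠ 2) {x : ℕ × ℚ} (hx : x ∈ P p) :
    ∃ a j : ℕ, x = (a, (j : ℚ)) ∧ a < p ∧ 2 * j + 1 ≤ p := by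
  rw [P, if_neg h2] at hx
  obtain ⟨h1, j, hj, h3⟩ := hx
  refine ⟨x.1, j, Prod.ext rfl h3, h1, ?_⟩
  have := hp.out.two_le
  omega

lemma mem_P_two {x : ℕ × ℚ} (hx : x ∈ P 2) : x = (0, 1 / 2) ∨ x = (1, 0) ∨ x = (1, 1) := by
  simpa [P] using hx

lemma eq_of_dvd_of_lt {N : ℤ} (h : (p : ℤ) ∣ N) (h1 : N < 3 * p) (h2 : -(2 * p) < N) :
    N = -p ∨ N = 0 ∨ N = p ∨ N = 2 * p := by
  obtain ⟨c, rfl⟩ := h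
  have hp0 : (0 : ℤ) < p := by exact_mod_cast hp.out.pos
  have h3 : c < 3 := by
    by_contra! hc
    nlinarith
  have h4 : -2 < c := by
    by_contra! hc
    nlinarith
  have : c = -1 ∨ c = 0 ∨ c = 1 ∨ c = 2 := by omega
  rcases this with rfl | rfl | rfl | rfl <;> simp <;> omega

lemma prod_range_dvd_psiEps (h2 : p ≠ 2) (ε : Fin 2) (j : ZMod p) {n : ℕ} (hn : n ≤ p)
    (c : ZMod p) (h1 : ∀ i < n, (i : ZMod p) + c ≠ j) (h1' : ∀ i < n, (i : ZMod p) + c ≠ -j) :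
    ∏ i ∈ Finset.range n, (X - C (((i : ZMod p) + c) ^ 2)) ∣ psiEps p ε j := by
  classical
  have h := prod_dvd_psiEps p h2 ε j (s := (Finset.range n).image fun i : ℕ => (i : ZMod p) + c)
    (by simpa using h1) (by simpa using h1')
  rwa [Finset.prod_image] at h
  intro i hi i' hi' hii
  have hi := Finset.mem_range.mp hi
  have hi' := Finset.mem_range.mp hi'
  have h3 := add_right_cancel hii
  rwa [ZMod.natCast_eq_natCast_iff', Nat.mod_eq_of_lt (by omega), Nat.mod_eq_of_lt (by omega)] at h3

lemma half_add_half (h2 : p ≠ 2) (c : ZMod p) : 2 * (c / 2) = c :=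
  mul_div_cancel₀ c (two_ne_zero_zmod p h2)

/-- Completing the square: i(i + a + 1) + ((a+1)/2)² = (i + (a+1)/2)². This explains the translation
in the definition of B. -/
lemma phiIco_eq_comp (h2 : p ≠ 2) (a n : ℕ) : phiIco (ZMod p) a 0 n =
    (∏ i ∈ Finset.range n, (X - C (((i : ZMod p) + ((a : ZMod p) + 1) / 2) ^ 2))).comp
      (X + C ((((a : ZMod p) + 1) / 2) ^ 2)) := by
  rw [phiIco, Polynomial.prod_comp, Nat.Ico_zero_eq_range]
  refine Finset.prod_congr rfl fun i _ => ?_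
  have h := half_add_half p h2 ((a : ZMod p) + 1)
  rw [sub_comp, X_comp, C_comp, add_sub_assoc, ← C_sub, sub_eq_add_neg, ← C_neg]
  congr 2
  push_cast
  linear_combination (-(i : ZMod p)) * (-h)

lemma chiPoly_eq_comp (h2 : p ≠ 2) (a n : ℕ) : chiPoly (ZMod p) a n =
    (∏ i ∈ Finset.range n, (X - C (((i : ZMod p) + (1 - ((a : ZMod p) + 1) / 2)) ^ 2))).comp
      (X + C ((((a : ZMod p) + 1) / 2) ^ 2)) := by
  rw [chiPoly, Polynomial.prod_comp]
  refine Finset.prod_congr rfl fun i _ => ?_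
  have h := half_add_half p h2 ((a : ZMod p) + 1)
  rw [sub_comp, X_comp, C_comp, add_sub_assoc, ← C_sub]
  congr 2
  push_cast
  linear_combination (-(i : ZMod p) - 1) * h

/-- As i runs over 0, …, p - 1, the values i + (a+1)/2 run once over F_p. -/
lemma phiIco_prime_eq_psi_comp (h2 : p ≠ 2) (a : ℕ) :
    phiIco (ZMod p) a 0 p = (psi p).comp (X + C ((((a : ZMod p) + 1) / 2) ^ 2)) := by
  rw [phiIco_eq_comp p h2, psi]
  congr 1
  refine Finset.prod_bij' (fun (i : ℕ) _ => (i : ZMod p) + ((a : ZMod p) + 1) / 2)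
    (fun (i : ZMod p) _ => (i - ((a : ZMod p) + 1) / 2).val) ?_ ?_ ?_ ?_ ?_
  · simp
  · intro i _
    exact Finset.mem_range.mpr (ZMod.val_lt _)
  · intro i hi
    rw [add_sub_cancel_right, ZMod.val_natCast, Nat.mod_eq_of_lt (Finset.mem_range.mp hi)]
  · intro i _
    simp
  · simp

lemma comp_dvd_comp {f g : (ZMod p)[X]} (h : f ∣ g) (c : (ZMod p)[X]) : f.comp c ∣ g.comp c := by
  obtain ⟨q, rfl⟩ := h
  exact ⟨q.comp c, mul_comp _ _ _⟩

lemma blockPoly_odd (h2 : p ≠ 2) (ε : Fin 2) (a j : ℕ) : blockPoly p ε (a, (j : ℚ)) =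
    (psiEps p ε (j : ZMod p)).comp (X + C ((((a : ZMod p) + 1) / 2) ^ 2)) := by
  rw [blockPoly, if_neg h2, Rat.cast_natCast]

lemma blockPoly_ne_zero_and_natDegree_lt (ε : Fin 2) {x : ℕ × ℚ} (hx : x ∈ P p) :
    blockPoly p ε x ≠ 0 ∧ (blockPoly p ε x).natDegree < p := by
  by_cases h2 : p = 2
  · subst h2
    rcases mem_P_two hx with rfl | rfl | rfl
    · fin_cases ε <;> simp [blockPoly]
    · simp [blockPoly]
    · simp only [blockPoly, Prod.mk.injEq, one_ne_zero, false_and, if_false, if_true, and_false]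
      exact ⟨X_add_C_ne_zero 1, by
        rw [← C_1, natDegree_X_add_C]; norm_num⟩
  · obtain ⟨a, j, rfl, -, -⟩ := mem_P_odd p h2 hx
    have h := psiEps_ne_zero_and_natDegree_lt p h2 ε j
    rw [blockPoly_odd p h2]
    refine ⟨fun hc => h.1 ?_, by rw [natDegree_comp, natDegree_X_add_C, mul_one]; exact h.2⟩
    exact comp_X_add_C_eq_zero_iff.mp hc

lemma phiIco_two_zero : phiIco (ZMod 2) 0 0 2 = X * X := by
  have h2 : ((1 : ℕ) : ZMod 2) * ((1 : ℕ) + (0 : ℤ) + 1) = 0 := by decide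
  rw [phiIco, Nat.Ico_zero_eq_range, Finset.prod_range_succ, Finset.prod_range_one, h2]
  simp

lemma phiIco_two_one : phiIco (ZMod 2) 1 0 2 = X * (X + 1) := by
  have h2 : ((1 : ℕ) : ZMod 2) * ((1 : ℕ) + (1 : ℤ) + 1) = -1 := by decide
  rw [phiIco, Nat.Ico_zero_eq_range, Finset.prod_range_succ, Finset.prod_range_one, h2]
  simp
  exact CharTwo.sub_eq_add _ _

lemma phiIco_dvd_blockPoly_zero_mul_sub (ε : Fin 2) {x : ℕ × ℚ} (hx : x ∈ P p) :
    phiIco (ZMod p) x.1 0 p ∣ blockPoly p 0 x * blockPoly p ε x - blockPoly p ε x := by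
  by_cases h2 : p = 2
  · subst h2
    have h0 : (2 : (ZMod 2)[X]) = 0 := CharP.cast_eq_zero _ 2
    rcases mem_P_two hx with rfl | rfl | rfl
    · fin_cases ε <;> simp [blockPoly]
    · rw [Nat.cast_one, phiIco_two_one]
      refine ⟨1, ?_⟩
      simp [blockPoly]
      linear_combination (-X) * h0
    · rw [Nat.cast_one, phiIco_two_one]
      refine ⟨1, ?_⟩
      simp [blockPoly]
      ring
  · obtain ⟨a, j, rfl, -, -⟩ := mem_P_odd p h2 hx
    rw [blockPoly_odd p h2, blockPoly_odd p h2, ← mul_comp, ← sub_comp,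
      phiIco_prime_eq_psi_comp p h2]
    exact comp_dvd_comp p (psi_dvd_psiEps_zero_mul_sub p h2 ε j) _

lemma natCast_ne_zero_of_lt {j : ℕ} (hj : j ≠ 0) (hjp : j < p) : (j : ZMod p) ≠ 0 := by
  rw [Ne, ZMod.natCast_eq_zero_iff]
  exact fun h => absurd (Nat.le_of_dvd (Nat.pos_of_ne_zero hj) h) (by omega)

lemma phiIco_dvd_blockPoly_one_sq {x : ℕ × ℚ} (hx : x ∈ P p) (h : ¬ Degenerate p x) :
    phiIco (ZMod p) x.1 0 p ∣ blockPoly p 1 x * blockPoly p 1 x := by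
  by_cases h2 : p = 2
  · subst h2
    rcases mem_P_two hx with rfl | rfl | rfl
    · rw [Nat.cast_zero, phiIco_two_zero]
      simp [blockPoly]
    · simp [Degenerate] at h
    · simp [Degenerate] at h
  · obtain ⟨a, j, rfl, -, hj⟩ := mem_P_odd p h2 hx
    rw [Degenerate, if_neg h2] at h
    have hj0 : j ≠ 0 := by
      rintro rfl
      exact h Nat.cast_zero
    rw [blockPoly_odd p h2, ← mul_comp, phiIco_prime_eq_psi_comp p h2]
    exact comp_dvd_comp p
      (psi_dvd_psiEps_one_mul_self p h2 (natCast_ne_zero_of_lt p hj0 (by omega))) _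

lemma phiIco_dvd_blockPoly_mul_blockPoly {x x' : ℕ × ℚ} (hx : x ∈ P p) (hx' : x' ∈ P p)
    (h1 : x.1 = x'.1) (hne : x ≠ x') :
    phiIco (ZMod p) x.1 0 p ∣ blockPoly p 0 x * blockPoly p 0 x' := by
  by_cases h2 : p = 2
  · subst h2
    rcases mem_P_two hx with rfl | rfl | rfl <;> rcases mem_P_two hx' with rfl | rfl | rfl <;>
      first
      | exact absurd rfl hne
      | (simp at h1; done)
      | (rw [Nat.cast_one, phiIco_two_one]; simp [blockPoly]; done)
      | (rw [Nat.cast_one, phiIco_two_one, mul_comm]; simp [blockPoly])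
  · obtain ⟨a, j, rfl, -, hj⟩ := mem_P_odd p h2 hx
    obtain ⟨a', j', rfl, -, hj'⟩ := mem_P_odd p h2 hx'
    dsimp only at h1
    subst h1
    have hjj : j ≠ j' := by
      rintro rfl
      exact hne rfl
    rw [blockPoly_odd p h2, blockPoly_odd p h2, ← mul_comp, phiIco_prime_eq_psi_comp p h2]
    refine comp_dvd_comp p (psi_dvd_psiEps_mul_psiEps p h2 ?_ ?_ 0 0) _
    · rw [Ne, ZMod.natCast_eq_natCast_iff', Nat.mod_eq_of_lt (by omega),
        Nat.mod_eq_of_lt (by omega)]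
      exact hjj
    · intro hc
      have h3 : ((j + j' : ℕ) : ZMod p) = 0 := by push_cast; rw [hc]; ring
      exact natCast_ne_zero_of_lt p (by omega) (by omega) h3

/-- The exponent of `X` to the right of `Fr'(z)` in `Z ε z x`. -/
noncomputable def blockShift (x : ℕ × ℚ) : ℕ := by
  classical exact if IsShifted p x then sShift p x else 0

lemma blockShift_of_shifted {x : ℕ × ℚ} (h : IsShifted p x) : blockShift p x = sShift p x :=
  if_pos h

lemma blockShift_of_not_shifted {x : ℕ × ℚ} (h : ¬ IsShifted p x) : blockShift p x = 0 :=
  if_neg h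

/-- Y^s X^s passes through the weight a + 2s, and the shift is chosen so that this weight is 0 or 1
modulo p, where admissibility is easy. -/
lemma sShift_spec {x : ℕ × ℚ} (hx : x ∈ P p) (h : IsShifted p x) :
    x.1 + 2 * sShift p x = p ∨ (x.1 + 2 * sShift p x = p + 1 ∧ 1 ≤ sShift p x) := by
  by_cases h2 : p = 2
  · subst h2
    rw [IsShifted, if_pos rfl] at h
    subst h
    simp [sShift]
  · obtain ⟨a, j, rfl, ha, hj⟩ := mem_P_odd p h2 hx
    obtain ⟨m, hm⟩ := hp.out.odd_of_ne_two h2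
    rw [isShifted_iff p h2] at h
    rw [sShift, if_neg h2]
    dsimp only
    rcases h with ⟨⟨b, hb⟩, h⟩ | ⟨⟨b, hb⟩, h⟩
    · rw [if_pos ⟨b, hb⟩]
      omega
    · rw [if_neg (by rw [Nat.not_even_iff_odd]; exact ⟨b, hb⟩)]
      omega

/-- The roots (i + (a+1)/2)² with i < s avoid j²: a coincidence would make 2i + a + 1 ∓ 2j divisible
by p, which size and parity exclude for pairs of shifted type. -/
lemma phiIco_sShift_dvd (h2 : p ≠ 2) (ε : Fin 2) {x : ℕ × ℚ} (hx : x ∈ P p) (h : IsShifted p x) :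
    phiIco (ZMod p) x.1 0 (sShift p x) ∣ blockPoly p ε x := by
  have hs := sShift_spec p hx h
  obtain ⟨a, j, rfl, ha, hj⟩ := mem_P_odd p h2 hx
  obtain ⟨m, hm⟩ := hp.out.odd_of_ne_two h2
  rw [isShifted_iff p h2] at h
  rw [blockPoly_odd p h2, phiIco_eq_comp p h2]
  dsimp only at hs ⊢
  have h3 := half_add_half p h2 ((a : ZMod p) + 1)
  refine comp_dvd_comp p (prod_range_dvd_psiEps p h2 ε _ (by omega) _ ?_ ?_) _
  · intro i hi hc
    have h4 : ((2 * i + a + 1 - 2 * j : ℤ) : ZMod p) = 0 := by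
      push_cast
      linear_combination 2 * hc - h3
    rw [ZMod.intCast_zmod_eq_zero_iff_dvd] at h4
    rcases h with ⟨⟨b, hb⟩, h⟩ | ⟨⟨b, hb⟩, h⟩ <;>
      rcases eq_of_dvd_of_lt p h4 (by omega) (by omega) with h5 | h5 | h5 | h5 <;> omega
  · intro i hi hc
    have h4 : ((2 * i + a + 1 + 2 * j : ℤ) : ZMod p) = 0 := by
      push_cast
      linear_combination 2 * hc - h3
    rw [ZMod.intCast_zmod_eq_zero_iff_dvd] at h4
    rcases h with ⟨⟨b, hb⟩, h⟩ | ⟨⟨b, hb⟩, h⟩ <;>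
      rcases eq_of_dvd_of_lt p h4 (by omega) (by omega) with h5 | h5 | h5 | h5 <;> omega

/-- For pairs not of shifted type, the same size and parity argument shows that the roots belonging
to X^a Y^a avoid j². The factor X^a Y^a gained here is what provides admissibility at weight a
without a shift. -/
lemma chiPoly_dvd_blockPoly (ε : Fin 2) {x : ℕ × ℚ} (hx : x ∈ P p) (h : ¬ IsShifted p x) :
    chiPoly (ZMod p) x.1 x.1 ∣ blockPoly p ε x := by
  by_cases h2 : p = 2
  · subst h2
    rcases mem_P_two hx with rfl | rfl | rfl
    · simp [chiPoly]
    · simp [IsShifted] at h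
    · simp [chiPoly, blockPoly]
  · obtain ⟨a, j, rfl, ha, hj⟩ := mem_P_odd p h2 hx
    obtain ⟨m, hm⟩ := hp.out.odd_of_ne_two h2
    rw [isShifted_iff p h2, not_or, not_and, not_and, Nat.even_iff, Nat.odd_iff] at h
    rw [blockPoly_odd p h2, chiPoly_eq_comp p h2]
    have h3 := half_add_half p h2 ((a : ZMod p) + 1)
    refine comp_dvd_comp p (prod_range_dvd_psiEps p h2 ε _ ha.le _ ?_ ?_) _
    · intro i hi hc
      have h4 : ((2 * i + 1 - a - 2 * j : ℤ) : ZMod p) = 0 := by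
        push_cast
        linear_combination 2 * hc + h3
      rw [ZMod.intCast_zmod_eq_zero_iff_dvd] at h4
      rcases eq_of_dvd_of_lt p h4 (by omega) (by omega) with h5 | h5 | h5 | h5 <;> omega
    · intro i hi hc
      have h4 : ((2 * i + 1 - a + 2 * j : ℤ) : ZMod p) = 0 := by
        push_cast
        linear_combination 2 * hc + h3
      rw [ZMod.intCast_zmod_eq_zero_iff_dvd] at h4
      rcases eq_of_dvd_of_lt p h4 (by omega) (by omega) with h5 | h5 | h5 | h5 <;> omega

/-- The degree of the block polynomial is below p, so the supremum defining n is attained. The bound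
s ≤ n guarantees that the truncated subtraction m - s in `Z` is exact. -/
lemma nEps_spec (ε : Fin 2) {x : ℕ × ℚ} (hx : x ∈ P p) :
    phiIco (ZMod p) x.1 0 (nEps p ε x) ∣ blockPoly p ε x ∧ nEps p ε x < p ∧
      blockShift p x ≤ nEps p ε x := by
  by_cases h2 : p = 2
  · subst h2
    rcases mem_P_two hx with rfl | rfl | rfl
    · have h : ¬ IsShifted 2 (0, 1 / 2) := by simp [IsShifted]
      rw [blockShift_of_not_shifted 2 h]
      fin_cases ε <;> simp [nEps, phiIco, blockPoly]
    · have h : IsShifted 2 (1, 0) := by simp [IsShifted]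
      rw [blockShift_of_shifted 2 h]
      simp [nEps, phiIco, blockPoly, sShift]
    · have h : ¬ IsShifted 2 (1, 1) := by simp [IsShifted]
      rw [blockShift_of_not_shifted 2 h]
      simp [nEps, phiIco]
  · have hF := blockPoly_ne_zero_and_natDegree_lt p ε hx
    have hset : nEps p ε x = sSup {n | phiIco (ZMod p) x.1 0 n ∣ blockPoly p ε x} := by
      rw [nEps, if_neg h2, blockPoly, if_neg h2]
      simp only [phi_eq_phiIco]
    have hb : ∀ n ∈ {n | phiIco (ZMod p) x.1 0 n ∣ blockPoly p ε x}, n < p := fun n hn => by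
      have := natDegree_le_of_dvd hn hF.1
      rw [phiIco_natDegree] at this
      omega
    have hbdd : BddAbove {n | phiIco (ZMod p) x.1 0 n ∣ blockPoly p ε x} :=
      ⟨p, fun n hn => (hb n hn).le⟩
    have hmem : nEps p ε x ∈ {n | phiIco (ZMod p) x.1 0 n ∣ blockPoly p ε x} := by
      rw [hset]
      exact Nat.sSup_mem ⟨0, by simp [phiIco]⟩ hbdd
    refine ⟨hmem, hb _ hmem, ?_⟩
    by_cases h : IsShifted p x
    · rw [blockShift_of_shifted p h, hset]
      exact le_csSup hbdd (phiIco_sShift_dvd p h2 ε hx h)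
    · rw [blockShift_of_not_shifted p h]
      exact Nat.zero_le _

end BlockPolynomials

end SL2Hyper

namespace SL2Hyper

/-! ### The maps z ↦ Z(z; (a,j)): products, injectivity, compatibility with A_r. -/

section BlockElements

set_option linter.unusedSectionVars false

open Polynomial

variable {k : Type*} [Field k] (p : ℕ) [hp : Fact p.Prime] [CharP k p]

lemma phiIco_map (a : ℤ) (s m : ℕ) :
    (phiIco (ZMod p) a s m).map (toField k p) = phiIco k a s m := by
  rw [phiIco, Polynomial.map_prod, phiIco]
  refine Finset.prod_congr rfl fun i _ => ?_
  rw [Polynomial.map_sub, map_X, map_C]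
  congr 2
  simp only [map_mul, map_add, map_natCast, map_intCast, map_one]

lemma chiPoly_map (a : ℤ) (n : ℕ) :
    (chiPoly (ZMod p) a n).map (toField k p) = chiPoly k a n := by
  rw [chiPoly, Polynomial.map_prod, chiPoly]
  refine Finset.prod_congr rfl fun i _ => ?_
  rw [Polynomial.map_add, map_X, map_C]
  congr 2
  simp only [map_mul, map_add, map_sub, map_natCast, map_intCast, map_one]

/-- After multiplication by the idempotent e, the e inside the polynomial is redundant. So B is a
polynomial in YX alone, times μ_a. -/
lemma aeval_idem_mul_add {e u : U k} (he : e * e = e) (heu : e * u = u * e) (c : k) (F : k[X]) :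
    aeval (e * u + algebraMap k (U k) c) F * e = aeval (u + algebraMap k (U k) c) F * e := by
  induction F using Polynomial.induction_on' with
  | add f g hf hg => rw [map_add, map_add, add_mul, add_mul, hf, hg]
  | monomial n r =>
    rw [aeval_monomial, aeval_monomial, mul_assoc, mul_assoc]
    congr 1
    induction n with
    | zero => simp
    | succ n ih =>
      have hc : algebraMap k (U k) c * e = e * algebraMap k (U k) c := Algebra.commutes c e
      have h1 : (e * u + algebraMap k (U k) c) * e = e * (u + algebraMap k (U k) c) := by
        rw [add_mul, hc, mul_add, mul_assoc, ← heu, ← mul_assoc, he]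
      have h2 : (u + algebraMap k (U k) c) * e = e * (u + algebraMap k (U k) c) := by
        rw [add_mul, hc, mul_add, heu]
      rw [pow_succ, pow_succ, mul_assoc, mul_assoc, h1, h2, ← mul_assoc, ← mul_assoc, ih]

lemma mu_eq_wt (a : ℕ) : mu k p a = wt k p a := mu_eq p a

lemma wt_mul_yx (a : ℤ) : wt k p a * yx k = yx k * wt k p a := wt_commute p yx_mem_degSpan a

lemma B1_eq (ε : Fin 2) {x : ℕ × ℚ} (hx : x ∈ P p) :
    B1 k p ε x = aeval (yx k) ((blockPoly p ε x).map (toField k p)) * wt k p x.1 := by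
  rw [B1, blockPoly]
  split_ifs with h2 h3 h4 h5
  · subst h3
    simp [mu_eq_wt]
  · subst h3
    rw [map_X, aeval_X, mul_assoc, mu_eq_wt, ← yx, wt_mul_yx]
  · subst h5
    rw [map_X, aeval_X, mul_assoc, mu_eq_wt, ← yx]
    exact wt_mul_yx p _
  · subst h2
    have h6 : x = (1, 1) := by
      rcases mem_P_two hx with h | h | h
      exacts [absurd h h3, absurd h h5, h]
    subst h6
    rw [Polynomial.map_add, map_X, Polynomial.map_one, map_add, aeval_X, map_one, mul_assoc,
      mu_eq_wt, ← yx, add_mul, one_mul]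
    congr 1
    exact wt_mul_yx _ _
  · rw [mu_eq_wt, mul_assoc, ← yx, aeval_idem_mul_add (wt_mul_self p _) (wt_mul_yx p _),
      map_comp, aeval_comp, Polynomial.map_add, map_X, map_C, map_add, aeval_X, aeval_C]

lemma one_ne_zero_U : (1 : U k) ≠ 0 := by
  have h := (pbwBasis k).ne_zero (0, 0, 0)
  rwa [pbwBasis_apply, pbw, Yd_zero, Xd_zero, binomH_zero, one_mul, one_mul] at h

lemma zeta_one (a : ℤ) (s : ℕ) (g : k[X]) :
    zeta p a s g 1 = aeval (yx k) (phiIco k a 0 s * g) * wt k p a := by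
  have h := aeval_phiIco_zero_mul_wt (k := k) p a s
  rw [zeta, Fr'_one, mul_one, mul_comm (phiIco k a 0 s), map_mul]
  simp only [mul_assoc] at h ⊢
  rw [h]

/-- Polynomials of degree less than `p` are determined by their action on a weight space. -/
lemma eq_of_aeval_yx_mul_wt_eq (a : ℤ) {F G : k[X]} (hF : F.degree < p) (hG : G.degree < p)
    (h : aeval (yx k) F * wt k p a = aeval (yx k) G * wt k p a) : F = G := by
  by_contra hne
  refine one_ne_zero_U (k := k) (eq_zero_of_zeta_eq_zero p a (s := 0) (sub_ne_zero.mpr hne)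
    ((degree_sub_le _ _).trans_lt (max_lt hF hG)) one_mem_degSpan ?_)
  rw [zeta_one, phiIco_self, one_mul, map_sub, sub_mul, h, sub_self]

variable (k) in
/-- The image of `blockPoly` over `k`. -/
noncomputable abbrev blockPolyMap (ε : Fin 2) (x : ℕ × ℚ) : k[X] :=
  (blockPoly p ε x).map (toField k p)

lemma blockPolyMap_ne_zero (ε : Fin 2) {x : ℕ × ℚ} (hx : x ∈ P p) : blockPolyMap k p ε x ≠ 0 :=
  (Polynomial.map_ne_zero_iff (toField k p).injective).mpr
    (blockPoly_ne_zero_and_natDegree_lt p ε hx).1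

lemma degree_blockPolyMap_lt (ε : Fin 2) {x : ℕ × ℚ} (hx : x ∈ P p) :
    (blockPolyMap k p ε x).degree < p := by
  rw [degree_map, degree_eq_natDegree (blockPoly_ne_zero_and_natDegree_lt p ε hx).1]
  exact_mod_cast (blockPoly_ne_zero_and_natDegree_lt p ε hx).2

lemma blockPolyMap_dvd {f : (ZMod p)[X]} {ε : Fin 2} {x : ℕ × ℚ} (h : f ∣ blockPoly p ε x) :
    f.map (toField k p) ∣ blockPolyMap k p ε x := Polynomial.map_dvd _ h

lemma Icc_sub_one_eq_Ico (n : ℕ) : Finset.Icc n (p - 1) = Finset.Ico n p := by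
  ext i
  have := hp.out.pos
  simp only [Finset.mem_Icc, Finset.mem_Ico]
  omega

lemma wt_mul_sum_eq (a : ℤ) (S : Finset ℕ) (c : ℕ → k) :
    wt k p a * ∑ m ∈ S, c m • (Yd k 1 ^ m * Xd k 1 ^ m) =
      aeval (yx k) (∑ m ∈ S, C (c m) * phiIco k a 0 m) * wt k p a := by
  rw [map_sum, Finset.sum_mul, Finset.mul_sum]
  refine Finset.sum_congr rfl fun m _ => ?_
  rw [map_mul, aeval_C, mul_assoc, aeval_phiIco_zero_mul_wt p a, ← Algebra.smul_def, mul_smul_comm,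
    ← mul_assoc, wt_mul_Yd_pow, mul_assoc, ← Xd_pow_mul_wt, mul_assoc]

/-- Divide the block polynomial by φ_{a,n} and expand the quotient in the Newton basis of the
remaining roots. Existence ensures that `coeffB`, a `Classical.epsilon` choice, satisfies its
defining equation. -/
lemma exists_coeff_B1 (ε : Fin 2) {x : ℕ × ℚ} (hx : x ∈ P p) :
    ∃ c : ℕ → ZMod p, B1 k p ε x = mu k p x.1 *
      ∑ m ∈ Finset.Icc (nEps p ε x) (p - 1), toField k p (c m) • (Yd k 1 ^ m * Xd k 1 ^ m) := by
  obtain ⟨⟨q, hq⟩, hn, -⟩ := nEps_spec p ε hx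
  have hF := blockPoly_ne_zero_and_natDegree_lt p ε hx
  have hq0 : q ≠ 0 := by
    rintro rfl
    exact hF.1 (by rw [hq, mul_zero])
  have hqd : q.degree < (p - nEps p ε x : ℕ) := by
    have := hF.2
    rw [hq, natDegree_mul (phiIco_monic _ _ _ _).ne_zero hq0, phiIco_natDegree] at this
    rw [degree_eq_natDegree hq0]
    have h1 : q.natDegree < p - nEps p ε x := by omega
    exact_mod_cast h1
  obtain ⟨c, hc⟩ := exists_phiIco_expansion (x.1 : ℤ) (nEps p ε x) p q hqd
  refine ⟨c, ?_⟩
  rw [B1_eq p ε hx, mu_eq_wt, wt_mul_sum_eq, Icc_sub_one_eq_Ico]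
  congr 2
  rw [hq, hc, Finset.mul_sum, Polynomial.map_sum]
  refine Finset.sum_congr rfl fun m hm => ?_
  rw [mul_left_comm, phiIco_mul_phiIco _ _ (Nat.zero_le _) (Finset.mem_Ico.mp hm).1,
    Polynomial.map_mul, phiIco_map, map_C]

lemma coeffB_spec (ε : Fin 2) {x : ℕ × ℚ} (hx : x ∈ P p) : B1 k p ε x = mu k p x.1 *
    ∑ m ∈ Finset.Icc (nEps p ε x) (p - 1),
      toField k p (coeffB k p ε x m) • (Yd k 1 ^ m * Xd k 1 ^ m) :=
  Classical.epsilon_spec (p := fun c : ℕ → ZMod p => B1 k p ε x = mu k p x.1 *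
    ∑ m ∈ Finset.Icc (nEps p ε x) (p - 1), toField k p (c m) • (Yd k 1 ^ m * Xd k 1 ^ m))
    (exists_coeff_B1 p ε hx)

lemma degree_sum_phiIco_lt (a : ℤ) (s n : ℕ) (c : ℕ → k) :
    (∑ m ∈ Finset.Ico n p, C (c m) * phiIco k a s m).degree < p := by
  refine (degree_sum_le _ _).trans_lt ?_
  rw [Finset.sup_lt_iff (by exact_mod_cast WithBot.bot_lt_coe p)]
  intro m hm
  rw [← smul_eq_C_mul]
  refine (degree_smul_le _ _).trans_lt ?_
  rw [degree_eq_natDegree (phiIco_monic _ _ _ _).ne_zero, phiIco_natDegree]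
  have := Finset.mem_Ico.mp hm
  have h1 : m - s < p := by omega
  exact_mod_cast h1

/-- The elements `Z ε z x` in terms of `zeta`. -/
lemma exists_Z_eq_zeta {x : ℕ × ℚ} (hx : x ∈ P p) (ε : Fin 2) : ∃ g : k[X],
    blockPolyMap k p ε x = phiIco k x.1 0 (blockShift p x) * g ∧
    ∀ z ∈ degSpan k, Z k p ε z x = zeta p x.1 (blockShift p x) g z := by
  by_cases hs : IsShifted p x
  · obtain ⟨-, hn, hsn⟩ := nEps_spec p ε hx
    have hSle : ∀ m ∈ Finset.Ico (nEps p ε x) p, blockShift p x ≤ m := fun m hm =>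
      hsn.trans (Finset.mem_Ico.mp hm).1
    have hB := coeffB_spec (k := k) p ε hx
    rw [mu_eq_wt, wt_mul_sum_eq p _ _ fun m => toField k p (coeffB k p ε x m), B1_eq p ε hx,
      Icc_sub_one_eq_Ico] at hB
    -- Both polynomials have degree below p, so equality on the weight space is equality of
    -- polynomials; φ_{a,s} can then be factored out of each summand.
    have hF := eq_of_aeval_yx_mul_wt_eq p _ (degree_blockPolyMap_lt p ε hx)
      (degree_sum_phiIco_lt p _ _ _ _) hB
    refine ⟨∑ m ∈ Finset.Ico (nEps p ε x) p,
      C (toField k p (coeffB k p ε x m)) * phiIco k x.1 (blockShift p x) m, ?_, fun z hz => ?_⟩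
    · rw [hF, Finset.mul_sum]
      refine Finset.sum_congr rfl fun m hm => ?_
      rw [mul_left_comm, phiIco_mul_phiIco _ _ (Nat.zero_le _) (hSle m hm)]
    · rw [zeta_eq p _ _ _ hz, aeval_sum_phiIco_mul p _ _ hSle, Z, if_pos hs,
        ← blockShift_of_shifted p hs, Icc_sub_one_eq_Ico, mu_eq_wt, Finset.mul_sum, Finset.sum_mul]
      refine Finset.sum_congr rfl fun m hm => ?_
      have e : (x.1 : ℤ) + 2 * m =
          x.1 + 2 * blockShift p x + 2 * (m - blockShift p x : ℕ) := by
        push_cast [Nat.cast_sub (hSle m hm)]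
        ring
      have h1 : wt k p x.1 * (Yd k 1 ^ m * Xd k 1 ^ (m - blockShift p x)) =
          Yd k 1 ^ m * Xd k 1 ^ (m - blockShift p x) * wt k p (x.1 + 2 * blockShift p x) := by
        rw [← mul_assoc, wt_mul_Yd_pow, e, mul_assoc, ← Xd_pow_mul_wt, mul_assoc]
      rw [mul_smul_comm, smul_mul_assoc, ← h1]
      simp only [mul_assoc]
  · refine ⟨blockPolyMap k p ε x, ?_, fun z hz => ?_⟩
    · rw [blockShift_of_not_shifted p hs, phiIco_self, one_mul]
    · rw [blockShift_of_not_shifted p hs, Z, if_neg hs, B1_eq p ε hx, zeta, pow_zero, pow_zero,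
        one_mul, mul_one, ← mul_assoc, (degSpan_commute (Fr'_mem_degSpan p hz)
          (aeval_yx_mem_degSpan _)).eq]

lemma Z_mem_degSpan {x : ℕ × ℚ} (hx : x ∈ P p) (ε : Fin 2) {z : U k} (hz : z ∈ degSpan k) :
    Z k p ε z x ∈ degSpan k := by
  obtain ⟨g, -, hg⟩ := exists_Z_eq_zeta (k := k) p hx ε
  rw [hg z hz]
  exact zeta_mem_degSpan p _ _ _ hz

lemma Z_one {x : ℕ × ℚ} (hx : x ∈ P p) (ε : Fin 2) : Z k p ε 1 x = B1 k p ε x := by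
  obtain ⟨g, hF, hg⟩ := exists_Z_eq_zeta (k := k) p hx ε
  rw [hg 1 one_mem_degSpan, zeta_one, B1_eq p ε hx, ← hF]

lemma eq_zero_of_Z_eq_zero {x : ℕ × ℚ} (hx : x ∈ P p) (ε : Fin 2) {z : U k} (hz : z ∈ degSpan k)
    (h : Z k p ε z x = 0) : z = 0 := by
  obtain ⟨g, hF, hg⟩ := exists_Z_eq_zeta (k := k) p hx ε
  have hF0 := blockPolyMap_ne_zero (k := k) p ε hx
  have hg0 : g ≠ 0 := by
    rintro rfl
    exact hF0 (by rw [hF, mul_zero])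
  have hd := degree_blockPolyMap_lt (k := k) p ε hx
  rw [hF, degree_eq_natDegree (hF ▸ hF0), natDegree_mul (phiIco_monic _ _ _ _).ne_zero hg0,
    phiIco_natDegree] at hd
  have hd' : blockShift p x - 0 + g.natDegree < p := by exact_mod_cast hd
  rw [hg z hz] at h
  refine eq_zero_of_zeta_eq_zero p _ hg0 ?_ hz h
  rw [degree_eq_natDegree hg0]
  have : g.natDegree < p - blockShift p x := by omega
  exact_mod_cast this

lemma Yd_pow_mul_wt_mul_Yd (s : ℕ) (b : ℤ) (i : ℕ) (h : Yd k 1 ^ s * Yd k i = 0) :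
    Yd k 1 ^ s * wt k p b * Yd k i = 0 := by
  rw [mul_assoc, wt, hel_mul_Yd (resFun_mem p b), ← mul_assoc, h, zero_mul]

lemma blockShift_lt {x : ℕ × ℚ} (hx : x ∈ P p) : blockShift p x < p := by
  have h := nEps_spec p 0 hx
  omega

/-- For shifted pairs the weight is 0 or 1. Weight 0 imposes no condition, and weight 1 only that
Y^(p-1) be killed, which Y^s with s ≥ 1 does. For other pairs the factor X^a Y^a of the block
polynomial supplies Y^a, which kills Y^(i) as soon as a + i ≥ p. -/
lemma exists_isAdmissible {x : ℕ × ℚ} (hx : x ∈ P p) {ε : Fin 2} {g : k[X]}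
    (hg : blockPolyMap k p ε x = phiIco k x.1 0 (blockShift p x) * g) (q : k[X]) :
    ∃ w, IsAdmissible p w (aeval (yx k) (phiIco k x.1 0 (blockShift p x) * (g * q)) *
      (Yd k 1 ^ blockShift p x * wt k p (x.1 + 2 * blockShift p x))) := by
  by_cases hs : IsShifted p x
  · have h := sShift_spec p hx hs
    rw [← blockShift_of_shifted p hs] at h
    rcases h with h | ⟨h, h1⟩
    · refine ⟨0, ⟨?_, fun i h1 h2 => by omega⟩⟩
      rw [mul_assoc, mul_assoc, wt_congr p (a := ((0 : ℕ) : ℤ)) (b := x.1 + 2 * blockShift p x),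
        wt_mul_self]
      refine ⟨-1, ?_⟩
      have h1 : (x.1 : ℤ) + 2 * blockShift p x = p := by exact_mod_cast h
      rw [h1]
      push_cast
      ring
    · refine ⟨1, ⟨?_, fun i h3 h2 => ?_⟩⟩
      · rw [mul_assoc, mul_assoc, wt_congr p (a := ((1 : ℕ) : ℤ)) (b := x.1 + 2 * blockShift p x),
          wt_mul_self]
        refine ⟨-1, ?_⟩
        have : (x.1 : ℤ) + 2 * blockShift p x = p + 1 := by exact_mod_cast h
        rw [this]
        push_cast
        ring
      · rw [mul_assoc, Yd_pow_mul_wt_mul_Yd, mul_zero]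
        exact Yd_pow_mul_Yd_eq_zero p (blockShift_lt p hx) h2 (by omega)
  · have h0 := blockShift_of_not_shifted p hs
    rw [h0, phiIco_self, one_mul] at hg
    have hdvd := blockPolyMap_dvd (k := k) p (chiPoly_dvd_blockPoly p ε hx hs)
    rw [chiPoly_map, hg] at hdvd
    obtain ⟨q', rfl⟩ := hdvd
    have hx1 : x.1 < p := by
      by_cases h2 : p = 2
      · subst h2
        rcases mem_P_two hx with rfl | rfl | rfl <;> simp
      · obtain ⟨a, j, rfl, ha, -⟩ := mem_P_odd p h2 hx
        exact ha
    rw [h0, phiIco_self]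
    refine ⟨x.1, ⟨?_, fun i h1 h2 => ?_⟩⟩
    · simp [mul_assoc, wt_mul_self]
    · have e : (1 : k[X]) * (chiPoly k x.1 x.1 * q' * q) = (q' * q) * chiPoly k x.1 x.1 := by ring
      have h3 := aeval_chiPoly_mul_wt (k := k) p x.1 x.1
      rw [e, map_mul, pow_zero, one_mul, mul_assoc, mul_assoc, Nat.cast_zero, mul_zero, add_zero,
        ← mul_assoc (aeval (yx k) (chiPoly k x.1 x.1)), h3, mul_assoc (Xd k 1 ^ x.1),
        mul_assoc (Xd k 1 ^ x.1), Yd_pow_mul_wt_mul_Yd, mul_zero, mul_zero]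
      exact Yd_pow_mul_Yd_eq_zero p hx1 h2 (by omega)

/-- If `F_ε F_ε' ≡ F` modulo `φ_{a,p}`, then `Z` multiplies accordingly. -/
lemma Z_mul_Z {x : ℕ × ℚ} (hx : x ∈ P p) {ε ε' : Fin 2} {G : k[X]}
    (h : phiIco k x.1 0 p ∣ blockPolyMap k p ε x * blockPolyMap k p ε' x -
      phiIco k x.1 0 (blockShift p x) * G) {z z' : U k}
    (hz : z ∈ degSpan k) (hz' : z' ∈ degSpan k) :
    Z k p ε z x * Z k p ε' z' x = zeta p x.1 (blockShift p x) G (z * z') := by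
  obtain ⟨g, hF, hg⟩ := exists_Z_eq_zeta (k := k) p hx ε
  obtain ⟨g', hF', hg'⟩ := exists_Z_eq_zeta (k := k) p hx ε'
  obtain ⟨w, hw⟩ := exists_isAdmissible p hx hF g'
  have hs := (blockShift_lt p hx).le
  rw [hg z hz, hg' z' hz', zeta_mul_zeta p _ _ g g' hz hz' hw]
  refine zeta_congr p _ hs ?_ (mul_mem_degSpan hz hz')
  rw [← phiIco_mul_phiIco k _ (Nat.zero_le (blockShift p x)) hs, hF, hF'] at h
  refine (mul_dvd_mul_iff_left (phiIco_monic k (x.1 : ℤ) 0 (blockShift p x)).ne_zero).mp ?_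
  convert h using 1
  ring

lemma map_dvd_of_dvd {x : ℕ × ℚ} {q : (ZMod p)[X]} (h : phiIco (ZMod p) x.1 0 p ∣ q) :
    phiIco k x.1 0 p ∣ q.map (toField k p) := by
  rw [← phiIco_map p]
  exact Polynomial.map_dvd _ h

lemma Z_zero_mul_Z {x : ℕ × ℚ} (hx : x ∈ P p) (ε : Fin 2) {z z' : U k}
    (hz : z ∈ degSpan k) (hz' : z' ∈ degSpan k) :
    Z k p 0 z x * Z k p ε z' x = Z k p ε (z * z') x := by
  obtain ⟨g, hF, hg⟩ := exists_Z_eq_zeta (k := k) p hx ε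
  rw [hg _ (mul_mem_degSpan hz hz'), Z_mul_Z p hx _ hz hz']
  have h := map_dvd_of_dvd (k := k) p (phiIco_dvd_blockPoly_zero_mul_sub p ε hx)
  rw [← hF]
  rwa [Polynomial.map_sub, Polynomial.map_mul] at h

lemma Z_one_mul_Z_one {x : ℕ × ℚ} (hx : x ∈ P p) (hd : ¬ Degenerate p x) {z z' : U k}
    (hz : z ∈ degSpan k) (hz' : z' ∈ degSpan k) :
    Z k p 1 z x * Z k p 1 z' x = 0 := by
  have h := map_dvd_of_dvd (k := k) p (phiIco_dvd_blockPoly_one_sq p hx hd)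
  have h1 := Z_mul_Z (k := k) p hx (ε := 1) (ε' := 1) (G := 0)
    (by rwa [mul_zero, sub_zero, ← Polynomial.map_mul]) hz hz'
  rw [h1, zeta, map_zero, zero_mul, zero_mul]

/-- Inserting Z^{(0)}(1) as a unit on each side reduces to idempotents of level one. Those of
different weights are orthogonal through μ_a, and those of equal weight because φ_{a,p} divides the
product of their block polynomials. -/
lemma Z_mul_Z_of_ne {x x' : ℕ × ℚ} (hx : x ∈ P p) (hx' : x' ∈ P p) (hne : x ≠ x')
    (ε ε' : Fin 2) {z z' : U k} (hz : z ∈ degSpan k) (hz' : z' ∈ degSpan k) :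
    Z k p ε z x * Z k p ε' z' x' = 0 := by
  have h1 := Z_zero_mul_Z (k := k) p hx ε one_mem_degSpan hz
  have h2 := Z_zero_mul_Z (k := k) p hx' ε' one_mem_degSpan hz'
  have h3 : Z k p 0 1 x * Z k p 0 1 x' = (0 : U k) := by
    have hG' := aeval_yx_mem_degSpan (blockPolyMap k p 0 x')
    rw [Z_one p hx, Z_one p hx', B1_eq p 0 hx, B1_eq p 0 hx', ← wt_commute p hG', mul_assoc,
      ← mul_assoc (wt k p _) (wt k p _)]
    by_cases ha : x.1 = x'.1
    · have h := map_dvd_of_dvd (k := k) p (phiIco_dvd_blockPoly_mul_blockPoly p hx hx' ha hne)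
      rw [← ha, wt_mul_self, wt_commute p hG', ← mul_assoc, ← map_mul, ← Polynomial.map_mul]
      have h4 := zeta_eq_zero_of_dvd p x.1 (Nat.zero_le p) h (one_mem_degSpan (k := k))
      rwa [zeta_one, phiIco_self, one_mul] at h4
    · rw [wt_mul_of_not_dvd, zero_mul, mul_zero]
      have hlt : ∀ y ∈ P p, y.1 < p := fun y hy => by
        by_cases h2 : p = 2
        · subst h2
          rcases mem_P_two hy with rfl | rfl | rfl <;> simp
        · obtain ⟨a, j, rfl, ha, -⟩ := mem_P_odd p h2 hy
          exact ha
      have h5 := hlt x hx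
      have h6 := hlt x' hx'
      intro h7
      have h8 := Int.eq_zero_of_abs_lt_dvd h7 (by rw [abs_lt]; constructor <;> omega)
      omega
  rw [one_mul] at h1 h2
  have h4 := degSpan_commute (Z_mem_degSpan p hx ε hz)
    (Z_mem_degSpan p hx' 0 (one_mem_degSpan (k := k)))
  rw [← h1, ← h2, mul_assoc, ← mul_assoc (Z k p ε z x), h4.eq, mul_assoc, ← mul_assoc, h3, zero_mul]

lemma Fr'_mem_Ur {r : ℕ} {z : U k} (hz : z ∈ Ar k p r) : Fr' k p z ∈ Ur k p (r + 1) := by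
  classical
  rw [mem_Ar_iff] at hz
  have h : Submodule.span k (degBox k p r : Set (U k)) ≤
      (Subalgebra.toSubmodule (Ur k p (r + 1))).comap (Fr' k p) := by
    refine Submodule.span_le.mpr ?_
    intro v hv
    rw [degBox, Finset.coe_image] at hv
    obtain ⟨⟨m, n⟩, hmn, rfl⟩ := hv
    simp only [Finset.coe_product, Set.mem_prod, Finset.mem_coe, Finset.mem_range] at hmn
    change Fr' k p (pbw k (m, n, m)) ∈ Ur k p (r + 1)
    rw [Fr'_pbw, pbw]
    have hlt : ∀ i, i < p ^ r → i * p < p ^ (r + 1) := fun i hi => by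
      rw [pow_succ]
      exact Nat.mul_lt_mul_of_pos_right hi hp.out.pos
    exact mul_mem (mul_mem (Yd_mem_Ur p (hlt m hmn.1)) (binomH_mem_Ur p (hlt n hmn.2)))
      (Xd_mem_Ur p (hlt m hmn.1))
  exact h hz

lemma degSpan_of_mem_Ar {r : ℕ} {z : U k} (hz : z ∈ Ar k p r) : z ∈ degSpan k :=
  (mem_A_iff p).mp hz.1

lemma Z_mem_Ar {x : ℕ × ℚ} (hx : x ∈ P p) (ε : Fin 2) {r : ℕ} {z : U k} (hz : z ∈ Ar k p r) :
    Z k p ε z x ∈ Ar k p (r + 1) := by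
  have hz' := degSpan_of_mem_Ar p hz
  refine ⟨(mem_A_iff p).mpr (Z_mem_degSpan p hx ε hz'), ?_⟩
  obtain ⟨g, -, hg⟩ := exists_Z_eq_zeta (k := k) p hx ε
  have h1 : 1 < p ^ (r + 1) := Nat.one_lt_pow (Nat.succ_ne_zero r) hp.out.one_lt
  have hX := Xd_mem_Ur (k := k) p h1
  have hY := Yd_mem_Ur (k := k) p h1
  have hyx : Algebra.adjoin k {yx k} ≤ Ur k p (r + 1) :=
    Algebra.adjoin_le (Set.singleton_subset_iff.mpr (mul_mem hY hX))
  have hper : Function.Periodic (resFun (k := k) p x.1) ((p ^ (r + 1) : ℕ) : ℤ) := by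
    have := (resFun_periodic (k := k) p x.1).nat_mul (p ^ r)
    rw [pow_succ]
    rw [pow_one] at this
    push_cast at this ⊢
    exact this
  rw [hg z hz', zeta]
  exact mul_mem (mul_mem (hyx (aeval_mem_adjoin_singleton k _))
    (mul_mem (mul_mem (pow_mem hY _) (Fr'_mem_Ur p hz)) (pow_mem hX _))) (hel_mem_Ur p hper)

end BlockElements

end SL2Hyper

namespace SL2Hyper

/-! ### The multiplication table of the B's, independence and spanning. -/

section Tuples

set_option linter.unusedSectionVars false

variable {k : Type*} [Field k] (p : ℕ) [hp : Fact p.Prime] [CharP k p]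

lemma Z_mul_Z_of_or {x : ℕ × ℚ} (hx : x ∈ P p) {ε ε' : Fin 2} (h : ε = 0 ∨ ε' = 0) {z z' : U k}
    (hz : z ∈ degSpan k) (hz' : z' ∈ degSpan k) :
    Z k p ε z x * Z k p ε' z' x = Z k p (max ε ε') (z * z') x := by
  rcases h with rfl | rfl
  · rw [Z_zero_mul_Z p hx ε' hz hz', max_eq_right (Fin.zero_le _)]
  · rw [(degSpan_commute (Z_mem_degSpan p hx ε hz) (Z_mem_degSpan p hx 0 hz')).eq,
      Z_zero_mul_Z p hx ε hz' hz, max_eq_left (Fin.zero_le _), (degSpan_commute hz hz').eq]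

lemma Z_zero {x : ℕ × ℚ} (hx : x ∈ P p) (ε : Fin 2) : Z k p ε 0 x = 0 := by
  obtain ⟨g, -, hg⟩ := exists_Z_eq_zeta (k := k) p hx ε
  rw [hg 0 (zero_mem _), zeta_zero_right]

lemma Z_mul_Z_of_mul_eq_zero {x : ℕ × ℚ} (hx : x ∈ P p) (ε ε' : Fin 2) {z z' : U k}
    (hz : z ∈ degSpan k) (hz' : z' ∈ degSpan k) (h : z * z' = 0) :
    Z k p ε z x * Z k p ε' z' x = 0 := by
  have h1 := Z_mul_Z_of_or (k := k) p hx (ε := ε) (ε' := 0) (Or.inr rfl) one_mem_degSpan hz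
  have h2 := Z_mul_Z_of_or (k := k) p hx (ε := 0) (ε' := ε') (Or.inl rfl) hz' one_mem_degSpan
  rw [max_eq_left (Fin.zero_le _), one_mul] at h1
  rw [max_eq_right (Fin.zero_le _), mul_one] at h2
  rw [← h1, ← h2, mul_assoc, ← mul_assoc (Z k p 0 z x), Z_zero_mul_Z p hx 0 hz hz', h,
    Z_zero p hx, zero_mul, mul_zero]

/-- Since Fr'(1) = 1, the value 1 for the empty tuple makes the recursion valid from r = 1 on, so
inductions can start at r = 0. -/
lemma B_succ {r : ℕ} (ε : Fin (r + 1) → Fin 2) {aj : Fin (r + 1) → ℕ × ℚ} (h : aj 0 ∈ P p) :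
    B k p ε aj = Z k p (ε 0) (B k p (fun i => ε i.succ) (fun i => aj i.succ)) (aj 0) := by
  rcases r with _ | r
  · exact (Z_one p h (ε 0)).symm
  · rfl

lemma B_mem_Ar {r : ℕ} (ε : Fin r → Fin 2) {aj : Fin r → ℕ × ℚ} (h : ∀ i, aj i ∈ P p) :
    B k p ε aj ∈ Ar k p r := by
  induction r with
  | zero => exact one_mem _
  | succ r ih =>
    rw [B_succ p ε (h 0)]
    exact Z_mem_Ar p (h 0) _ (ih _ fun i => h i.succ)

lemma B_mem_degSpan {r : ℕ} (ε : Fin r → Fin 2) {aj : Fin r → ℕ × ℚ} (h : ∀ i, aj i ∈ P p) :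
    B k p ε aj ∈ degSpan k := degSpan_of_mem_Ar p (B_mem_Ar p ε h)

lemma B_ne_zero {r : ℕ} (ε : Fin r → Fin 2) {aj : Fin r → ℕ × ℚ} (h : ∀ i, aj i ∈ P p) :
    B k p ε aj ≠ 0 := by
  induction r with
  | zero => exact one_ne_zero_U
  | succ r ih =>
    rw [B_succ p ε (h 0)]
    exact fun hc => ih _ (fun i => h i.succ)
      (eq_zero_of_Z_eq_zero p (h 0) _ (B_mem_degSpan p _ fun i => h i.succ) hc)

lemma B_mul_B {r : ℕ} {ε ε' : Fin r → Fin 2} {aj : Fin r → ℕ × ℚ} (h : ∀ i, aj i ∈ P p)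
    (hε : ∀ i, ε i = 0 ∨ ε' i = 0) :
    B k p ε aj * B k p ε' aj = B k p (fun i => max (ε i) (ε' i)) aj := by
  induction r with
  | zero => exact one_mul _
  | succ r ih =>
    rw [B_succ p ε (h 0), B_succ p ε' (h 0), B_succ p (fun i => max (ε i) (ε' i)) (h 0),
      Z_mul_Z_of_or p (h 0) (hε 0) (B_mem_degSpan p _ fun i => h i.succ)
        (B_mem_degSpan p _ fun i => h i.succ), ih (fun i => h i.succ) fun i => hε i.succ]

lemma B_mul_B_eq_zero {r : ℕ} {ε ε' : Fin r → Fin 2} {aj : Fin r → ℕ × ℚ} (h : ∀ i, aj i ∈ P p)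
    {i : Fin r} (hd : ¬ Degenerate p (aj i)) (h1 : ε i = 1) (h2 : ε' i = 1) :
    B k p ε aj * B k p ε' aj = 0 := by
  induction r with
  | zero => exact i.elim0
  | succ r ih =>
    rw [B_succ p ε (h 0), B_succ p ε' (h 0)]
    have hm := fun δ : Fin r → Fin 2 => B_mem_degSpan (k := k) p δ fun i => h i.succ
    refine Fin.cases (fun hd h1 h2 => ?_) (fun i hd h1 h2 => ?_) i hd h1 h2
    · rw [h1, h2]
      exact Z_one_mul_Z_one p (h 0) hd (hm _) (hm _)
    · exact Z_mul_Z_of_mul_eq_zero p (h 0) _ _ (hm _) (hm _)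
        (ih (i := i) (fun i => h i.succ) hd h1 h2)

lemma B_mul_B_of_ne {r : ℕ} (ε ε' : Fin r → Fin 2) {aj aj' : Fin r → ℕ × ℚ}
    (h : ∀ i, aj i ∈ P p) (h' : ∀ i, aj' i ∈ P p) (hne : aj ≠ aj') :
    B k p ε aj * B k p ε' aj' = 0 := by
  induction r with
  | zero => exact absurd (Subsingleton.elim _ _) hne
  | succ r ih =>
    rw [B_succ p ε (h 0), B_succ p ε' (h' 0)]
    have hm := B_mem_degSpan (k := k) p (fun i => ε i.succ) fun i => h i.succ
    have hm' := B_mem_degSpan (k := k) p (fun i => ε' i.succ) fun i => h' i.succ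
    by_cases h0 : aj 0 = aj' 0
    · rw [← h0]
      refine Z_mul_Z_of_mul_eq_zero p (h 0) _ _ hm hm'
        (ih _ _ (fun i => h i.succ) (fun i => h' i.succ) fun hc => hne ?_)
      ext1 i
      exact Fin.cases h0 (fun i => congrFun hc i) i
    · exact Z_mul_Z_of_ne p (h 0) (h' 0) h0 _ _ hm hm'

open Classical in
/-- The difference `τ - ε`. -/
noncomputable def epsCompl {r : ℕ} (aj : Fin r → ℕ × ℚ) (ε : Fin r → Fin 2) : Fin r → Fin 2 :=
  fun i => if Degenerate p (aj i) then 0 else 1 - ε i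

lemma epsCompl_mem {r : ℕ} (aj : Fin r → ℕ × ℚ) (ε : Fin r → Fin 2) :
    epsCompl p aj ε ∈ epsSet p aj := fun _ hi => if_pos hi

lemma max_epsCompl {r : ℕ} {aj : Fin r → ℕ × ℚ} {ε : Fin r → Fin 2} (hε : ε ∈ epsSet p aj) :
    (fun i => max (ε i) (epsCompl p aj ε i)) = tau p aj := by
  ext1 i
  have hmax : ∀ e : Fin 2, max e (1 - e) = 1 := by decide
  by_cases hd : Degenerate p (aj i)
  · simp [epsCompl, tau, hd, hε i hd]
  · simp [epsCompl, tau, hd, hmax]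

lemma B_mul_epsCompl_self {r : ℕ} {aj : Fin r → ℕ × ℚ} (h : ∀ i, aj i ∈ P p)
    {ε : Fin r → Fin 2} (hε : ε ∈ epsSet p aj) :
    B k p ε aj * B k p (epsCompl p aj ε) aj = B k p (tau p aj) aj := by
  have hmin : ∀ e : Fin 2, e = 0 ∨ 1 - e = 0 := by decide
  rw [B_mul_B p h, max_epsCompl p hε]
  intro i
  by_cases hd : Degenerate p (aj i)
  · exact Or.inl (hε i hd)
  · simpa [epsCompl, hd] using hmin (ε i)

lemma B_mul_epsCompl_of_not_le {r : ℕ} {aj : Fin r → ℕ × ℚ} (h : ∀ i, aj i ∈ P p)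
    {ε ε' : Fin r → Fin 2} (hε' : ε' ∈ epsSet p aj) (hle : ¬ ε' ≤ ε) :
    B k p ε' aj * B k p (epsCompl p aj ε) aj = 0 := by
  have hlt : ∀ e e' : Fin 2, e < e' → e' = 1 ∧ 1 - e = 1 := by decide
  rw [Pi.le_def, not_forall] at hle
  obtain ⟨i, hi⟩ := hle
  obtain ⟨h1, h2⟩ := hlt _ _ (not_le.mp hi)
  have hd : ¬ Degenerate p (aj i) := fun hd => by
    rw [hε' i hd] at h1
    exact absurd h1 (by decide)
  exact B_mul_B_eq_zero p h hd h1 (by simpa [epsCompl, hd] using h2)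

/-- The supports are disjoint, but their union misses an index where ε' is below ε. The product is
therefore a basis element other than B^τ, invisible to the coefficient of B^τ. -/
lemma B_mul_epsCompl_of_lt {r : ℕ} {aj : Fin r → ℕ × ℚ} (h : ∀ i, aj i ∈ P p)
    {ε ε' : Fin r → Fin 2} (hε : ε ∈ epsSet p aj) (hlt : ε' < ε) :
    ∃ δ ∈ epsSet p aj, δ ≠ tau p aj ∧
      B k p ε' aj * B k p (epsCompl p aj ε) aj = B k p δ aj := by
  have hmin : ∀ e e' : Fin 2, e' ≤ e → e' = 0 ∨ 1 - e = 0 := by decide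
  have hmax : ∀ e e' : Fin 2, e' < e → max e' (1 - e) ≠ 1 := by decide
  obtain ⟨hle, i, hi⟩ := Pi.lt_def.mp hlt
  refine ⟨fun i => max (ε' i) (epsCompl p aj ε i), fun i hd => ?_, fun hc => ?_, B_mul_B p h ?_⟩
  · have h1 : ε' i = 0 := le_antisymm ((hle i).trans (hε i hd).le) (Fin.zero_le _)
    simp [h1, epsCompl, hd]
  · have hd : ¬ Degenerate p (aj i) := fun hd => by
      rw [hε i hd] at hi
      exact absurd hi (Fin.not_lt_zero _)
    have h1 := congrFun hc i
    simp only [epsCompl, tau, hd, if_false] at h1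
    exact hmax _ _ hi h1
  · intro i
    by_cases hd : Degenerate p (aj i)
    · exact Or.inr (if_pos hd)
    · simpa [epsCompl, hd] using hmin _ _ (hle i)

/-- Linear independence of the elements `B`. -/
theorem linearIndependent_B {ι : Type*} {r : ℕ} {aj : ι → Fin r → ℕ × ℚ} {ε : ι → Fin r → Fin 2}
    (h : ∀ t i, aj t i ∈ P p) (hε : ∀ t, ε t ∈ epsSet p (aj t))
    (hinj : Function.Injective fun t => (aj t, ε t)) :
    LinearIndependent k fun t => B k p (ε t) (aj t) := by
  classical
  rw [linearIndependent_iff']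
  intro s c hsum t0 ht0
  by_contra hc0
  -- Multiplying by the complement of a minimal ε kills every other term: different tuples are
  -- orthogonal, and any remaining ε' ≠ ε satisfies ε' ≰ ε by minimality. Only a nonzero multiple of
  -- B^τ is left.
  obtain ⟨t1, ht1, hmin⟩ := Finset.exists_minimalFor ε
    (s.filter fun t => c t ≠ 0 ∧ aj t = aj t0) ⟨t0, by simp [ht0, hc0]⟩
  simp only [Finset.mem_filter] at ht1 hmin
  obtain ⟨hs1, hc1, haj1⟩ := ht1
  have h1 := congrArg (· * B k p (epsCompl p (aj t1) (ε t1)) (aj t1)) hsum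
  simp only [zero_mul, Finset.sum_mul] at h1
  rw [Finset.sum_eq_single t1, smul_mul_assoc, B_mul_epsCompl_self p (h t1) (hε t1)] at h1
  · exact (smul_ne_zero hc1 (B_ne_zero p _ (h t1))) h1
  · intro t hts hne
    rw [smul_mul_assoc]
    by_cases hct : c t = 0
    · rw [hct, zero_smul]
    by_cases hajt : aj t = aj t1
    · have hnle : ¬ ε t ≤ ε t1 := fun hle => by
        have h2 := hmin ⟨hts, hct, hajt.trans haj1⟩ hle
        exact hne (hinj (Prod.ext hajt (le_antisymm hle h2)))
      rw [hajt, B_mul_epsCompl_of_not_le p (h t1) (hajt ▸ hε t) hnle, smul_zero]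
    · rw [B_mul_B_of_ne p _ _ (h t) (h t1) hajt, smul_zero]
  · exact fun hn => absurd hs1 hn

/-- An injection of `Fin p × Fin p` into the set of pairs of an element of `P` and an admissible
exponent. -/
noncomputable def blockIndex (t : Fin p × Fin p) : (ℕ × ℚ) × Fin 2 :=
  if p = 2 then
    if (t.1 : ℕ) = 0 then ((0, 1 / 2), if (t.2 : ℕ) = 0 then 0 else 1)
    else ((1, ((t.2 : ℕ) : ℚ)), 0)
  else if 2 * (t.2 : ℕ) < p then (((t.1 : ℕ), ((t.2 : ℕ) : ℚ)), 0)
  else (((t.1 : ℕ), ((t.2 - (p - 1) / 2 : ℕ) : ℚ)), 1)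

/-- For odd p and fixed a, the p values of the second coordinate split into (p + 1)/2 indices with ε
= 0 and (p - 1)/2 indices with ε = 1 and j ≠ 0. -/
lemma blockIndex_mem (t : Fin p × Fin p) : (blockIndex p t).1 ∈ P p := by
  obtain ⟨⟨a, ha⟩, ⟨j, hj⟩⟩ := t
  by_cases h2 : p = 2
  · subst h2
    interval_cases a <;> interval_cases j <;> simp [blockIndex, P]
  · rw [blockIndex, if_neg h2, P, if_neg h2]
    dsimp only
    obtain ⟨m, hm⟩ := hp.out.odd_of_ne_two h2
    split_ifs with h
    · exact ⟨ha, j, by omega, rfl⟩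
    · exact ⟨ha, j - (p - 1) / 2, by omega, rfl⟩

lemma blockIndex_degenerate (t : Fin p × Fin p) (h : Degenerate p (blockIndex p t).1) :
    (blockIndex p t).2 = 0 := by
  obtain ⟨⟨a, ha⟩, ⟨j, hj⟩⟩ := t
  by_cases h2 : p = 2
  · subst h2
    interval_cases a <;> interval_cases j <;> simp_all [blockIndex, Degenerate]
  · rw [Degenerate, if_neg h2] at h
    rw [blockIndex, if_neg h2] at h ⊢
    dsimp only at h ⊢
    split_ifs at h ⊢ with h3
    · rfl
    · dsimp only at h
      have h4 : j - (p - 1) / 2 = 0 := by exact_mod_cast h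
      omega

lemma blockIndex_injective : Function.Injective (blockIndex p) := by
  rintro ⟨⟨a, ha⟩, ⟨j, hj⟩⟩ ⟨⟨a', ha'⟩, ⟨j', hj'⟩⟩ h
  by_cases h2 : p = 2
  · subst h2
    interval_cases a <;> interval_cases j <;> interval_cases a' <;> interval_cases j' <;>
      simp_all [blockIndex]
  · rw [blockIndex, blockIndex, if_neg h2, if_neg h2] at h
    dsimp only at h
    split_ifs at h with h3 h4 h4 <;> simp only [Prod.mk.injEq, Nat.cast_inj] at h
    · simp [h.1.1, h.1.2]
    · exact absurd h.2 (by decide)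
    · exact absurd h.2 (by decide)
    · obtain ⟨⟨h5, h6⟩, -⟩ := h
      have h7 : j = j' := by omega
      simp [h5, h7]

/-- The elements `B` span `A_r`. -/
theorem mem_span_B {r : ℕ} {z : U k} (hz : z ∈ Ar k p r) :
    z ∈ Submodule.span k (Set.range fun t : Fin r → Fin p × Fin p =>
      B k p (fun i => (blockIndex p (t i)).2) (fun i => (blockIndex p (t i)).1)) := by
  have hli : LinearIndependent k fun t : Fin r → Fin p × Fin p =>
      B k p (fun i => (blockIndex p (t i)).2) (fun i => (blockIndex p (t i)).1) := by
    refine linearIndependent_B p (fun t i => blockIndex_mem p (t i))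
      (fun t i => blockIndex_degenerate p (t i)) fun t t' htt => ?_
    simp only [Prod.mk.injEq] at htt
    ext1 i
    exact blockIndex_injective p (Prod.ext (congrFun htt.1 i) (congrFun htt.2 i))
  have hle : Submodule.span k (Set.range fun t : Fin r → Fin p × Fin p =>
      B k p (fun i => (blockIndex p (t i)).2) (fun i => (blockIndex p (t i)).1)) ≤
      Submodule.span k (degBox k p r : Set (U k)) := by
    rw [Submodule.span_le]
    rintro _ ⟨t, rfl⟩
    exact (mem_Ar_iff p).mp (B_mem_Ar p _ fun i => blockIndex_mem p (t i))
  have hfin : FiniteDimensional k (Submodule.span k (degBox k p r : Set (U k))) :=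
    FiniteDimensional.span_finset k _
  -- The independent family has p^{2r} members, which is the upper bound for the dimension of A_r.
  rw [mem_Ar_iff, ← Submodule.eq_of_le_of_finrank_le hle ?_] at hz
  · exact hz
  · rw [finrank_span_eq_card hli]
    refine (finrank_span_finset_le_card _).trans ((degBox_card_le p r).trans ?_)
    simp [sq]

lemma B_mul_E {r : ℕ} (ε : Fin r → Fin 2) {aj : Fin r → ℕ × ℚ} (h : ∀ i, aj i ∈ P p) :
    B k p ε aj * E k p aj = B k p ε aj := by
  rw [E, B_mul_B p h fun i => Or.inr rfl]
  congr 1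
  ext1 i
  exact max_eq_left (Fin.zero_le _)

/-- E annihilates the B's of other tuples and fixes those of its own, so it projects the spanning
set of A_r onto one block. -/
lemma mul_E_mem_span {r : ℕ} {aj : Fin r → ℕ × ℚ} (h : ∀ i, aj i ∈ P p) {z : U k}
    (hz : z ∈ Ar k p r) : z * E k p aj ∈
      Submodule.span k (Set.range fun ε : epsSet p aj => B k p (ε : Fin r → Fin 2) aj) := by
  have hle : Submodule.span k (Set.range fun t : Fin r → Fin p × Fin p =>
      B k p (fun i => (blockIndex p (t i)).2) (fun i => (blockIndex p (t i)).1)) ≤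
      (Submodule.span k (Set.range fun ε : epsSet p aj => B k p (ε : Fin r → Fin 2) aj)).comap
        (LinearMap.mulRight k (E k p aj)) := by
    rw [Submodule.span_le]
    rintro _ ⟨t, rfl⟩
    rw [SetLike.mem_coe, Submodule.mem_comap, LinearMap.mulRight_apply]
    by_cases hj : (fun i => (blockIndex p (t i)).1) = aj
    · dsimp only
      rw [hj, B_mul_E p _ h]
      refine Submodule.subset_span ⟨⟨fun i => (blockIndex p (t i)).2, fun i hi => ?_⟩, rfl⟩
      rw [← hj] at hi
      exact blockIndex_degenerate p _ hi
    · rw [E, B_mul_B_of_ne p _ _ (fun i => blockIndex_mem p (t i)) h hj]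
      exact zero_mem _
  exact hle (mem_span_B p hz)

end Tuples

end SL2Hyper

namespace SL2Hyper

/-! ### The corner algebra A_r · E and its symmetrizing form. -/

section Corner

set_option linter.unusedSectionVars false

variable {k : Type*} [Field k] {p : ℕ} [hp : Fact p.Prime] [CharP k p] {r : ℕ}
  {aj : Fin r → ℕ × ℚ}

variable (k) in
lemma E_mem_Ar (h : ∀ i, aj i ∈ P p) : E k p aj ∈ Ar k p r := B_mem_Ar p _ h

lemma isIdempotentElem_E (h : ∀ i, aj i ∈ P p) :
    IsIdempotentElem (⟨E k p aj, E_mem_Ar k h⟩ : Ar k p r) :=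
  Subtype.ext (B_mul_E p _ h)

lemma Ar_mul_comm (x y : Ar k p r) : x * y = y * x :=
  Subtype.ext (degSpan_commute (degSpan_of_mem_Ar p x.2) (degSpan_of_mem_Ar p y.2)).eq

lemma mem_corner_Ar_iff {e : Ar k p r} (he : IsIdempotentElem e) (x : Ar k p r) :
    x ∈ Subsemigroup.corner e ↔ x * e = x := by
  rw [Subsemigroup.mem_corner_iff he, Ar_mul_comm e x, and_self]

lemma corner_mul_comm {e : Ar k p r} (he : IsIdempotentElem e) (x y : he.Corner) :
    x * y = y * x := Subtype.ext (Ar_mul_comm x.1 y.1)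

/-- The inclusion of a corner ring of `A_r`. -/
noncomputable def cornerIncl {e : Ar k p r} (he : IsIdempotentElem e) : he.Corner →ₗ[k] U k where
  toFun x := (x.1 : U k)
  map_add' _ _ := rfl
  map_smul' _ _ := rfl

lemma cornerIncl_injective {e : Ar k p r} (he : IsIdempotentElem e) :
    Function.Injective (cornerIncl he) := fun _ _ h => Subtype.ext (Subtype.ext h)

variable (k) in
/-- The elements `B ε aj` as elements of the corner ring. -/
noncomputable def cornerB (h : ∀ i, aj i ∈ P p) (ε : epsSet p aj) :
    (isIdempotentElem_E (k := k) h).Corner :=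
  ⟨⟨B k p (ε : Fin r → Fin 2) aj, B_mem_Ar p _ h⟩,
    (mem_corner_Ar_iff (isIdempotentElem_E h) _).mpr (Subtype.ext (B_mul_E p _ h))⟩

lemma linearIndependent_cornerB (h : ∀ i, aj i ∈ P p) : LinearIndependent k (cornerB k h) := by
  refine LinearIndependent.of_comp (cornerIncl (isIdempotentElem_E h)) ?_
  exact linearIndependent_B p (ι := epsSet p aj) (aj := fun _ => aj) (ε := fun ε => ε)
    (fun _ => h) (fun ε => ε.2) fun ε ε' hεε => Subtype.ext (congrArg Prod.snd hεε)

lemma span_cornerB (h : ∀ i, aj i ∈ P p) : ⊤ ≤ Submodule.span k (Set.range (cornerB k h)) := by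
  intro x _
  have hx : (x.1 : U k) * E k p aj = x.1 :=
    congrArg Subtype.val ((mem_corner_Ar_iff (isIdempotentElem_E h) x.1).mp x.2)
  have h1 := mul_E_mem_span p h x.1.2
  rw [hx] at h1
  have h2 : (Set.range fun ε : epsSet p aj => B k p (ε : Fin r → Fin 2) aj) =
      cornerIncl (isIdempotentElem_E (k := k) h) '' Set.range (cornerB k h) := by
    rw [← Set.range_comp]
    rfl
  rw [h2, ← Submodule.map_span] at h1
  obtain ⟨y, hy, hyx⟩ := h1
  rwa [← cornerIncl_injective _ hyx]

variable (k) in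
/-- The basis of `A_r · E(aj)` formed by the elements `B ε aj`. -/
noncomputable def cornerBasis (h : ∀ i, aj i ∈ P p) :
    Module.Basis (epsSet p aj) k (isIdempotentElem_E (k := k) h).Corner :=
  Module.Basis.mk (linearIndependent_cornerB h) (span_cornerB h)

lemma cornerBasis_apply (h : ∀ i, aj i ∈ P p) (ε : epsSet p aj) :
    cornerBasis k h ε = cornerB k h ε := Module.Basis.mk_apply _ _ _

lemma coord_cornerB (h : ∀ i, aj i ∈ P p) (ε ε' : epsSet p aj) [Decidable (ε' = ε)] :
    (cornerBasis k h).coord ε (cornerB k h ε') = if ε' = ε then 1 else 0 := by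
  rw [← cornerBasis_apply, Module.Basis.coord_apply, Module.Basis.repr_self, Finsupp.single_apply]

/-- Under the form (x, y) ↦ coefficient of B^τ in xy, the elements B^{τ-ε} are dual to the B^ε. All
coordinates of x can thus be recovered from the form on the ideal generated by x, which gives
nondegeneracy. -/
lemma coord_tau_mul (h : ∀ i, aj i ∈ P p) (ε : epsSet p aj)
    (x : (isIdempotentElem_E (k := k) h).Corner) :
    (cornerBasis k h).coord (tau p aj) (cornerB k h ⟨_, epsCompl_mem p aj ε⟩ * x) =
      (cornerBasis k h).coord ε x := by
  classical
  have hlin : (cornerBasis k h).coord (tau p aj) ∘ₗ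
      LinearMap.mulLeft k (cornerB k h ⟨_, epsCompl_mem p aj ε⟩) = (cornerBasis k h).coord ε := by
    refine (cornerBasis k h).ext fun ε' => ?_
    rw [cornerBasis_apply, coord_cornerB, LinearMap.comp_apply, LinearMap.mulLeft_apply,
      corner_mul_comm]
    split_ifs with hεε
    · subst hεε
      have e : cornerB k h ε' * cornerB k h ⟨_, epsCompl_mem p aj ε'⟩ = cornerB k h (tau p aj) :=
        cornerIncl_injective _ (B_mul_epsCompl_self p h ε'.2)
      rw [e, coord_cornerB, if_pos rfl]
    · by_cases hle : (ε' : Fin r → Fin 2) ≤ ε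
      · obtain ⟨δ, hδ, hne, hB⟩ := B_mul_epsCompl_of_lt (k := k) p h ε.2
          (lt_of_le_of_ne hle fun hc => hεε (Subtype.ext hc))
        have e : cornerB k h ε' * cornerB k h ⟨_, epsCompl_mem p aj ε⟩ = cornerB k h ⟨δ, hδ⟩ :=
          cornerIncl_injective _ hB
        rw [e, coord_cornerB, if_neg fun hc => hne (congrArg Subtype.val hc)]
      · have e : cornerB k h ε' * cornerB k h ⟨_, epsCompl_mem p aj ε⟩ = 0 :=
          cornerIncl_injective _ (B_mul_epsCompl_of_not_le p h ε'.2 hle)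
        rw [e, map_zero]
  exact LinearMap.congr_fun hlin x

lemma isSymmetrizingForm_coord_tau (h : ∀ i, aj i ∈ P p) :
    IsSymmetrizingForm ((cornerBasis k h).coord (tau p aj)) where
  symm x y := by rw [corner_mul_comm]
  no_ideal I hI := by
    rw [eq_bot_iff]
    intro x hx
    rw [Ideal.mem_bot]
    refine (cornerBasis k h).ext_elem fun ε => ?_
    rw [map_zero, Finsupp.zero_apply, ← Module.Basis.coord_apply, ← coord_tau_mul]
    exact hI _ (I.mul_mem_left _ hx)

end Corner

end SL2Hyper

theorem theorem3p13 (k : Type*) [Field k] [IsAlgClosed k] (p : ℕ) [Fact p.Prime] [CharP k p]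
    (r : ℕ) (hr : 0 < r) (aj : Fin r → ℕ × ℚ) (haj : ∀ i, aj i ∈ SL2Hyper.P p) :
    ∃ (hE : SL2Hyper.E k p aj ∈ SL2Hyper.Ar k p r)
      (he : IsIdempotentElem (⟨SL2Hyper.E k p aj, hE⟩ : SL2Hyper.Ar k p r)),
      -- the corner ring of the idempotent, with unit `E(a,j)`, is `A_r · E(a,j)`
      (Set.range (fun x : he.Corner => (x.1 : SL2Hyper.Ar k p r)) =
        {x | ∃ z : SL2Hyper.Ar k p r, x = z * ⟨SL2Hyper.E k p aj, hE⟩}) ∧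
      IsSymmetricKAlgebra k he.Corner ∧
      ∃ b : Module.Basis (SL2Hyper.epsSet p aj) k he.Corner,
        (∀ ε : SL2Hyper.epsSet p aj,
          ((b ε).1 : SL2Hyper.U k) = SL2Hyper.B k p (ε : Fin r → Fin 2) aj) ∧
        IsSymmetrizingForm (b.coord (SL2Hyper.tau p aj)) := by
  have he := SL2Hyper.isIdempotentElem_E (k := k) haj
  have hf := SL2Hyper.isSymmetrizingForm_coord_tau (k := k) haj
  refine ⟨SL2Hyper.E_mem_Ar k haj, he, ?_, ⟨Module.Finite.of_basis (SL2Hyper.cornerBasis k haj),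
    _, hf⟩, SL2Hyper.cornerBasis k haj, fun ε => ?_, hf⟩
  · ext x
    constructor
    · rintro ⟨y, rfl⟩
      exact ⟨y.1, ((SL2Hyper.mem_corner_Ar_iff he y.1).mp y.2).symm⟩
    · rintro ⟨z, rfl⟩
      exact ⟨⟨_, (SL2Hyper.mem_corner_Ar_iff he _).mpr (by rw [mul_assoc, he.eq])⟩, rfl⟩
  · rw [SL2Hyper.cornerBasis_apply]
    rfl
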